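/- **Theorem 2.1 (WCP).** Let $N\ge 1$, let $\Omega\subset\mathbb R^N$ be a bounded domain with Lipschitz boundary, $T\in(0,\infty)$, $\Omega_\tau=\Omega\times(0,\tau)$, and $\lambda\in\mathbb R$. Let $f,g\in L^\infty(\Omega_T)$, let $u_0,v_0\in W^{1,p}(\Omega)\cap L^2(\Omega)$, and let $h_1,h_2$ be continuous on $(\overline\Omega\times\{0\})\cup(\partial\Omega\times[0,T])$. Let $u$ and $v$ be weak solutions of $$\partial_t u-\Delta_p u=\lambda|u|^{p-2}u+f \text{ in }\Omega_T,\qquad u(\cdot,0)=u_0\text{ in }\Omega,\qquad u=h_1\text{ on }\partial\Omega\times(0,T),$$ $$\partial_t v-\Delta_p v=\lambda|v|^{p-2}v+g \text{ in }\Omega_T,\qquad v(\cdot,0)=v_0\text{ in }\Omega,\qquad v=h_2\text{ on }\partial\Omega\times(0,T).$$ Here a weak solution of the first problem is a measurable $u\in C([0,T]\to L^2(\Omega))\cap L^p((0,T)\to W^{1,p}(\Omega))$ with $u(\cdot,0)=u_0$ a.e. in $\Omega$, whose trace on $\partial\Omega$ is $h_1(\cdot,t)$ for a.e. $t\in(0,T)$,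 and such that $$\int_\Omega u\varphi\,dx\Big|_{t=0}^{t=\tau}+\int_{\Omega_\tau}\left(-u\,\partial_t\varphi+|\nabla_xu|^{p-2}\langle\nabla_xu,\nabla_x\varphi\rangle\right)dx\,dt=\lambda\int_{\Omega_\tau}|u|^{p-2}u\varphi\,dx\,dt+\int_{\Omega_\tau}f\varphi\,dx\,dt$$ for every $\tau\in(0,T]$ and every $\varphi\in W^{1,2}((0,\tau)\to L^2(\Omega))\cap L^p((0,\tau)\to W^{1,p}_0(\Omega))$; weak solutions of the second problem are defined in the same way. Let $E\subseteq\Omega_T$ be a subdomain (a nonempty connected open subset) with $f\le g$ a.e. in $E$, and assume that either (i) $p>1$ and $\lambda\le 0$; or (ii) $p>2$, $\lambda>0$, and $u,v\in L^\infty(E)$. If $u\le v$ a.e. in $(\overline\Omega\times[0,T))\setminus E$, that is, $u\le v$ a.e. in $\Omega_T\setminus E$, $u_0\le v_0$ a.e. in $\Omega$, and, for a.e. $t\in(0,T)$, $h_1(\cdot,t)\le h_2(\cdot,t)$ a.e. on $\partial\Omega$ with respect to the $(N-1)$-dimensional Hausdorff measure, then $u\le v$ throughout $E$: $u\le v$ a.e.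 in $E$, and moreover, for every $t\in(0,T)$, $u(x,t)\le v(x,t)$ for a.e. $x\in\Omega$ with $(x,t)\in E$. -/

import Mathlib

open MeasureTheory Set Filter Topology
open scoped ENNReal NNReal ContDiff

namespace PLaplace

/-- `ℝ^N` with the Euclidean norm. -/
abbrev RN (N : ℕ) := EuclideanSpace ℝ (Fin N)

variable {N : ℕ}

/-- The boundary of `Ω` is locally the graph of a Lipschitz function, with `Ω` on one side of it:
near each boundary point there are a unit vector `e` and a Lipschitz function `γ` of the component
of `y` orthogonal to `e` such that `Ω` is the set of the `y` lying strictly above the graph. -/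
def HasLipschitzBoundary (Ω : Set (RN N)) : Prop :=
  ∀ x₀ ∈ frontier Ω, ∃ (e : RN N) (γ : RN N → ℝ) (K : ℝ≥0) (r : ℝ),
    ‖e‖ = 1 ∧ LipschitzWith K γ ∧ 0 < r ∧
    ∀ y ∈ Metric.ball x₀ r, (y ∈ Ω ↔ γ (y - (inner ℝ e y : ℝ) • e) < inner ℝ e y)

/-- A bounded domain with Lipschitz boundary. -/
structure IsBoundedLipschitzDomain (Ω : Set (RN N)) : Prop where
  isOpen : IsOpen Ω
  isConnected : IsConnected Ω
  isBounded : Bornology.IsBounded Ω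
  lipschitz : HasLipschitzBoundary Ω

/-- The open parabolic cylinder `Ω × (0, T)`. -/
def cyl (Ω : Set (RN N)) (T : ℝ) : Set (RN N × ℝ) := Ω ×ˢ Ioo 0 T

/-- The set `(closure Ω × {0}) ∪ (∂Ω × [0, T])`. -/
def parabolicBoundary (Ω : Set (RN N)) (T : ℝ) : Set (RN N × ℝ) :=
  (closure Ω ×ˢ {0}) ∪ (frontier Ω ×ˢ Icc 0 T)

/-- The surface measure on `∂Ω`: the `(N - 1)`-dimensional Hausdorff measure. -/
noncomputable def surfaceMeasure (Ω : Set (RN N)) : Measure (RN N) :=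
  (Measure.hausdorffMeasure ((N : ℝ) - 1)).restrict (frontier Ω)

/-- `G` is the weak (distributional) gradient of `w` in the open set `Ω`. -/
structure HasWeakGradient (Ω : Set (RN N)) (w : RN N → ℝ) (G : RN N → RN N) : Prop where
  locInt : LocallyIntegrableOn w Ω
  locInt_grad : LocallyIntegrableOn G Ω
  integral_eq : ∀ η : RN N → ℝ, ContDiff ℝ ∞ η → HasCompactSupport η → tsupport η ⊆ Ω →
    ∀ e : RN N, ∫ x in Ω, w x * fderiv ℝ η x e = - ∫ x in Ω, inner ℝ (G x) e * η x

/-- `w ∈ W^{1,p}(Ω)`, with weak gradient `G`. -/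
structure MemW1p (Ω : Set (RN N)) (p : ℝ) (w : RN N → ℝ) (G : RN N → RN N) : Prop where
  memLp : MemLp w (ENNReal.ofReal p) (volume.restrict Ω)
  memLp_grad : MemLp G (ENNReal.ofReal p) (volume.restrict Ω)
  weakGrad : HasWeakGradient Ω w G

/-- `w ∈ W_0^{1,p}(Ω)`, with weak gradient `G`: `w` lies in the closure of `C_c^∞(Ω)` in
`W^{1,p}(Ω)`. -/
structure MemW1p₀ (Ω : Set (RN N)) (p : ℝ) (w : RN N → ℝ) (G : RN N → RN N) : Prop
    extends MemW1p Ω p w G where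
  approx : ∃ η : ℕ → RN N → ℝ,
    (∀ n, ContDiff ℝ ∞ (η n) ∧ HasCompactSupport (η n) ∧ tsupport (η n) ⊆ Ω) ∧
    Tendsto (fun n => eLpNorm (fun x => η n x - w x) (ENNReal.ofReal p) (volume.restrict Ω))
      atTop (𝓝 0) ∧
    Tendsto (fun n => eLpNorm (fun x => gradient (η n) x - G x) (ENNReal.ofReal p)
      (volume.restrict Ω)) atTop (𝓝 0)

/-- `k` is the trace on `∂Ω` of the function `w ∈ W^{1,p}(Ω)` with weak gradient `G`. The trace
operator is the continuous extension to `W^{1,p}(Ω)` of the restriction `w ↦ w|_∂Ω`, from functions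
smooth up to the boundary, with values in `L^p(∂Ω)`. -/
def HasTrace (Ω : Set (RN N)) (p : ℝ) (w : RN N → ℝ) (G : RN N → RN N) (k : RN N → ℝ) : Prop :=
  ∃ η : ℕ → RN N → ℝ, (∀ n, ContDiff ℝ ∞ (η n)) ∧
    Tendsto (fun n => eLpNorm (fun x => η n x - w x) (ENNReal.ofReal p) (volume.restrict Ω))
      atTop (𝓝 0) ∧
    Tendsto (fun n => eLpNorm (fun x => gradient (η n) x - G x) (ENNReal.ofReal p)
      (volume.restrict Ω)) atTop (𝓝 0) ∧
    Tendsto (fun n => eLpNorm (fun x => η n x - k x) (ENNReal.ofReal p) (surfaceMeasure Ω))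
      atTop (𝓝 0)

/-- `t ↦ w(·, t)` belongs to `C([0, T] → L²(Ω))`. -/
structure ContinuousL2 (Ω : Set (RN N)) (T : ℝ) (w : RN N × ℝ → ℝ) : Prop where
  memLp : ∀ t ∈ Icc 0 T, MemLp (fun x => w (x, t)) 2 (volume.restrict Ω)
  tendsto : ∀ s ∈ Icc 0 T,
    Tendsto (fun t => eLpNorm (fun x => w (x, t) - w (x, s)) 2 (volume.restrict Ω))
      (𝓝[Icc 0 T] s) (𝓝 0)

/-- `w ∈ L^p((0, T) → W^{1,p}(Ω))`, with spatial weak gradient `G`. -/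
structure MemLpW1p (Ω : Set (RN N)) (T p : ℝ) (w : RN N × ℝ → ℝ) (G : RN N × ℝ → RN N) :
    Prop where
  memLp : MemLp w (ENNReal.ofReal p) (volume.restrict (cyl Ω T))
  memLp_grad : MemLp G (ENNReal.ofReal p) (volume.restrict (cyl Ω T))
  slice : ∀ᵐ t ∂(volume.restrict (Ioo 0 T)), MemW1p Ω p (fun x => w (x, t)) (fun x => G (x, t))

/-- `φ ∈ W^{1,2}((0, τ) → L²(Ω))`, with weak time derivative `ψ`; `φ` is the representative that is
continuous from `[0, τ]` to `L²(Ω)`, so that its values at the times `0` and `τ` make sense. -/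
structure MemW12L2 (Ω : Set (RN N)) (τ : ℝ) (φ ψ : RN N × ℝ → ℝ) : Prop where
  memLp : MemLp φ 2 (volume.restrict (cyl Ω τ))
  memLp_deriv : MemLp ψ 2 (volume.restrict (cyl Ω τ))
  continuousL2 : ContinuousL2 Ω τ φ
  weakDeriv : ∀ η : ℝ → ℝ, ContDiff ℝ ∞ η → HasCompactSupport η → tsupport η ⊆ Ioo 0 τ →
    ∀ᵐ x ∂(volume.restrict Ω),
      ∫ t in Ioo 0 τ, φ (x, t) * deriv η t = - ∫ t in Ioo 0 τ, ψ (x, t) * η t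

/-- `φ ∈ W^{1,2}((0, τ) → L²(Ω)) ∩ L^p((0, τ) → W_0^{1,p}(Ω))`, with weak time derivative `ψ` and
spatial weak gradient `Φ`. -/
structure IsTestFunction (Ω : Set (RN N)) (τ p : ℝ) (φ ψ : RN N × ℝ → ℝ)
    (Φ : RN N × ℝ → RN N) : Prop where
  time : MemW12L2 Ω τ φ ψ
  space : MemLpW1p Ω τ p φ Φ
  zero_boundary : ∀ᵐ t ∂(volume.restrict (Ioo 0 τ)),
    MemW1p₀ Ω p (fun x => φ (x, t)) (fun x => Φ (x, t))

/-- `u` is a weak solution of `∂_t u - Δ_p u = lam |u|^{p-2} u + f` in `Ω × (0, T)` with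
`u(·, 0) = u₀` in `Ω` and `u = h` on `∂Ω × (0, T)`. Here `G` is the spatial gradient of `u`
(unique up to null sets). -/
def IsWeakSolution (Ω : Set (RN N)) (T p lam : ℝ) (f : RN N × ℝ → ℝ) (u₀ : RN N → ℝ)
    (h : RN N × ℝ → ℝ) (u : RN N × ℝ → ℝ) : Prop :=
  ContinuousL2 Ω T u ∧
  (∀ᵐ x ∂(volume.restrict Ω), u (x, 0) = u₀ x) ∧
  ∃ G : RN N × ℝ → RN N,
    MemLpW1p Ω T p u G ∧
    (∀ᵐ t ∂(volume.restrict (Ioo 0 T)),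
      HasTrace Ω p (fun x => u (x, t)) (fun x => G (x, t)) (fun x => h (x, t))) ∧
    ∀ τ ∈ Ioc 0 T, ∀ (φ ψ : RN N × ℝ → ℝ) (Φ : RN N × ℝ → RN N),
      IsTestFunction Ω τ p φ ψ Φ →
      ((∫ x in Ω, u (x, τ) * φ (x, τ)) - ∫ x in Ω, u (x, 0) * φ (x, 0)) +
          ∫ z in cyl Ω τ, (-(u z * ψ z) + ‖G z‖ ^ (p - 2) * inner ℝ (G z) (Φ z)) =
        lam * (∫ z in cyl Ω τ, |u z| ^ (p - 2) * u z * φ z) + ∫ z in cyl Ω τ, f z * φ z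

end PLaplace

/-!
The difference `w = u - v` of the two solutions is tested with `trunc w`, a bounded `C¹` truncation
of the positive part `w⁺` that vanishes for `w ≤ 0`. With the primitive `truncPrim` of `trunc`, this
gives, for the energy `Y(t) = ∫_Ω truncPrim (w(·, t))` at every time `τ`,
`Y(τ) + ∫ trunc'(w) ⟨|∇u|^{p-2}∇u - |∇v|^{p-2}∇v, ∇u - ∇v⟩`
`≤ ∫ (lam (|u|^{p-2}u - |v|^{p-2}v) + f - g) trunc w`, with the integrals over `Ω × (0, τ)`. The
gradient term is nonnegative. The integrand on the right vanishes where `u ≤ v`, hence outside `E`.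
In `E` it is nonpositive if `lam ≤ 0`. If `lam > 0` and `p > 2`, then `s ↦ |s|^{p-2}s` is Lipschitz
on the range of `u` and `v`, and `s · trunc s ≤ 3 truncPrim s` bounds the integrand by a multiple of
`truncPrim w`. Hence `Y(τ) ≤ C ∫₀^τ Y`, so that `Y = 0` by Grönwall's inequality and the continuity
of `Y`, and `w ≤ 0` at every time.

Two points need work before `trunc w` can play the role of a test function.

* The boundary values. Since the trace of `w(·, t)` is at most zero, `trunc (w(·, t))` extended by
  zero has a weak gradient in all of `ℝ^N` (`hasZeroExtensionGradient_of_trace_le`). Let `θ_n` be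
  smooth functions converging to `w(·, t)` in `W^{1,p}(Ω)`, with boundary values converging to the
  trace. Then `trunc θ_n → 0` in `L^p(∂Ω)`, and the boundary term in the integration by parts for
  `trunc θ_n` is bounded by the norm in `L^p(∂Ω)` (`exists_fluxBound`): on the lines in a fixed
  direction transversal to the boundary, the fundamental theorem of calculus leaves the value at
  the crossing point, and the projection along these lines does not increase Hausdorff measure. No
  trace theorem or Gauss–Green formula is needed. A function whose extension by zero has a weak
  gradient lies in `W_0^{1,p}(Ω)`: it is localized by cutoffs, shifted into `Ω` and mollified
  (`HasZeroExtensionGradient.memW1p₀`).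
* The time derivative. `w` has none in `L²`, so the test functions are the forward averages
  `h⁻¹ ∫_t^{t+h} trunc (w(·, s)) ds`, where `trunc w` is extended by zero beyond `τ`
  (`isTestFunction_timeAverage`). The term with the time derivative is a difference quotient, and
  the tangent line inequality for the convex function `truncPrim` bounds it from below by an average
  of the energy over `(τ - h, τ)` (`energy_le_integral_mul_difference`). Letting `h → 0` gives
  `energy_inequality`.
-/

namespace PLaplace

variable {N : ℕ}

/-! ### Averages of translates in `L^p` -/

/-- Minkowski's integral inequality for a probability measure, with a uniform bound on the
slices. -/
lemma eLpNorm_integral_le {α β F : Type*} [MeasurableSpace α] [MeasurableSpace β]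
    [NormedAddCommGroup F] [NormedSpace ℝ F] {μ : Measure α} [SFinite μ] {ν : Measure β}
    [IsProbabilityMeasure ν] {p : ℝ≥0∞} (hp : 1 ≤ p) (hp' : p ≠ ⊤) {f : α → β → F}
    (hf : StronglyMeasurable (Function.uncurry f)) {C : ℝ≥0∞}
    (h : ∀ᵐ z ∂ν, eLpNorm (fun x => f x z) p μ ≤ C) :
    eLpNorm (fun x => ∫ z, f x z ∂ν) p μ ≤ C := by
  have hp0 : p ≠ 0 := (zero_lt_one.trans_le hp).ne'
  have hpr : 0 < p.toReal := ENNReal.toReal_pos hp0 hp'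
  have hpt : ∀ x, ‖∫ z, f x z ∂ν‖ₑ ^ p.toReal ≤ ∫⁻ z, ‖f x z‖ₑ ^ p.toReal ∂ν := by
    intro x
    have hx : StronglyMeasurable (f x) := hf.comp_measurable measurable_prodMk_left
    have h1 : ‖∫ z, f x z ∂ν‖ₑ ≤ eLpNorm (f x) p ν :=
      (enorm_integral_le_lintegral_enorm _).trans
        ((eLpNorm_one_eq_lintegral_enorm (μ := ν) (f := f x)).symm.le.trans
          (eLpNorm_le_eLpNorm_of_exponent_le hp hx.aestronglyMeasurable))
    rw [eLpNorm_eq_lintegral_rpow_enorm_toReal hp0 hp'] at h1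
    calc _ ≤ _ := ENNReal.rpow_le_rpow h1 hpr.le
      _ = _ := by rw [← ENNReal.rpow_mul, one_div, inv_mul_cancel₀ hpr.ne', ENNReal.rpow_one]
  rw [eLpNorm_eq_lintegral_rpow_enorm_toReal hp0 hp', one_div]
  rw [ENNReal.rpow_inv_le_iff hpr]
  have hm : Measurable (Function.uncurry fun x z => ‖f x z‖ₑ ^ p.toReal) :=
    (hf.enorm.pow_const _)
  calc ∫⁻ x, ‖∫ z, f x z ∂ν‖ₑ ^ p.toReal ∂μ
      ≤ ∫⁻ x, ∫⁻ z, ‖f x z‖ₑ ^ p.toReal ∂ν ∂μ := lintegral_mono hpt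
    _ = ∫⁻ z, ∫⁻ x, ‖f x z‖ₑ ^ p.toReal ∂μ ∂ν := lintegral_lintegral_swap hm.aemeasurable
    _ ≤ ∫⁻ z, C ^ p.toReal ∂ν := by
        refine lintegral_mono_ae (h.mono fun z hz => ?_)
        rwa [eLpNorm_eq_lintegral_rpow_enorm_toReal hp0 hp', one_div,
          ENNReal.rpow_inv_le_iff hpr] at hz
    _ = C ^ p.toReal := by simp

section Translation

variable {V F : Type*} [NormedAddCommGroup V] [NormedSpace ℝ V] [FiniteDimensional ℝ V]
  [MeasurableSpace V] [BorelSpace V] {μ : Measure V} [μ.IsAddHaarMeasure]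
  [NormedAddCommGroup F] {p : ℝ≥0∞}

/-- Translation is continuous in `L^p`, `1 ≤ p < ∞`. -/
lemma tendsto_eLpNorm_translate_sub (hp : 1 ≤ p) (hp' : p ≠ ⊤) {f : V → F} (hf : MemLp f p μ) :
    Tendsto (fun z => eLpNorm (fun x => f (x + z) - f x) p μ) (𝓝 0) (𝓝 0) := by
  have : Fact (1 ≤ p) := ⟨hp⟩
  let g : V → C(V, V) := (ContinuousMap.mk (fun a : V × V => a.2 + a.1) (by fun_prop)).curry
  have hg : Continuous g := ContinuousMap.continuous _
  have hgm : ∀ z, MeasurePreserving (g z) μ μ := fun z => measurePreserving_add_right μ z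
  have h := (continuous_const (y := hf.toLp f)).compMeasurePreservingLp hg hgm hp'
  have h0 := h.tendsto 0
  have h1 := (tendsto_iff_edist_tendsto_0.1 h0)
  refine h1.congr fun z => ?_
  rw [Lp.edist_def]
  refine eLpNorm_congr_ae ?_
  have e1 := Lp.coeFn_compMeasurePreserving (hf.toLp f) (hgm z)
  have e2 := Lp.coeFn_compMeasurePreserving (hf.toLp f) (hgm 0)
  have e3 := (hgm z).quasiMeasurePreserving.ae_eq_comp hf.coeFn_toLp
  have e4 := (hgm 0).quasiMeasurePreserving.ae_eq_comp hf.coeFn_toLp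
  filter_upwards [e1, e2, e3, e4] with x h1 h2 h3 h4
  simp only [Pi.sub_apply, h1, h2, h3, h4]
  simp [g]

lemma eLpNorm_translate_average_le [NormedSpace ℝ F] (hp : 1 ≤ p) (hp' : p ≠ ⊤) {f : V → F}
    (hf : StronglyMeasurable f) (ν : Measure V) [IsProbabilityMeasure ν] :
    eLpNorm (fun x => ∫ z, f (x + z) ∂ν) p μ ≤ eLpNorm f p μ := by
  refine eLpNorm_integral_le hp hp' (f := fun x z => f (x + z))
    (hf.comp_measurable measurable_add) (.of_forall fun z => ?_)
  exact (eLpNorm_comp_measurePreserving hf.aestronglyMeasurable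
    (measurePreserving_add_right μ z)).le

/-- Averages of translates of `f ∈ L^p` converge to `f` in `L^p` when the averaging measures
concentrate at the origin. -/
lemma tendsto_eLpNorm_translate_average_sub [NormedSpace ℝ F] [CompleteSpace F]
    (hp : 1 ≤ p) (hp' : p ≠ ⊤) {f : V → F}
    (hf : StronglyMeasurable f) (hfp : MemLp f p μ) (ν : ℕ → Measure V)
    [∀ n, IsProbabilityMeasure (ν n)]
    (hν : ∀ U ∈ 𝓝 (0 : V), ∀ᶠ n in atTop, ∀ᵐ z ∂(ν n), z ∈ U)
    (hint : ∀ n, ∀ᵐ x ∂μ, Integrable (fun z => f (x + z)) (ν n)) :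
    Tendsto (fun n => eLpNorm (fun x => (∫ z, f (x + z) ∂(ν n)) - f x) p μ) atTop (𝓝 0) := by
  rw [ENNReal.tendsto_nhds_zero]
  intro ε hε
  have h1 := (ENNReal.tendsto_nhds_zero.1 (tendsto_eLpNorm_translate_sub hp hp' hfp)) ε hε
  filter_upwards [hν _ h1] with n hn
  have : eLpNorm (fun x => (∫ z, f (x + z) ∂(ν n)) - f x) p μ
      = eLpNorm (fun x => ∫ z, (f (x + z) - f x) ∂(ν n)) p μ := by
    refine eLpNorm_congr_ae ((hint n).mono fun x hx => ?_)
    simp only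
    rw [integral_sub hx (integrable_const _)]; simp
  rw [this]
  refine eLpNorm_integral_le hp hp' (f := fun x z => f (x + z) - f x) ?_ hn
  exact (hf.comp_measurable measurable_add).sub (hf.comp_measurable measurable_fst)

end Translation

/-! ### Localization of test functions -/

/-- A property of smooth compactly supported functions which is stable under sums and holds for
functions supported in small balls holds for all of them. -/
lemma smooth_compact_induction {Q : (RN N → ℝ) → Prop} (zero : Q 0)
    (add : ∀ η₁ η₂ : RN N → ℝ, Q η₁ → Q η₂ → Q (η₁ + η₂))
    (loc : ∀ x : RN N, ∃ r > 0, ∀ η : RN N → ℝ, ContDiff ℝ ∞ η → HasCompactSupport η →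
      tsupport η ⊆ Metric.ball x r → Q η)
    (η : RN N → ℝ) (hη : ContDiff ℝ ∞ η) (hc : HasCompactSupport η) : Q η := by
  choose r hr hQ using loc
  obtain ⟨ρ, hρ⟩ := SmoothPartitionOfUnity.exists_isSubordinate (modelWithCornersSelf ℝ (RN N))
    (isClosed_tsupport η) (fun x => Metric.ball x (r x)) (fun x => Metric.isOpen_ball)
    (fun x _ => mem_iUnion.2 ⟨x, Metric.mem_ball_self (hr x)⟩)
  have hfin : {i | (Function.support (ρ i) ∩ tsupport η).Nonempty}.Finite :=
    ρ.locallyFinite.finite_nonempty_inter_compact hc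
  have hsum : η = ∑ i ∈ hfin.toFinset, (fun x => ρ i x * η x) := by
    funext x
    rw [Finset.sum_apply, ← Finset.sum_mul]
    by_cases hx : x ∈ tsupport η
    · rw [← finsum_eq_sum_of_support_subset, ρ.sum_eq_one hx, one_mul]
      intro i hi
      simp only [Finite.coe_toFinset, mem_ofPred_eq]
      exact ⟨x, hi, hx⟩
    · rw [image_eq_zero_of_notMem_tsupport hx, mul_zero]
  rw [hsum]
  refine Finset.sum_induction _ Q add zero fun i _ => hQ i _ ?_ ?_ ?_
  · exact (ρ i).contMDiff.contDiff.mul hη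
  · exact hc.mul_left
  · exact (tsupport_mul_subset_left).trans (hρ i)

/-! ### Lipschitz graphs -/

/-- The height of `y` above the graph of `γ` in the direction `e`. -/
noncomputable def graphHeight (e : RN N) (γ : RN N → ℝ) (y : RN N) : ℝ :=
  (inner ℝ e y : ℝ) - γ (y - (inner ℝ e y : ℝ) • e)

lemma le_graphHeight_add {e : RN N} {γ : RN N → ℝ} {K : ℝ≥0} (hγ : LipschitzWith K γ)
    (y z : RN N) :
    graphHeight e γ y + ((inner ℝ e z : ℝ) - K * ‖z - (inner ℝ e z : ℝ) • e‖) ≤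
      graphHeight e γ (y + z) := by
  have h := hγ.dist_le_mul (y + z - (inner ℝ e (y + z) : ℝ) • e) (y - (inner ℝ e y : ℝ) • e)
  rw [dist_eq_norm, Real.norm_eq_abs] at h
  have e1 : (y + z - (inner ℝ e (y + z) : ℝ) • e) - (y - (inner ℝ e y : ℝ) • e)
      = z - (inner ℝ e z : ℝ) • e := by
    rw [inner_add_right, add_smul]; abel
  rw [dist_eq_norm, e1] at h
  have := (abs_le.1 h).2
  unfold graphHeight
  rw [inner_add_right] at *
  linarith

lemma continuous_graphHeight {e : RN N} {γ : RN N → ℝ} {K : ℝ≥0} (hγ : LipschitzWith K γ) :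
    Continuous (graphHeight e γ) := by
  unfold graphHeight
  have := hγ.continuous
  fun_prop

/-- Near a boundary point, points of the closure lie on or above the graph. -/
lemma graphHeight_nonneg_of_mem_closure {Ω : Set (RN N)} {e : RN N} {γ : RN N → ℝ} {K : ℝ≥0}
    (hγ : LipschitzWith K γ) {x₀ : RN N} {r : ℝ}
    (h : ∀ y ∈ Metric.ball x₀ r, (y ∈ Ω ↔ γ (y - (inner ℝ e y : ℝ) • e) < inner ℝ e y))
    {x : RN N} (hx : x ∈ closure Ω) (hxr : x ∈ Metric.ball x₀ r) : 0 ≤ graphHeight e γ x := by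
  have hx' : x ∈ closure (Ω ∩ Metric.ball x₀ r) :=
    Metric.isOpen_ball.closure_inter ⟨hx, hxr⟩
  refine closure_minimal (t := {y | 0 ≤ graphHeight e γ y}) ?_
    (isClosed_le continuous_const (continuous_graphHeight hγ)) hx'
  rintro y ⟨hy, hyr⟩
  exact (sub_pos.2 ((h y hyr).1 hy)).le

/-- The uniform interior cone property of a Lipschitz domain. -/
lemma exists_interior_cone {Ω : Set (RN N)} (hΩ : IsOpen Ω) (hL : HasLipschitzBoundary Ω)
    (x₀ : RN N) : ∃ (r : ℝ) (e : RN N) (c s₀ : ℝ), 0 < r ∧ 0 < c ∧ 0 < s₀ ∧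
      ∀ x ∈ closure Ω ∩ Metric.ball x₀ r, ∀ s ∈ Ioo 0 s₀, ∀ z : RN N, ‖z - s • e‖ ≤ c * s →
        x + z ∈ Ω := by
  by_cases hx : x₀ ∈ closure Ω
  swap
  · obtain ⟨r, hr, h⟩ := Metric.isOpen_iff.1 isClosed_closure.isOpen_compl x₀ hx
    exact ⟨r, 0, 1, 1, hr, one_pos, one_pos, fun x hx => (h hx.2 hx.1).elim⟩
  by_cases hx' : x₀ ∈ Ω
  · obtain ⟨r, hr, h⟩ := Metric.isOpen_iff.1 hΩ x₀ hx'
    refine ⟨r / 2, 0, 1, r / 2, by positivity, one_pos, by positivity, ?_⟩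
    rintro x ⟨-, hx⟩ s ⟨hs0, hs⟩ z hz
    apply h
    rw [smul_zero, sub_zero, one_mul] at hz
    rw [mem_ball_iff_norm] at hx ⊢
    have : x + z - x₀ = (x - x₀) + z := by abel
    rw [this]
    have := norm_add_le (x - x₀) z
    linarith
  obtain ⟨e, γ, K, r, he, hγ, hr, h⟩ := hL x₀ ⟨hx, by rwa [hΩ.interior_eq]⟩
  have hK : (0 : ℝ) ≤ K := K.2
  refine ⟨r / 2, e, 1 / (2 * (1 + 2 * K)), r / 4, by positivity, by positivity, by positivity, ?_⟩
  rintro x ⟨hxc, hxb⟩ s ⟨hs0, hs⟩ z hz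
  set c : ℝ := 1 / (2 * (1 + 2 * K)) with hc
  have hc1 : c * (1 + 2 * K) = 1 / 2 := by rw [hc]; field_simp
  have hcpos : 0 < c := by positivity
  have hcle : c ≤ 1 := by nlinarith
  set w := z - s • e with hw
  have hzw : z = w + s • e := by rw [hw]; abel
  have hee : (inner ℝ e e : ℝ) = 1 := by rw [real_inner_self_eq_norm_sq, he]; norm_num
  have hew : |(inner ℝ e w : ℝ)| ≤ ‖w‖ := by
    simpa [he] using abs_real_inner_le_norm e w
  have hez : (inner ℝ e z : ℝ) = inner ℝ e w + s := by
    rw [hzw, inner_add_right, inner_smul_right, hee, mul_one]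
  have hPz : ‖z - (inner ℝ e z : ℝ) • e‖ ≤ 2 * ‖w‖ := by
    have : z - (inner ℝ e z : ℝ) • e = w - (inner ℝ e w : ℝ) • e := by
      rw [hez, add_smul]; nth_rw 1 [hzw]; abel
    rw [this]
    refine (norm_sub_le _ _).trans ?_
    rw [norm_smul, he, mul_one, Real.norm_eq_abs]; linarith
  have hxr : x ∈ Metric.ball x₀ r := Metric.ball_subset_ball (by linarith) hxb
  have hxz : x + z ∈ Metric.ball x₀ r := by
    rw [mem_ball_iff_norm] at hxb ⊢
    have h1 : x + z - x₀ = (x - x₀) + (w + s • e) := by rw [← hzw]; abel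
    rw [h1]
    have h2 := norm_add_le (x - x₀) (w + s • e)
    have h3 := norm_add_le w (s • e)
    rw [norm_smul, he, mul_one, Real.norm_of_nonneg hs0.le] at h3
    nlinarith
  rw [h _ hxz, ← sub_pos]
  have h0 := graphHeight_nonneg_of_mem_closure hγ h hxc hxr
  have h1 := le_graphHeight_add (e := e) hγ x z
  have h2 := (abs_le.1 hew).1
  refine lt_of_lt_of_le ?_ h1
  have h3 : K * ‖z - (inner ℝ e z : ℝ) • e‖ ≤ K * (2 * ‖w‖) := by gcongr
  nlinarith

/-! ### Functions whose extension by zero is weakly differentiable -/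

/-- The extension of `w` by zero outside `Ω` has as its weak gradient in the whole space the
extension of `G` by zero: the integration by parts formula holds for test functions which need not
vanish on the boundary. -/
def HasZeroExtensionGradient (Ω : Set (RN N)) (w : RN N → ℝ) (G : RN N → RN N) : Prop :=
  ∀ η : RN N → ℝ, ContDiff ℝ ∞ η → HasCompactSupport η → ∀ e : RN N,
    ∫ x in Ω, w x * fderiv ℝ η x e = - ∫ x in Ω, inner ℝ (G x) e * η x

/-- `(w, G)` is a limit of pairs `(η, ∇η)` with `η ∈ C_c^∞(Ω)`, in the norm of `L^p(Ω)`. -/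
def IsTestLimit (Ω : Set (RN N)) (p : ℝ) (w : RN N → ℝ) (G : RN N → RN N) : Prop :=
  ∃ η : ℕ → RN N → ℝ,
    (∀ n, ContDiff ℝ ∞ (η n) ∧ HasCompactSupport (η n) ∧ tsupport (η n) ⊆ Ω) ∧
    Tendsto (fun n => eLpNorm (fun x => η n x - w x) (ENNReal.ofReal p) (volume.restrict Ω))
      atTop (𝓝 0) ∧
    Tendsto (fun n => eLpNorm (fun x => gradient (η n) x - G x) (ENNReal.ofReal p)
      (volume.restrict Ω)) atTop (𝓝 0)

lemma isTestLimit_zero (Ω : Set (RN N)) (p : ℝ) : IsTestLimit Ω p 0 0 := by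
  refine ⟨fun _ => 0, fun _ => ⟨contDiff_const, HasCompactSupport.zero, by simp⟩, ?_, ?_⟩
  · simp
  · have : gradient (0 : RN N → ℝ) = 0 := by ext1 x; simp [gradient]
    simp [this]

lemma IsTestLimit.add {Ω : Set (RN N)} {p : ℝ} (hp : 1 ≤ p) {w₁ w₂ : RN N → ℝ}
    {G₁ G₂ : RN N → RN N} (hw₁ : AEStronglyMeasurable w₁ (volume.restrict Ω))
    (hw₂ : AEStronglyMeasurable w₂ (volume.restrict Ω))
    (hG₁ : AEStronglyMeasurable G₁ (volume.restrict Ω))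
    (hG₂ : AEStronglyMeasurable G₂ (volume.restrict Ω))
    (h₁ : IsTestLimit Ω p w₁ G₁) (h₂ : IsTestLimit Ω p w₂ G₂) :
    IsTestLimit Ω p (w₁ + w₂) (G₁ + G₂) := by
  obtain ⟨η₁, hη₁, ha₁, hb₁⟩ := h₁
  obtain ⟨η₂, hη₂, ha₂, hb₂⟩ := h₂
  have hq : 1 ≤ ENNReal.ofReal p := by simpa using hp
  have hgr : ∀ {f : RN N → ℝ}, ContDiff ℝ ∞ f → Continuous (gradient f) := fun hf =>
    (LinearIsometryEquiv.continuous _).comp (hf.continuous_fderiv (by simp))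
  refine ⟨fun n => η₁ n + η₂ n, fun n => ⟨(hη₁ n).1.add (hη₂ n).1, (hη₁ n).2.1.add (hη₂ n).2.1,
    (tsupport_add _ _).trans (union_subset (hη₁ n).2.2 (hη₂ n).2.2)⟩, ?_, ?_⟩
  · refine tendsto_of_tendsto_of_tendsto_of_le_of_le tendsto_const_nhds
      (by simpa using ha₁.add ha₂) (fun _ => zero_le) fun n => ?_
    refine le_trans (le_of_eq ?_) (eLpNorm_add_le
      ((hη₁ n).1.continuous.aestronglyMeasurable.sub hw₁)
      ((hη₂ n).1.continuous.aestronglyMeasurable.sub hw₂) hq)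
    congr 1; ext x; simp; ring
  · refine tendsto_of_tendsto_of_tendsto_of_le_of_le tendsto_const_nhds
      (by simpa using hb₁.add hb₂) (fun _ => zero_le) fun n => ?_
    refine le_trans (le_of_eq ?_) (eLpNorm_add_le
      ((hgr (hη₁ n).1).aestronglyMeasurable.sub hG₁)
      ((hgr (hη₂ n).1).aestronglyMeasurable.sub hG₂) hq)
    congr 1; ext1 x
    have : gradient (η₁ n + η₂ n) x = gradient (η₁ n) x + gradient (η₂ n) x := by
      simp only [gradient]
      rw [fderiv_add ((hη₁ n).1.differentiable (by simp) x)
        ((hη₂ n).1.differentiable (by simp) x), map_add]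
    simp only [this, Pi.add_apply]; abel

/-- The gradient of a mollification is the mollification of the weak gradient. -/
lemma gradient_convolution {ψ : RN N → ℝ} {G : RN N → RN N} (hψ : LocallyIntegrable ψ)
    (hG : LocallyIntegrable G)
    (h : ∀ ζ : RN N → ℝ, ContDiff ℝ ∞ ζ → HasCompactSupport ζ → ∀ e : RN N,
      ∫ x, ψ x * fderiv ℝ ζ x e = - ∫ x, inner ℝ (G x) e * ζ x)
    {ρ : RN N → ℝ} (hρ : ContDiff ℝ ∞ ρ) (hc : HasCompactSupport ρ) :
    ContDiff ℝ ∞ (fun x => ∫ y, ψ y * ρ (x - y)) ∧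
      ∀ x, gradient (fun x => ∫ y, ψ y * ρ (x - y)) x = ∫ y, ρ (x - y) • G y := by
  have hconv : (fun x => ∫ y, ψ y * ρ (x - y)) =
      convolution ψ ρ (ContinuousLinearMap.lsmul ℝ ℝ) volume := by
    ext x; simp [convolution_def]
  rw [hconv]
  refine ⟨hc.contDiff_convolution_right _ hψ hρ, fun x => ?_⟩
  refine ext_inner_right ℝ fun e => ?_
  have hd := (hc.hasFDerivAt_convolution_right (ContinuousLinearMap.lsmul ℝ ℝ) hψ
    (hρ.of_le (by simp)) x).fderiv
  have hint : Integrable fun y => ρ (x - y) • G y := by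
    have h1 : Continuous fun y => ρ (x - y) := hρ.continuous.comp (by fun_prop)
    have h2 : HasCompactSupport fun y => ρ (x - y) :=
      hc.comp_homeomorph (Homeomorph.subLeft x)
    exact hG.integrable_smul_left_of_hasCompactSupport h1 h2
  have hxc : ContDiff ℝ ∞ fun y => ρ (x - y) := hρ.comp (contDiff_const.sub contDiff_id)
  have hxs : HasCompactSupport fun y => ρ (x - y) := hc.comp_homeomorph (Homeomorph.subLeft x)
  rw [gradient, InnerProductSpace.toDual_symm_apply, hd,
    convolution_precompR_apply _ hψ (hc.fderiv ℝ) (hρ.continuous_fderiv (by simp)),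
    real_inner_comm, ← integral_inner hint, convolution_def]
  have hh := h _ hxc hxs e
  have hf : ∀ y, fderiv ℝ (fun y => ρ (x - y)) y e = - fderiv ℝ ρ (x - y) e := by
    intro y
    have h1 : HasFDerivAt (fun y => x - y) (-(ContinuousLinearMap.id ℝ (RN N))) y :=
      (hasFDerivAt_id y).const_sub x
    have h2 := ((hρ.differentiable (by simp)) (x - y)).hasFDerivAt.comp y h1
    have h3 : fderiv ℝ (fun y => ρ (x - y)) y = _ := h2.fderiv
    rw [h3]; simp
  simp only [hf, mul_neg, integral_neg, neg_inj] at hh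
  simp only [ContinuousLinearMap.lsmul_apply, smul_eq_mul]
  rw [hh]
  congr 1; ext y
  rw [inner_smul_right, real_inner_comm, mul_comm]

/-- Convolution with an approximate identity converges in `L^p`. -/
lemma tendsto_eLpNorm_convolution_sub {F : Type*} [NormedAddCommGroup F] [NormedSpace ℝ F]
    [CompleteSpace F] {q : ℝ≥0∞} (hq : 1 ≤ q) (hq' : q ≠ ⊤) {f : RN N → F}
    (hf : StronglyMeasurable f) (hfq : MemLp f q) {ρ : ℕ → RN N → ℝ}
    (hρ : ∀ n, Continuous (ρ n)) (hc : ∀ n, HasCompactSupport (ρ n)) (h0 : ∀ n x, 0 ≤ ρ n x)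
    (h1 : ∀ n, ∫ x, ρ n x = 1)
    (hs : ∀ U ∈ 𝓝 (0 : RN N), ∀ᶠ n in atTop, ∀ z, ρ n z ≠ 0 → z ∈ U) :
    Tendsto (fun n => eLpNorm (fun x => (∫ y, ρ n (x - y) • f y) - f x) q volume)
      atTop (𝓝 0) := by
  let ν : ℕ → Measure (RN N) := fun n =>
    volume.withDensity fun z => ENNReal.ofReal (ρ n (-z))
  have hm : ∀ n, Measurable fun z => ENNReal.ofReal (ρ n (-z)) := fun n =>
    (((hρ n).comp continuous_neg).measurable).ennreal_ofReal
  have hint : ∀ n, Integrable (ρ n) := fun n => (hρ n).integrable_of_hasCompactSupport (hc n)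
  have hprob : ∀ n, IsProbabilityMeasure (ν n) := fun n => by
    constructor
    rw [withDensity_apply _ MeasurableSet.univ, setLIntegral_univ,
      ← ofReal_integral_eq_lintegral_ofReal ((hint n).comp_neg) (.of_forall fun z => h0 n _),
      integral_neg_eq_self (ρ n), h1, ENNReal.ofReal_one]
  have hdens : ∀ n (g : RN N → F), ∫ z, g z ∂(ν n) = ∫ z, ρ n (-z) • g z := fun n g => by
    rw [integral_withDensity_eq_integral_toReal_smul (hm n) (.of_forall fun _ => by simp)]
    simp [h0]
  have hloc : LocallyIntegrable f := hfq.locallyIntegrable hq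
  have hcs : ∀ n, HasCompactSupport fun z => ρ n (-z) := fun n =>
    (hc n).comp_homeomorph (Homeomorph.neg _)
  have hi : ∀ n x, Integrable (fun z => f (x + z)) (ν n) := fun n x => by
    rw [integrable_withDensity_iff_integrable_smul' (hm n) (.of_forall fun _ => by simp)]
    simp only [ENNReal.toReal_ofReal (h0 n _)]
    have : LocallyIntegrable fun z => f (x + z) := by
      have h := (measurePreserving_add_left (volume : Measure (RN N)) x)
      exact (MemLp.comp_measurePreserving hfq h).locallyIntegrable hq
    exact this.integrable_smul_left_of_hasCompactSupport ((hρ n).comp continuous_neg) (hcs n)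
  have key := tendsto_eLpNorm_translate_average_sub hq hq' hf hfq ν ?_
    (fun n => .of_forall fun x => hi n x)
  · refine key.congr fun n => ?_
    congr 1; ext1 x
    rw [hdens, ← integral_add_left_eq_self (fun y => ρ n (x - y) • f y) x]
    simp
  · intro U hU
    have hU' : (fun z => -z) ⁻¹' U ∈ 𝓝 (0 : RN N) :=
      continuous_neg.continuousAt.preimage_mem_nhds (by simpa using hU)
    filter_upwards [hs _ hU'] with n hn
    rw [ae_withDensity_iff (hm n)]
    refine .of_forall fun z hz => ?_
    have : ρ n (-z) ≠ 0 := fun h => hz (by simp [h])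
    simpa using hn _ this

/-- The weak product rule, for the product with a smooth compactly supported function. -/
lemma HasZeroExtensionGradient.mul {Ω : Set (RN N)} {w : RN N → ℝ} {G : RN N → RN N}
    (hw : Integrable w (volume.restrict Ω)) (hG : Integrable G (volume.restrict Ω))
    (hz : HasZeroExtensionGradient Ω w G) {η : RN N → ℝ} (hη : ContDiff ℝ ∞ η)
    (hηc : HasCompactSupport η) :
    HasZeroExtensionGradient Ω (fun x => η x * w x)
      (fun x => η x • G x + w x • gradient η x) := by
  intro ζ hζ hζc d
  have hgr : Continuous (gradient η) :=
    (LinearIsometryEquiv.continuous _).comp (hη.continuous_fderiv (by simp))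
  have hgc : HasCompactSupport (gradient η) := (hηc.fderiv (𝕜 := ℝ)).comp_left (map_zero _)
  obtain ⟨C₁, hC₁⟩ := hη.continuous.bounded_above_of_compact_support hηc
  obtain ⟨C₂, hC₂⟩ := hgr.bounded_above_of_compact_support hgc
  have h3 := hz (fun x => η x * ζ x) (hη.mul hζ) (hηc.mul_right) d
  have hf : ∀ x, fderiv ℝ (fun x => η x * ζ x) x d
      = η x * fderiv ℝ ζ x d + inner ℝ (gradient η x) d * ζ x := by
    intro x
    rw [fderiv_fun_mul (hη.differentiable (by simp) x) (hζ.differentiable (by simp) x)]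
    simp [gradient, InnerProductSpace.toDual_symm_apply]; ring
  obtain ⟨D₁, hD₁⟩ := hζ.continuous.bounded_above_of_compact_support hζc
  have hfc : Continuous fun x => fderiv ℝ ζ x d :=
    (hζ.continuous_fderiv (by simp)).clm_apply continuous_const
  obtain ⟨D₂, hD₂⟩ := hfc.bounded_above_of_compact_support (hζc.fderiv_apply (𝕜 := ℝ) d)
  have i1 : Integrable (fun x => η x * w x * fderiv ℝ ζ x d) (volume.restrict Ω) :=
    (hw.bdd_mul (c := C₁) hη.continuous.aestronglyMeasurable (.of_forall hC₁)).mul_bdd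
      (c := D₂) hfc.aestronglyMeasurable (.of_forall hD₂)
  have i2 : Integrable (fun x => inner ℝ (w x • gradient η x) d * ζ x) (volume.restrict Ω) :=
    ((hw.smul_bdd C₂ hgr.aestronglyMeasurable (.of_forall hC₂)).inner_const d).mul_bdd
      (c := D₁) hζ.continuous.aestronglyMeasurable (.of_forall hD₁)
  have i3 : Integrable (fun x => inner ℝ (η x • G x) d * ζ x) (volume.restrict Ω) :=
    ((hG.bdd_smul C₁ hη.continuous.aestronglyMeasurable (.of_forall hC₁)).inner_const
      d).mul_bdd (c := D₁) hζ.continuous.aestronglyMeasurable (.of_forall hD₁)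
  have h4 : ∫ x in Ω, w x * fderiv ℝ (fun x => η x * ζ x) x d =
      (∫ x in Ω, η x * w x * fderiv ℝ ζ x d) +
        ∫ x in Ω, inner ℝ (w x • gradient η x) d * ζ x := by
    rw [← integral_add i1 i2]
    congr 1; ext x; rw [hf, real_inner_smul_left]; ring
  have h5 : ∫ x in Ω, inner ℝ (η x • G x + w x • gradient η x) d * ζ x =
      (∫ x in Ω, inner ℝ (η x • G x) d * ζ x) +
        ∫ x in Ω, inner ℝ (w x • gradient η x) d * ζ x := by
    rw [← integral_add i3 i2]
    congr 1; ext x; rw [inner_add_left]; ring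
  have h6 : ∫ x in Ω, inner ℝ (G x) d * (η x * ζ x) =
      ∫ x in Ω, inner ℝ (η x • G x) d * ζ x := by
    congr 1; ext x; rw [real_inner_smul_left]; ring
  rw [h5]
  rw [h4, h6] at h3
  linarith

/-- A function with weakly differentiable extension by zero which vanishes outside a ball where
`Ω` has the interior cone property is shifted into `Ω` along the cone and mollified. -/
lemma HasZeroExtensionGradient.isTestLimit_of_cone {Ω : Set (RN N)} (hΩm : MeasurableSet Ω)
    {p : ℝ} (hp : 1 ≤ p) {w : RN N → ℝ} {G : RN N → RN N} (hw : StronglyMeasurable w)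
    (hG : StronglyMeasurable G) (hwp : MemLp w (ENNReal.ofReal p) (volume.restrict Ω))
    (hGp : MemLp G (ENNReal.ofReal p) (volume.restrict Ω)) (hz : HasZeroExtensionGradient Ω w G)
    {K : Set (RN N)} (hK : IsCompact K) (hwK : ∀ x ∈ Ω, w x ≠ 0 → x ∈ K)
    {e : RN N} {c s₀ : ℝ} (hc : 0 < c) (hs₀ : 0 < s₀)
    (hcone : ∀ x ∈ K, ∀ s ∈ Ioo 0 s₀, ∀ z : RN N, ‖z - s • e‖ ≤ c * s → x + z ∈ Ω) :
    IsTestLimit Ω p w G := by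
  have hq : 1 ≤ ENNReal.ofReal p := by simpa using hp
  have hq' : ENNReal.ofReal p ≠ ⊤ := ENNReal.ofReal_ne_top
  have hψm : StronglyMeasurable (Ω.indicator w) := hw.indicator hΩm
  have hHm : StronglyMeasurable (Ω.indicator G) := hG.indicator hΩm
  have hψp : MemLp (Ω.indicator w) (ENNReal.ofReal p) volume :=
    (memLp_indicator_iff_restrict hΩm).2 hwp
  have hHp : MemLp (Ω.indicator G) (ENNReal.ofReal p) volume :=
    (memLp_indicator_iff_restrict hΩm).2 hGp
  have hid : ∀ ζ : RN N → ℝ, ContDiff ℝ ∞ ζ → HasCompactSupport ζ → ∀ e : RN N,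
      ∫ x, Ω.indicator w x * fderiv ℝ ζ x e = - ∫ x, inner ℝ (Ω.indicator G x) e * ζ x := by
    intro ζ hζ hζc d
    have h1 : ∫ x, Ω.indicator w x * fderiv ℝ ζ x d = ∫ x in Ω, w x * fderiv ℝ ζ x d := by
      rw [← integral_indicator hΩm]
      congr 1; ext x; by_cases hx : x ∈ Ω <;> simp [hx]
    have h2 : ∫ x, inner ℝ (Ω.indicator G x) d * ζ x = ∫ x in Ω, inner ℝ (G x) d * ζ x := by
      rw [← integral_indicator hΩm]
      congr 1; ext x; by_cases hx : x ∈ Ω <;> simp [hx]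
    rw [h1, h2, hz ζ hζ hζc d]
  -- mollifiers centred at `s n • e`, supported in the cone
  obtain ⟨s, hspos, hslt, hs0⟩ : ∃ s : ℕ → ℝ, (∀ n, 0 < s n) ∧ (∀ n, s n < s₀) ∧
      Tendsto s atTop (𝓝 0) := by
    refine ⟨fun n => s₀ / (n + 2), fun n => by positivity, fun n => ?_,
      Tendsto.div_atTop tendsto_const_nhds
        (tendsto_atTop_add_const_right _ _ tendsto_natCast_atTop_atTop)⟩
    rw [div_lt_iff₀ (by positivity)]
    have : (0 : ℝ) ≤ n := n.cast_nonneg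
    nlinarith
  have hβ : ∀ n, ∃ ρ : RN N → ℝ, ContDiff ℝ ∞ ρ ∧ HasCompactSupport ρ ∧ (∀ x, 0 ≤ ρ x) ∧
      ∫ x, ρ x = 1 ∧ ∀ z, ρ z ≠ 0 → ‖z - s n • e‖ < c * s n := fun n => by
    have hcs : 0 < c * s n := mul_pos hc (hspos n)
    let β : ContDiffBump (s n • e) := ⟨c * s n / 2, c * s n, by linarith, by linarith⟩
    refine ⟨β.normed volume, β.contDiff_normed, β.hasCompactSupport_normed, β.nonneg_normed,
      β.integral_normed, fun z hz => ?_⟩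
    have : z ∈ Function.support (β.normed volume) := hz
    rw [β.support_normed_eq] at this
    exact mem_ball_iff_norm.1 this
  choose ρ hρ hρc hρ0 hρ1 hρs using hβ
  have hsupp : ∀ U ∈ 𝓝 (0 : RN N), ∀ᶠ n in atTop, ∀ z, ρ n z ≠ 0 → z ∈ U := by
    intro U hU
    obtain ⟨ε, hε, hεU⟩ := Metric.mem_nhds_iff.1 hU
    have : Tendsto (fun n => s n * (‖e‖ + c)) atTop (𝓝 0) := by simpa using hs0.mul_const _
    filter_upwards [this.eventually_lt_const hε] with n hn z hz
    apply hεU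
    rw [mem_ball_zero_iff]
    have h1 := hρs n z hz
    have h2 := norm_add_le (z - s n • e) (s n • e)
    rw [sub_add_cancel, norm_smul, Real.norm_of_nonneg (hspos n).le] at h2
    nlinarith
  have hgc := fun n => gradient_convolution (hψp.locallyIntegrable hq)
    (hHp.locallyIntegrable hq) hid (hρ n) (hρc n)
  have hKn : ∀ n, IsCompact ((fun a : RN N × RN N => a.1 + a.2) ''
      (K ×ˢ Metric.closedBall (s n • e) (c * s n))) := fun n =>
    (hK.prod (isCompact_closedBall _ _)).image continuous_add
  have hts : ∀ n, tsupport (fun x => ∫ y, Ω.indicator w y * ρ n (x - y)) ⊆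
      (fun a : RN N × RN N => a.1 + a.2) '' (K ×ˢ Metric.closedBall (s n • e) (c * s n)) :=
      fun n => by
    refine closure_minimal ?_ (hKn n).isClosed
    intro x hx
    by_contra hx'
    apply hx
    refine integral_eq_zero_of_ae (.of_forall fun y => ?_)
    by_contra hy
    have h1 : Ω.indicator w y ≠ 0 := left_ne_zero_of_mul hy
    have h2 : ρ n (x - y) ≠ 0 := right_ne_zero_of_mul hy
    have hyΩ : y ∈ Ω := mem_of_indicator_ne_zero h1
    rw [indicator_of_mem hyΩ] at h1
    refine hx' ⟨(y, x - y), ⟨hwK y hyΩ h1, ?_⟩, by simp⟩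
    exact mem_closedBall_iff_norm.2 (hρs n _ h2).le
  refine ⟨fun n x => ∫ y, Ω.indicator w y * ρ n (x - y),
    fun n => ⟨(hgc n).1, ?_, (hts n).trans ?_⟩, ?_, ?_⟩
  · exact HasCompactSupport.of_support_subset_isCompact (hKn n)
      ((subset_tsupport _).trans (hts n))
  · rintro _ ⟨⟨y, z⟩, ⟨hy, hz⟩, rfl⟩
    exact hcone y hy (s n) ⟨hspos n, hslt n⟩ z (mem_closedBall_iff_norm.1 hz)
  · have := tendsto_eLpNorm_convolution_sub hq hq' hψm hψp (fun n => (hρ n).continuous) hρc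
      hρ0 hρ1 hsupp
    refine tendsto_of_tendsto_of_tendsto_of_le_of_le tendsto_const_nhds this
      (fun _ => zero_le) fun n => ?_
    refine le_trans (le_of_eq (eLpNorm_congr_ae ?_)) (eLpNorm_restrict_le _ _ _ Ω)
    filter_upwards [ae_restrict_mem hΩm] with x hx
    simp only [indicator_of_mem hx, smul_eq_mul, mul_comm]
  · have := tendsto_eLpNorm_convolution_sub hq hq' hHm hHp (fun n => (hρ n).continuous) hρc
      hρ0 hρ1 hsupp
    refine tendsto_of_tendsto_of_tendsto_of_le_of_le tendsto_const_nhds this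
      (fun _ => zero_le) fun n => ?_
    refine le_trans (le_of_eq (eLpNorm_congr_ae ?_)) (eLpNorm_restrict_le _ _ _ Ω)
    filter_upwards [ae_restrict_mem hΩm] with x hx
    rw [(hgc n).2, indicator_of_mem hx]

/-- Local form of the approximation by test functions, after multiplication with a cutoff of small
support. -/
lemma exists_isTestLimit_mul {Ω : Set (RN N)} (hΩ : IsBoundedLipschitzDomain Ω) {p : ℝ}
    (hp : 1 ≤ p) {w : RN N → ℝ} {G : RN N → RN N} (hw : StronglyMeasurable w)
    (hG : StronglyMeasurable G) (hwp : MemLp w (ENNReal.ofReal p) (volume.restrict Ω))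
    (hGp : MemLp G (ENNReal.ofReal p) (volume.restrict Ω)) (hz : HasZeroExtensionGradient Ω w G)
    (x₀ : RN N) : ∃ r > 0, ∀ η : RN N → ℝ, ContDiff ℝ ∞ η → HasCompactSupport η →
      tsupport η ⊆ Metric.ball x₀ r →
      IsTestLimit Ω p (fun x => η x * w x) (fun x => η x • G x + w x • gradient η x) := by
  obtain ⟨r, e, c, s₀, hr, hc, hs₀, hcone⟩ := exists_interior_cone hΩ.isOpen hΩ.lipschitz x₀
  refine ⟨r, hr, fun η hη hηc hηs => ?_⟩
  have hq : 1 ≤ ENNReal.ofReal p := by simpa using hp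
  have hgr : Continuous (gradient η) :=
    (LinearIsometryEquiv.continuous _).comp (hη.continuous_fderiv (by simp))
  have hgc : HasCompactSupport (gradient η) := (hηc.fderiv (𝕜 := ℝ)).comp_left (map_zero _)
  have hfin : IsFiniteMeasure (volume.restrict Ω) := ⟨by
    simpa using hΩ.isBounded.measure_lt_top⟩
  obtain ⟨C₁, hC₁⟩ := hη.continuous.bounded_above_of_compact_support hηc
  obtain ⟨C₂, hC₂⟩ := hgr.bounded_above_of_compact_support hgc
  have hψ1 : MemLp (fun x => η x * w x) (ENNReal.ofReal p) (volume.restrict Ω) :=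
    hwp.of_le_mul (c := C₁) (hη.continuous.stronglyMeasurable.mul hw).aestronglyMeasurable
      (.of_forall fun x => by rw [norm_mul]; gcongr; exact hC₁ x)
  have hH1 : MemLp (fun x => η x • G x) (ENNReal.ofReal p) (volume.restrict Ω) :=
    hGp.of_le_mul (c := C₁) (hη.continuous.stronglyMeasurable.smul hG).aestronglyMeasurable
      (.of_forall fun x => by rw [norm_smul]; gcongr; exact hC₁ x)
  have hH2 : MemLp (fun x => w x • gradient η x) (ENNReal.ofReal p) (volume.restrict Ω) :=
    hwp.of_le_mul (c := C₂) (hw.smul hgr.stronglyMeasurable).aestronglyMeasurable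
      (.of_forall fun x => by rw [norm_smul, mul_comm]; gcongr; exact hC₂ x)
  refine (hz.mul (hwp.integrable hq) (hGp.integrable hq) hη hηc).isTestLimit_of_cone
    hΩ.isOpen.measurableSet hp (hη.continuous.stronglyMeasurable.mul hw)
    ((hη.continuous.stronglyMeasurable.smul hG).add (hw.smul hgr.stronglyMeasurable))
    hψ1 (hH1.add hH2) (hηc.inter_left isClosed_closure) ?_ hc hs₀
    fun x hx => hcone x ⟨hx.1, hηs hx.2⟩
  exact fun x hx h => ⟨subset_closure hx, subset_tsupport _ (left_ne_zero_of_mul h)⟩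

/-- On a bounded Lipschitz domain, a function whose extension by zero is weakly differentiable
belongs to `W_0^{1,p}(Ω)`. -/
lemma HasZeroExtensionGradient.memW1p₀ {Ω : Set (RN N)} (hΩ : IsBoundedLipschitzDomain Ω) {p : ℝ}
    (hp : 1 ≤ p) {w : RN N → ℝ} {G : RN N → RN N} (hw : StronglyMeasurable w)
    (hG : StronglyMeasurable G) (hwp : MemLp w (ENNReal.ofReal p) (volume.restrict Ω))
    (hGp : MemLp G (ENNReal.ofReal p) (volume.restrict Ω))
    (hz : HasZeroExtensionGradient Ω w G) : MemW1p₀ Ω p w G := by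
  have hq : 1 ≤ ENNReal.ofReal p := by simpa using hp
  have hΩm : MeasurableSet Ω := hΩ.isOpen.measurableSet
  have hfin : IsFiniteMeasure (volume.restrict Ω) := ⟨by
    simpa using hΩ.isBounded.measure_lt_top⟩
  have hwg : HasWeakGradient Ω w G :=
    ⟨IntegrableOn.locallyIntegrableOn (hwp.integrable hq),
      IntegrableOn.locallyIntegrableOn (hGp.integrable hq),
      fun η hη hc _ e => hz η hη hc e⟩
  refine ⟨⟨hwp, hGp, hwg⟩, ?_⟩
  change IsTestLimit Ω p w G
  have hgr : ∀ {f : RN N → ℝ}, ContDiff ℝ ∞ f → Continuous (gradient f) := fun hf =>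
    (LinearIsometryEquiv.continuous _).comp (hf.continuous_fderiv (by simp))
  -- a cutoff equal to one near the closure of `Ω`
  obtain ⟨R, hR⟩ := hΩ.isBounded.subset_closedBall 0
  let χ : ContDiffBump (0 : RN N) := ⟨|R| + 1, |R| + 2, by positivity, by linarith⟩
  have hχ1 : ∀ x ∈ Ω, (χ : RN N → ℝ) =ᶠ[𝓝 x] fun _ => 1 := fun x hx => by
    have : x ∈ Metric.ball (0 : RN N) (|R| + 1) :=
      Metric.closedBall_subset_ball (by linarith [le_abs_self R]) (hR hx)
    filter_upwards [Metric.isOpen_ball.mem_nhds this] with y hy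
    exact χ.one_of_mem_closedBall (Metric.ball_subset_closedBall hy)
  have key : ContDiff ℝ ∞ (χ : RN N → ℝ) ∧ IsTestLimit Ω p (fun x => χ x * w x)
      (fun x => χ x • G x + w x • gradient χ x) := by
    refine smooth_compact_induction
      (Q := fun η => ContDiff ℝ ∞ η ∧ IsTestLimit Ω p (fun x => η x * w x)
        (fun x => η x • G x + w x • gradient η x)) ?_ ?_ ?_ χ χ.contDiff χ.hasCompactSupport
    · have : gradient (0 : RN N → ℝ) = 0 := by ext1 x; simp [gradient]
      refine ⟨contDiff_const, ?_⟩
      convert isTestLimit_zero Ω p using 1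
      · ext x; simp
      · ext1 x; simp [this]
    · rintro η₁ η₂ ⟨h₁, hl₁⟩ ⟨h₂, hl₂⟩
      refine ⟨h₁.add h₂, ?_⟩
      convert! hl₁.add hp ?_ ?_ ?_ ?_ hl₂ using 1
      · ext x; simp [add_mul]
      · ext1 x
        have : gradient (η₁ + η₂) x = gradient η₁ x + gradient η₂ x := by
          simp only [gradient]
          rw [fderiv_add (h₁.differentiable (by simp) x) (h₂.differentiable (by simp) x), map_add]
        simp only [this, Pi.add_apply, add_smul, smul_add]; abel
      · exact (h₁.continuous.stronglyMeasurable.mul hw).aestronglyMeasurable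
      · exact (h₂.continuous.stronglyMeasurable.mul hw).aestronglyMeasurable
      · exact ((h₁.continuous.stronglyMeasurable.smul hG).add
          (hw.smul (hgr h₁).stronglyMeasurable)).aestronglyMeasurable
      · exact ((h₂.continuous.stronglyMeasurable.smul hG).add
          (hw.smul (hgr h₂).stronglyMeasurable)).aestronglyMeasurable
    · intro x
      obtain ⟨r, hr, h⟩ := exists_isTestLimit_mul hΩ hp hw hG hwp hGp hz x
      exact ⟨r, hr, fun η hη hc hs => ⟨hη, h η hη hc hs⟩⟩
  obtain ⟨-, ξ, hξ, ha, hb⟩ := key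
  refine ⟨ξ, hξ, ha.congr fun n => eLpNorm_congr_ae ?_, hb.congr fun n => eLpNorm_congr_ae ?_⟩
  · filter_upwards [ae_restrict_mem hΩm] with x hx
    simp [(hχ1 x hx).eq_of_nhds]
  · filter_upwards [ae_restrict_mem hΩm] with x hx
    have : gradient χ x = 0 := by
      rw [gradient, (hχ1 x hx).fderiv_eq]; simp
    simp [(hχ1 x hx).eq_of_nhds, this]

/-! ### The flux through a Lipschitz boundary -/

/-- Cartesian coordinates adapted to a unit vector `d`: the first one is the coordinate along `d`,
the other ones are coordinates in the orthogonal hyperplane. -/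
lemma exists_adapted_coordinates {n : ℕ} {d : RN (n + 1)} (hd : ‖d‖ = 1) :
    ∃ Φ : RN (n + 1) ≃ₜ ℝ × (Fin n → ℝ), MeasurePreserving Φ ∧
      (∀ x s, Φ (x + s • d) = ((Φ x).1 + s, (Φ x).2)) ∧ LipschitzWith 1 fun x => (Φ x).2 := by
  have ho : Orthonormal ℝ (({0} : Set (Fin (n + 1))).domRestrict fun _ => d) := by
    constructor
    · exact fun _ => hd
    · intro i j hij; exact (hij (Subsingleton.elim _ _)).elim
  obtain ⟨b, hb⟩ := ho.exists_orthonormalBasis_extension_of_card_eq (by simp)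
  have hb0 : b 0 = d := hb 0 rfl
  let e₁ : RN (n + 1) ≃ᵐ (Fin (n + 1) → ℝ) :=
    b.repr.toHomeomorph.toMeasurableEquiv.trans (MeasurableEquiv.toLp 2 (Fin (n + 1) → ℝ)).symm
  let e₂ : RN (n + 1) ≃ᵐ ℝ × (Fin n → ℝ) :=
    e₁.trans (MeasurableEquiv.piFinSuccAbove (fun _ => ℝ) 0)
  have hfst : ∀ x, (e₂ x).1 = b.repr x 0 := fun x => rfl
  have hsnd : ∀ x i, (e₂ x).2 i = b.repr x i.succ := fun x i => rfl
  have hmp : MeasurePreserving e₂ :=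
    (volume_preserving_piFinSuccAbove (fun _ : Fin (n + 1) => ℝ) 0).comp
      ((EuclideanSpace.volume_preserving_symm_measurableEquiv_toLp (Fin (n + 1))).comp
        b.repr.measurePreserving)
  have hc : Continuous e₂ := by
    refine Continuous.prodMk (f := fun x => b.repr x 0) 
      (g := fun x (i : Fin n) => b.repr x i.succ) ?_ ?_
    all_goals fun_prop
  have hcs : Continuous e₂.symm := by
    have : ⇑e₂.symm = fun q : ℝ × (Fin n → ℝ) =>
        b.repr.symm (WithLp.toLp 2 (Fin.cons q.1 q.2 : Fin (n + 1) → ℝ)) := by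
      funext q
      rw [MeasurableEquiv.symm_apply_eq]
      refine Prod.ext ?_ (funext fun i => ?_)
      · rw [hfst]; simp
      · rw [hsnd]; simp
    rw [this]
    have h : Continuous fun q : ℝ × (Fin n → ℝ) => (Fin.cons q.1 q.2 : Fin (n + 1) → ℝ) :=
      continuous_pi fun i => by
        refine Fin.cases ?_ (fun i => ?_) i <;> simp <;> fun_prop
    fun_prop
  refine ⟨⟨e₂.toEquiv, hc, hcs⟩, hmp, fun x s => ?_, ?_⟩
  · change e₂ (x + s • d) = ((e₂ x).1 + s, (e₂ x).2)
    have h1 : b.repr d = EuclideanSpace.single 0 1 := by rw [← hb0, b.repr_self]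
    refine Prod.ext ?_ (funext fun i => ?_)
    · simp [hfst, h1]
    · simp [hsnd, h1]
  · refine LipschitzWith.of_dist_le_mul fun x y => ?_
    rw [NNReal.coe_one, one_mul, dist_pi_le_iff dist_nonneg]
    intro i
    change dist ((e₂ x).2 i) ((e₂ y).2 i) ≤ _
    rw [hsnd, hsnd, dist_eq_norm, dist_eq_norm]
    have := PiLp.norm_apply_le (b.repr (x - y)) i.succ
    rwa [b.repr.norm_map, map_sub, PiLp.sub_apply] at this

/-- For a direction `d` and a ball `B`, the flux `∫_Ω ∂_d F` of the functions `F ∈ C_c^1(B)` is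
controlled by the `L^p` norm of `F` on the boundary of `Ω`. -/
def FluxBound (Ω : Set (RN N)) (p : ℝ) (B : Set (RN N)) (d : RN N) : Prop :=
  ∃ C : ℝ≥0∞, C ≠ ⊤ ∧ ∀ F : RN N → ℝ, ContDiff ℝ 1 F → HasCompactSupport F → tsupport F ⊆ B →
    ‖∫ x in Ω, fderiv ℝ F x d‖ₑ ≤ C * eLpNorm F (ENNReal.ofReal p) (surfaceMeasure Ω)

lemma FluxBound.smul {Ω : Set (RN N)} {p : ℝ} {B : Set (RN N)} {d : RN N}
    (h : FluxBound Ω p B d) (c : ℝ) : FluxBound Ω p B (c • d) := by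
  obtain ⟨C, hC, h⟩ := h
  refine ⟨‖c‖ₑ * C, ENNReal.mul_ne_top (by simp) hC, fun F h1 h2 h3 => ?_⟩
  simp only [map_smul]
  rw [integral_smul, enorm_smul, mul_assoc]
  gcongr
  exact h F h1 h2 h3

lemma FluxBound.add {Ω : Set (RN N)} {p : ℝ} {B : Set (RN N)} {d₁ d₂ : RN N}
    (h₁ : FluxBound Ω p B d₁) (h₂ : FluxBound Ω p B d₂) : FluxBound Ω p B (d₁ + d₂) := by
  obtain ⟨C₁, hC₁, h₁⟩ := h₁
  obtain ⟨C₂, hC₂, h₂⟩ := h₂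
  refine ⟨C₁ + C₂, ENNReal.add_ne_top.2 ⟨hC₁, hC₂⟩, fun F h1 h2 h3 => ?_⟩
  have hi : ∀ d : RN N, Integrable (fun x => fderiv ℝ F x d) (volume.restrict Ω) := fun d =>
    (((h1.continuous_fderiv one_ne_zero).clm_apply continuous_const).integrable_of_hasCompactSupport
      (h2.fderiv_apply (𝕜 := ℝ) d)).restrict
  simp only [map_add]
  rw [integral_add (hi _) (hi _), add_mul]
  exact (enorm_add_le _ _).trans (add_le_add (h₁ F h1 h2 h3) (h₂ F h1 h2 h3))

/-- A continuous real function growing at least linearly is positive exactly on a half-line. -/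
lemma exists_zero_of_linear_growth {h : ℝ → ℝ} (hc : Continuous h) {c : ℝ} (hcp : 0 < c)
    (hg : ∀ t s, 0 ≤ s → h t + c * s ≤ h (t + s)) : ∃ a, h a = 0 ∧ ∀ t, 0 < h t ↔ a < t := by
  have h1 : ∃ t, h t ≤ 0 := ⟨-(|h 0| / c), by
    have := hg (-(|h 0| / c)) (|h 0| / c) (by positivity)
    rw [mul_div_cancel₀ _ hcp.ne', neg_add_cancel] at this
    linarith [le_abs_self (h 0)]⟩
  have h2 : ∃ t, 0 ≤ h t := ⟨|h 0| / c, by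
    have := hg 0 (|h 0| / c) (by positivity)
    rw [mul_div_cancel₀ _ hcp.ne', zero_add] at this
    linarith [neg_abs_le (h 0)]⟩
  obtain ⟨a, ha⟩ := mem_range_of_exists_le_of_exists_ge hc h1 h2
  refine ⟨a, ha, fun t => ⟨fun ht => ?_, fun ht => ?_⟩⟩
  · by_contra hta
    have := hg t (a - t) (by linarith)
    rw [add_sub_cancel, ha] at this
    nlinarith [mul_nonneg hcp.le (sub_nonneg.2 (not_lt.1 hta))]
  · have := hg a (t - a) (by linarith)
    rw [add_sub_cancel, ha] at this
    nlinarith [mul_pos hcp (sub_pos.2 ht)]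

/-- The flux bound near a boundary point, in a unit direction transversal to the graph: on each line
parallel to `d` the integral of `∂_d F` is minus the value of `F` at the point where the line
crosses the graph, and the projection along `d` does not increase the Hausdorff measure. -/
lemma fluxBound_of_transversal {n : ℕ} {Ω : Set (RN (n + 1))} (hΩ : IsOpen Ω) {p : ℝ} (hp : 1 ≤ p)
    {e : RN (n + 1)} {γ : RN (n + 1) → ℝ} {K : ℝ≥0} (hγ : LipschitzWith K γ)
    {x₀ : RN (n + 1)} {r : ℝ}
    (h : ∀ y ∈ Metric.ball x₀ r, (y ∈ Ω ↔ γ (y - (inner ℝ e y : ℝ) • e) < inner ℝ e y))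
    {d : RN (n + 1)} (hd : ‖d‖ = 1)
    (hcone : K * ‖d - (inner ℝ e d : ℝ) • e‖ < (inner ℝ e d : ℝ)) :
    FluxBound Ω p (Metric.ball x₀ r) d := by
  obtain ⟨Φ, hΦ, hΦd, hΦL⟩ := exists_adapted_coordinates hd
  set g := graphHeight e γ with hg
  have hgc : Continuous g := continuous_graphHeight hγ
  have hgΩ : ∀ y ∈ Metric.ball x₀ r, (y ∈ Ω ↔ 0 < g y) := fun y hy => by
    rw [h y hy, hg, graphHeight, sub_pos]
  -- the height above the graph grows at the rate `c` along lines in the direction `d`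
  set c : ℝ := (inner ℝ e d : ℝ) - K * ‖d - (inner ℝ e d : ℝ) • e‖ with hc
  have hcp : 0 < c := sub_pos.2 hcone
  have hgrow : ∀ x s, 0 ≤ s → g x + c * s ≤ g (x + s • d) := fun x s hs => by
    refine le_trans (le_of_eq ?_) (le_graphHeight_add hγ x (s • d))
    have : s • d - (inner ℝ e (s • d) : ℝ) • e = s • (d - (inner ℝ e d : ℝ) • e) := by
      rw [inner_smul_right, smul_sub, smul_smul]
    rw [this, norm_smul, Real.norm_of_nonneg hs, inner_smul_right, hc]; ring
  have hsymm : ∀ t s y, Φ.symm (t + s, y) = Φ.symm (t, y) + s • d := fun t s y => by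
    rw [Homeomorph.symm_apply_eq, hΦd]; simp
  have hex : ∀ y, ∃ a, g (Φ.symm (a, y)) = 0 ∧ ∀ t, 0 < g (Φ.symm (t, y)) ↔ a < t := fun y =>
    exists_zero_of_linear_growth (h := fun t => g (Φ.symm (t, y)))
      (hgc.comp (Φ.symm.continuous.comp (by fun_prop))) hcp
      (fun t s hs => by rw [hsymm]; exact hgrow _ s hs)
  choose a ha ha' using hex
  have ham : Measurable a := by
    refine measurable_of_Iio fun t => ?_
    have : a ⁻¹' Iio t = {y | 0 < g (Φ.symm (t, y))} := by
      ext y; simp only [mem_preimage, mem_Iio]; exact (ha' y t).symm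
    rw [this]
    exact (isOpen_lt continuous_const
      (hgc.comp (Φ.symm.continuous.comp (by fun_prop)))).measurableSet
  -- `σ y` is the point where the line with transversal coordinates `y` crosses the graph
  set σ : (Fin n → ℝ) → RN (n + 1) := fun y => Φ.symm (a y, y) with hσ
  have hσm : Measurable σ := Φ.symm.continuous.measurable.comp (ham.prodMk measurable_id)
  have hσΦ : ∀ y, (Φ (σ y)).2 = y := fun y => by simp [hσ]
  set D := σ ⁻¹' Metric.ball x₀ r with hD
  have hDm : MeasurableSet D := hσm Metric.isOpen_ball.measurableSet
  have hDfin : volume D < ⊤ := by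
    have hsub : D ⊆ (fun x => (Φ x).2) '' Metric.closedBall x₀ r := fun y hy =>
      ⟨σ y, Metric.ball_subset_closedBall hy, hσΦ y⟩
    refine lt_of_le_of_lt (measure_mono hsub) ?_
    exact ((isCompact_closedBall x₀ r).image hΦL.continuous).measure_lt_top
  have hDf : IsFiniteMeasure (volume.restrict D) := ⟨by simpa using hDfin⟩
  have hfront : ∀ y ∈ D, σ y ∈ frontier Ω := fun y hy => by
    rw [hΩ.frontier_eq]
    refine ⟨?_, fun hmem => ?_⟩
    · have ht : Tendsto (fun s : ℝ => Φ.symm (a y + s, y)) (𝓝[>] 0) (𝓝 (σ y)) := by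
        have : Continuous fun s : ℝ => Φ.symm (a y + s, y) :=
          Φ.symm.continuous.comp (by fun_prop)
        have h0 := this.tendsto 0
        simp only [add_zero] at h0
        exact h0.mono_left nhdsWithin_le_nhds
      refine mem_closure_of_tendsto ht ?_
      filter_upwards [ht (Metric.isOpen_ball.mem_nhds hy), self_mem_nhdsWithin] with s hs hs0
      exact (hgΩ _ hs).2 ((ha' y _).2 (by simpa using hs0))
    · have := (hgΩ _ hy).1 hmem
      rw [hσ, ha y] at this
      exact lt_irrefl _ this
  -- the `1`-Lipschitz map `x ↦ (Φ x).2` inverts `σ`, and the Hausdorff measure of dimension `n` on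
  -- `Fin n → ℝ` is Lebesgue measure
  have hmeas : (volume.restrict D).map σ ≤ surfaceMeasure Ω := by
    refine Measure.le_iff.2 fun A hA => ?_
    rw [Measure.map_apply hσm hA, Measure.restrict_apply (hσm hA), surfaceMeasure,
      Measure.restrict_apply hA]
    have hsub : σ ⁻¹' A ∩ D ⊆ (fun x => (Φ x).2) '' (A ∩ frontier Ω) := fun y hy =>
      ⟨σ y, ⟨hy.1, hfront y hy.2⟩, hσΦ y⟩
    refine (measure_mono hsub).trans ?_
    rw [← hausdorffMeasure_pi_real, Fintype.card_fin]
    refine (hΦL.hausdorffMeasure_image_le n.cast_nonneg _).trans (le_of_eq ?_)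
    simp
  have hq : 1 ≤ ENNReal.ofReal p := by simpa using hp
  -- the constant of Hölder's inequality between `L^1(D)` and `L^p(D)`
  refine ⟨(volume.restrict D) univ ^ (1 / (1 : ℝ≥0∞).toReal - 1 / (ENNReal.ofReal p).toReal),
    ?_, fun F hF hFc hFs => ?_⟩
  · refine ENNReal.rpow_ne_top_of_nonneg ?_ (measure_ne_top _ _)
    rw [ENNReal.toReal_ofReal (by linarith), ENNReal.toReal_one, div_one, sub_nonneg]
    exact (div_le_one (by linarith)).2 hp
  have hgset : MeasurableSet {x | 0 < g x} := (isOpen_lt continuous_const hgc).measurableSet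
  have hFint : Integrable (fun x => fderiv ℝ F x d) :=
    ((hF.continuous_fderiv one_ne_zero).clm_apply continuous_const).integrable_of_hasCompactSupport
      (hFc.fderiv_apply (𝕜 := ℝ) d)
  have e1 : ∫ x in Ω, fderiv ℝ F x d =
      ∫ x, {x | 0 < g x}.indicator (fun x => fderiv ℝ F x d) x := by
    rw [← integral_indicator hΩ.measurableSet]
    congr 1; ext x
    by_cases hx : x ∈ Metric.ball x₀ r
    · by_cases hxΩ : x ∈ Ω
      · rw [indicator_of_mem hxΩ, indicator_of_mem]
        exact (hgΩ x hx).1 hxΩ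
      · rw [indicator_of_notMem hxΩ, indicator_of_notMem]
        exact fun h => hxΩ ((hgΩ x hx).2 h)
    · have : fderiv ℝ F x = 0 := by
        by_contra hne
        exact hx (hFs (support_fderiv_subset ℝ hne))
      simp [indicator, this]
  -- Fubini's theorem and the fundamental theorem of calculus on the lines in the direction `d`
  have e2 : ∫ x, {x | 0 < g x}.indicator (fun x => fderiv ℝ F x d) x =
      ∫ y, - F (σ y) := by
    rw [← (hΦ.symm Φ.toMeasurableEquiv).integral_comp Φ.symm.measurableEmbedding]
    have hi2 := (hΦ.symm Φ.toMeasurableEquiv).integrable_comp_of_integrable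
      (hFint.indicator hgset)
    rw [Measure.volume_eq_prod, integral_prod_symm]
    swap; · exact hi2
    congr 1; ext y
    have e3 : ∀ t, {x | 0 < g x}.indicator (fun x => fderiv ℝ F x d) (Φ.symm (t, y)) =
        (Ioi (a y)).indicator (fun t => deriv (fun t => F (Φ.symm (t, y))) t) t := fun t => by
      have e4 : deriv (fun t => F (Φ.symm (t, y))) t = fderiv ℝ F (Φ.symm (t, y)) d := by
        have h1 : (fun t => F (Φ.symm (t, y))) = fun t => F (Φ.symm (0, y) + t • d) := by
          ext t; rw [← hsymm, zero_add]
        have h2 : HasDerivAt (fun t : ℝ => Φ.symm (0, y) + t • d) d t := by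
          simpa using ((hasDerivAt_id t).smul_const d).const_add (Φ.symm (0, y))
        rw [h1]
        have h3 := (hF.differentiable one_ne_zero
          (Φ.symm (0, y) + t • d)).hasFDerivAt.comp_hasDerivAt t h2
        have h4 : Φ.symm (t, y) = Φ.symm (0, y) + t • d := by rw [← hsymm, zero_add]
        rw [h4]
        exact h3.deriv
      by_cases ht : a y < t
      · rw [indicator_of_mem (show t ∈ Ioi (a y) from ht), e4, indicator_of_mem]
        exact (ha' y t).2 ht
      · rw [indicator_of_notMem (show t ∉ Ioi (a y) from ht), indicator_of_notMem]
        exact fun h => ht ((ha' y t).1 h)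
    have e5 : ∫ t, (Ioi (a y)).indicator (fun t => deriv (fun t => F (Φ.symm (t, y))) t) t
        = - F (σ y) := by
      rw [integral_indicator measurableSet_Ioi]
      have h1 : (fun t => F (Φ.symm (t, y))) = fun t => F (Φ.symm (0, y) + t • d) := by
        ext t; rw [← hsymm, zero_add]
      refine HasCompactSupport.integral_Ioi_deriv_eq (f := fun t => F (Φ.symm (t, y))) ?_ ?_ _
      · rw [h1]
        exact hF.comp (contDiff_const.add (contDiff_id.smul contDiff_const))
      · refine HasCompactSupport.of_support_subset_isCompact
          (hFc.isCompact.image (continuous_fst.comp Φ.continuous)) fun t ht => ?_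
        exact ⟨Φ.symm (t, y), subset_tsupport _ ht, by simp⟩
    rw [← e5]
    exact integral_congr_ae (.of_forall fun t => e3 t)
  have hFσ : ∀ y, F (σ y) ≠ 0 → y ∈ D := fun y hy => hFs (subset_tsupport _ hy)
  have e6 : ∫⁻ y, ‖F (σ y)‖ₑ = eLpNorm (F ∘ σ) 1 (volume.restrict D) := by
    rw [eLpNorm_one_eq_lintegral_enorm, ← lintegral_indicator hDm]
    congr 1; ext y
    by_cases hy : y ∈ D
    · simp [hy]
    · have : F (σ y) = 0 := by by_contra h; exact hy (hFσ y h)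
      simp [hy, this]
  have hFσm : AEStronglyMeasurable (F ∘ σ) (volume.restrict D) :=
    (hF.continuous.measurable.comp hσm).aestronglyMeasurable
  rw [e1, e2]
  calc ‖∫ y, - F (σ y)‖ₑ ≤ ∫⁻ y, ‖F (σ y)‖ₑ := by
        simpa using enorm_integral_le_lintegral_enorm (fun y => - F (σ y))
    _ = eLpNorm (F ∘ σ) 1 (volume.restrict D) := e6
    _ ≤ _ := eLpNorm_le_eLpNorm_mul_rpow_measure_univ hq hFσm
    _ ≤ _ := by
        rw [mul_comm]
        gcongr
        rw [← eLpNorm_map_measure hF.continuous.aestronglyMeasurable hσm.aemeasurable]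
        exact eLpNorm_mono_measure _ hmeas

/-- On a Lipschitz domain the flux bound holds near every point, in every direction. -/
lemma exists_fluxBound (hN : 1 ≤ N) {Ω : Set (RN N)} (hΩ : IsBoundedLipschitzDomain Ω) {p : ℝ}
    (hp : 1 ≤ p) (x₀ : RN N) : ∃ r > 0, ∀ d, FluxBound Ω p (Metric.ball x₀ r) d := by
  -- away from the boundary the flux vanishes
  by_cases hx : x₀ ∈ closure Ω
  swap
  · obtain ⟨r, hr, h⟩ := Metric.isOpen_iff.1 isClosed_closure.isOpen_compl x₀ hx
    refine ⟨r, hr, fun d => ⟨0, by simp, fun F _ _ hFs => ?_⟩⟩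
    rw [setIntegral_eq_zero_of_forall_eq_zero]
    · simp
    · intro x hxΩ
      have : fderiv ℝ F x = 0 := by
        by_contra hne
        exact h (hFs (support_fderiv_subset ℝ hne)) (subset_closure hxΩ)
      simp [this]
  by_cases hx' : x₀ ∈ Ω
  · obtain ⟨r, hr, h⟩ := Metric.isOpen_iff.1 hΩ.isOpen x₀ hx'
    refine ⟨r, hr, fun d => ⟨0, by simp, fun F hF hFc hFs => ?_⟩⟩
    rw [setIntegral_eq_integral_of_forall_compl_eq_zero]
    · have hi : Integrable (fun x => fderiv ℝ F x d) :=
        ((hF.continuous_fderiv one_ne_zero).clm_apply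
          continuous_const).integrable_of_hasCompactSupport (hFc.fderiv_apply (𝕜 := ℝ) d)
      have := integral_mul_fderiv_eq_neg_fderiv_mul_of_integrable (μ := volume)
        (f := fun _ : RN N => (1 : ℝ)) (g := F) (v := d) (by simp) (by simpa using hi)
        (by simpa using hF.continuous.integrable_of_hasCompactSupport hFc)
        (fun _ _ => differentiableAt_const _) (fun x _ => hF.differentiable one_ne_zero x)
      simp at this
      simp [this]
    · intro x hxΩ
      have : fderiv ℝ F x = 0 := by
        by_contra hne
        exact hxΩ (h (hFs (support_fderiv_subset ℝ hne)))
      simp [this]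
  obtain ⟨e, γ, K, r, he, hγ, hr, h⟩ := hΩ.lipschitz x₀ ⟨hx, by rwa [hΩ.isOpen.interior_eq]⟩
  obtain ⟨n, rfl⟩ : ∃ n, N = n + 1 := ⟨N - 1, by omega⟩
  have hee : (inner ℝ e e : ℝ) = 1 := by rw [real_inner_self_eq_norm_sq, he]; norm_num
  have hcone : ∀ d : RN (n + 1), K * ‖d - (inner ℝ e d : ℝ) • e‖ < (inner ℝ e d : ℝ) →
      FluxBound Ω p (Metric.ball x₀ r) d := by
    intro d hd
    have hd0 : ‖d‖ ≠ 0 := by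
      intro h0
      rw [norm_eq_zero.1 h0] at hd
      simp at hd
    have h1 : FluxBound Ω p (Metric.ball x₀ r) (‖d‖⁻¹ • d) := by
      refine fluxBound_of_transversal hΩ.isOpen hp hγ h ?_ ?_
      · rw [norm_smul, norm_inv, norm_norm, inv_mul_cancel₀ hd0]
      · have : ‖d‖⁻¹ • d - (inner ℝ e (‖d‖⁻¹ • d) : ℝ) • e
            = ‖d‖⁻¹ • (d - (inner ℝ e d : ℝ) • e) := by
          rw [inner_smul_right, smul_sub, smul_smul]
        rw [this, norm_smul, inner_smul_right, norm_inv, norm_norm]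
        have hpos : 0 < ‖d‖⁻¹ := by positivity
        nlinarith [mul_lt_mul_of_pos_left hd hpos]
    have := h1.smul ‖d‖
    rwa [smul_smul, mul_inv_cancel₀ hd0, one_smul] at this
  refine ⟨r, hr, fun d => ?_⟩
  -- `d` is a combination of the directions `e` and `e + s • d`, both close to `e`
  have hopen : ∀ᶠ s : ℝ in 𝓝 0, K * ‖(e + s • d) - (inner ℝ e (e + s • d) : ℝ) • e‖ <
      (inner ℝ e (e + s • d) : ℝ) := by
    refine ContinuousAt.eventually_lt (by fun_prop) (by fun_prop) ?_
    simp [he]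
  obtain ⟨ε, hε, hs⟩ := Metric.eventually_nhds_iff.1 hopen
  have h1 := hcone (e + (ε / 2) • d) (hs (by simp [abs_of_pos hε, hε]))
  have h2 := hcone e (by simp [he])
  have h3 := (h1.add (h2.smul (-1))).smul (ε / 2)⁻¹
  have h4 : (ε / 2)⁻¹ • (e + (ε / 2) • d + (-1 : ℝ) • e) = d := by
    have : e + (ε / 2) • d + (-1 : ℝ) • e = (ε / 2) • d := by
      rw [neg_one_smul]; abel
    rw [this, smul_smul, inv_mul_cancel₀ (by positivity), one_smul]
  rwa [h4] at h3

/-! ### Truncations of functions with nonpositive trace -/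

/-- Integrals of functions dominated by functions which tend to zero in `L^q` tend to zero. -/
lemma tendsto_integral_zero_of_le_mul {α F ι : Type*} {l : Filter ι} [MeasurableSpace α]
    [NormedAddCommGroup F] {μ : Measure α} [IsFiniteMeasure μ] {q : ℝ≥0∞} (hq : 1 ≤ q)
    {f : ι → α → F} {h : ι → α → ℝ} (hf : ∀ᶠ n in l, AEStronglyMeasurable (f n) μ)
    (hlim : Tendsto (fun n => eLpNorm (f n) q μ) l (𝓝 0)) {M : ℝ≥0}
    (hM : ∀ᶠ n in l, ∀ᵐ x ∂μ, ‖h n x‖ₑ ≤ M * ‖f n x‖ₑ) :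
    Tendsto (fun n => ∫ x, h n x ∂μ) l (𝓝 0) := by
  rw [tendsto_zero_iff_enorm_tendsto_zero]
  set C : ℝ≥0∞ := μ univ ^ (1 / (1 : ℝ≥0∞).toReal - 1 / q.toReal) with hC
  have hCt : C ≠ ⊤ := by
    refine ENNReal.rpow_ne_top_of_nonneg ?_ (measure_ne_top _ _)
    rw [ENNReal.toReal_one, div_one, sub_nonneg]
    rcases eq_or_ne q ⊤ with rfl | hq'
    · simp
    · have : 1 ≤ q.toReal := by
        simpa using ENNReal.toReal_mono hq' hq
      exact (div_le_one (by linarith)).2 this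
  refine tendsto_of_tendsto_of_tendsto_of_le_of_le' tendsto_const_nhds
    (h := fun n => M * (eLpNorm (f n) q μ * C)) ?_ (.of_forall fun _ => zero_le) ?_
  · have := ENNReal.Tendsto.const_mul (ENNReal.Tendsto.mul_const hlim (.inr hCt))
      (a := (M : ℝ≥0∞)) (.inr (by simp))
    simpa using this
  · filter_upwards [hf, hM] with n hf hM
    calc ‖∫ x, h n x ∂μ‖ₑ ≤ ∫⁻ x, ‖h n x‖ₑ ∂μ := enorm_integral_le_lintegral_enorm _
      _ ≤ ∫⁻ x, M * ‖f n x‖ₑ ∂μ := lintegral_mono_ae hM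
      _ = M * eLpNorm (f n) 1 μ := by
          rw [lintegral_const_mul' _ _ (by simp), eLpNorm_one_eq_lintegral_enorm]
      _ ≤ _ := by
          exact mul_le_mul' le_rfl (eLpNorm_le_eLpNorm_mul_rpow_measure_univ hq hf)

/-- If `w` is a limit in `W^{1,p}(Ω)` of smooth functions whose positive parts tend to zero on the
boundary, then every `C¹` truncation `b(w)` with `b = 0` on `(-∞, 0]` has a weakly differentiable
extension by zero. -/
lemma hasZeroExtensionGradient_truncation (hN : 1 ≤ N) {Ω : Set (RN N)}
    (hΩ : IsBoundedLipschitzDomain Ω) {p : ℝ} (hp : 1 ≤ p) {b : ℝ → ℝ} (hb : ContDiff ℝ 1 b)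
    (hb' : ∀ s, |deriv b s| ≤ 1) (hb0 : ∀ s, |b s| ≤ max s 0) {w : RN N → ℝ} {G : RN N → RN N}
    (hw : MemLp w (ENNReal.ofReal p) (volume.restrict Ω))
    (hG : MemLp G (ENNReal.ofReal p) (volume.restrict Ω)) {θ : ℕ → RN N → ℝ}
    (hθ : ∀ n, ContDiff ℝ ∞ (θ n))
    (hθw : Tendsto (fun n => eLpNorm (fun x => θ n x - w x) (ENNReal.ofReal p)
      (volume.restrict Ω)) atTop (𝓝 0))
    (hθG : Tendsto (fun n => eLpNorm (fun x => gradient (θ n) x - G x) (ENNReal.ofReal p)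
      (volume.restrict Ω)) atTop (𝓝 0))
    (hθb : Tendsto (fun n => eLpNorm (fun x => max (θ n x) 0) (ENNReal.ofReal p)
      (surfaceMeasure Ω)) atTop (𝓝 0)) :
    HasZeroExtensionGradient Ω (fun x => b (w x)) (fun x => deriv b (w x) • G x) := by
  have hq : 1 ≤ ENNReal.ofReal p := by simpa using hp
  have hfin : IsFiniteMeasure (volume.restrict Ω) := ⟨by
    simpa using hΩ.isBounded.measure_lt_top⟩
  have hbd : Differentiable ℝ b := hb.differentiable one_ne_zero
  have hbdc : Continuous (deriv b) := hb.continuous_deriv le_rfl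
  have hblip : ∀ s t, |b s - b t| ≤ |s - t| := fun s t => by
    have := lipschitzWith_of_nnnorm_deriv_le hbd (C := 1) (fun s => by
      rw [← NNReal.coe_le_coe]; simpa using hb' s)
    simpa [Real.dist_eq] using this.dist_le_mul s t
  have hbwm : AEStronglyMeasurable (fun x => b (w x)) (volume.restrict Ω) :=
    hb.continuous.comp_aestronglyMeasurable hw.1
  have hbw : Integrable (fun x => b (w x)) (volume.restrict Ω) := by
    refine (hw.integrable hq).mono hbwm (.of_forall fun x => ?_)
    rw [Real.norm_eq_abs, Real.norm_eq_abs]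
    exact (hb0 _).trans (max_le (le_abs_self _) (abs_nonneg _))
  have hGb : Integrable (fun x => deriv b (w x) • G x) (volume.restrict Ω) :=
    (hG.integrable hq).bdd_smul 1 (hbdc.comp_aestronglyMeasurable hw.1)
      (.of_forall fun x => hb' _)
  -- integrability against test functions
  have i1 : ∀ {η : RN N → ℝ}, ContDiff ℝ ∞ η → HasCompactSupport η → ∀ d : RN N,
      Integrable (fun x => b (w x) * fderiv ℝ η x d) (volume.restrict Ω) := fun {η} hη hηc d => by
    have hc : Continuous fun x => fderiv ℝ η x d :=
      (hη.continuous_fderiv (by simp)).clm_apply continuous_const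
    obtain ⟨D, hD⟩ := hc.bounded_above_of_compact_support (hηc.fderiv_apply (𝕜 := ℝ) d)
    exact hbw.mul_bdd (c := D) hc.aestronglyMeasurable (.of_forall hD)
  have i2 : ∀ {η : RN N → ℝ}, ContDiff ℝ ∞ η → HasCompactSupport η → ∀ d : RN N,
      Integrable (fun x => inner ℝ (deriv b (w x) • G x) d * η x) (volume.restrict Ω) :=
      fun {η} hη hηc d => by
    obtain ⟨D, hD⟩ := hη.continuous.bounded_above_of_compact_support hηc
    exact (hGb.inner_const d).mul_bdd (c := D) hη.continuous.aestronglyMeasurable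
      (.of_forall hD)
  intro η hη hηc
  refine (smooth_compact_induction (Q := fun η => ContDiff ℝ ∞ η ∧ HasCompactSupport η ∧
    ∀ d : RN N, ∫ x in Ω, b (w x) * fderiv ℝ η x d =
      - ∫ x in Ω, inner ℝ (deriv b (w x) • G x) d * η x) ?_ ?_ ?_ η hη hηc).2.2
  · refine ⟨contDiff_const, HasCompactSupport.zero, fun d => ?_⟩
    simp
  · rintro η₁ η₂ ⟨h₁, hc₁, e₁⟩ ⟨h₂, hc₂, e₂⟩
    refine ⟨h₁.add h₂, hc₁.add hc₂, fun d => ?_⟩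
    have e3 : ∫ x in Ω, b (w x) * fderiv ℝ (η₁ + η₂) x d =
        (∫ x in Ω, b (w x) * fderiv ℝ η₁ x d) + ∫ x in Ω, b (w x) * fderiv ℝ η₂ x d := by
      rw [← integral_add (i1 h₁ hc₁ d) (i1 h₂ hc₂ d)]
      congr 1; ext x
      rw [fderiv_add (h₁.differentiable (by simp) x) (h₂.differentiable (by simp) x)]
      simp [mul_add]
    have e4 : ∫ x in Ω, inner ℝ (deriv b (w x) • G x) d * (η₁ + η₂) x =
        (∫ x in Ω, inner ℝ (deriv b (w x) • G x) d * η₁ x) +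
          ∫ x in Ω, inner ℝ (deriv b (w x) • G x) d * η₂ x := by
      rw [← integral_add (i2 h₁ hc₁ d) (i2 h₂ hc₂ d)]
      congr 1; ext x; rw [Pi.add_apply, mul_add]
    rw [e3, e4, e₁, e₂, neg_add]
  intro x₀
  obtain ⟨r, hr, hflux⟩ := exists_fluxBound hN hΩ hp x₀
  refine ⟨r, hr, fun η hη hηc hηs => ⟨hη, hηc, fun d => ?_⟩⟩
  obtain ⟨C, hC, hflux⟩ := hflux d
  obtain ⟨M, hM⟩ := hη.continuous.bounded_above_of_compact_support hηc
  have hM0 : 0 ≤ M := (norm_nonneg _).trans (hM 0)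
  have hdc : Continuous fun x => fderiv ℝ η x d :=
    (hη.continuous_fderiv (by simp)).clm_apply continuous_const
  obtain ⟨D, hD⟩ := hdc.bounded_above_of_compact_support (hηc.fderiv_apply (𝕜 := ℝ) d)
  have hD0 : 0 ≤ D := (norm_nonneg _).trans (hD 0)
  have hgr : ∀ n, Continuous (gradient (θ n)) := fun n =>
    (LinearIsometryEquiv.continuous _).comp ((hθ n).continuous_fderiv (by simp))
  -- an almost everywhere convergent subsequence
  obtain ⟨ns, hns, hae⟩ : ∃ ns : ℕ → ℕ, StrictMono ns ∧
      ∀ᵐ x ∂(volume.restrict Ω), Tendsto (fun i => θ (ns i) x) atTop (𝓝 (w x)) := by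
    refine TendstoInMeasure.exists_seq_tendsto_ae (tendstoInMeasure_of_tendsto_eLpNorm
      (zero_lt_one.trans_le hq).ne' (fun n => (hθ n).continuous.aestronglyMeasurable) hw.1 ?_)
    exact hθw
  have hFc : ∀ n, ContDiff ℝ 1 fun x => b (θ n x) * η x := fun n =>
    (hb.comp ((hθ n).of_le (by simp))).mul (hη.of_le (by simp))
  have hfd : ∀ n x, fderiv ℝ (fun x => b (θ n x) * η x) x d =
      b (θ n x) * fderiv ℝ η x d + (η x * deriv b (θ n x) * inner ℝ (gradient (θ n) x - G x) d +
        η x * deriv b (θ n x) * inner ℝ (G x) d) := fun n x => by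
    have h1 : HasFDerivAt (fun x => b (θ n x)) (deriv b (θ n x) • fderiv ℝ (θ n) x) x :=
      (hbd _).hasDerivAt.comp_hasFDerivAt x ((hθ n).differentiable (by simp) x).hasFDerivAt
    have h2 := (h1.mul ((hη.differentiable (by simp) x).hasFDerivAt)).fderiv
    have h3 : inner ℝ (gradient (θ n) x) d = fderiv ℝ (θ n) x d := by
      simp [gradient, InnerProductSpace.toDual_symm_apply]
    have h4 : fderiv ℝ (fun x => b (θ n x) * η x) x = _ := h2
    rw [h4, inner_sub_left, h3]
    simp; ring
  -- the flux of `b(θ n) η` through the boundary tends to zero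
  have t0 : Tendsto (fun n => ∫ x in Ω, fderiv ℝ (fun x => b (θ n x) * η x) x d) atTop (𝓝 0) := by
    rw [tendsto_zero_iff_enorm_tendsto_zero]
    refine tendsto_of_tendsto_of_tendsto_of_le_of_le tendsto_const_nhds
      (h := fun n => C * (ENNReal.ofReal M * eLpNorm (fun x => max (θ n x) 0) (ENNReal.ofReal p)
        (surfaceMeasure Ω))) ?_ (fun _ => zero_le) fun n => ?_
    · have := ENNReal.Tendsto.const_mul (ENNReal.Tendsto.const_mul hθb
        (a := ENNReal.ofReal M) (.inr (by simp))) (a := C) (.inr hC)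
      simpa using this
    · refine (hflux _ (hFc n) hηc.mul_left ((tsupport_mul_subset_right).trans hηs)).trans ?_
      refine mul_le_mul' le_rfl ?_
      refine eLpNorm_le_mul_eLpNorm_of_ae_le_mul (.of_forall fun x => ?_) _
      rw [norm_mul, mul_comm, Real.norm_of_nonneg (le_max_right _ _)]
      exact mul_le_mul (hM x) (hb0 _) (norm_nonneg _) hM0
  have t1 : Tendsto (fun n => ∫ x in Ω, (b (θ n x) - b (w x)) * fderiv ℝ η x d)
      atTop (𝓝 0) := by
    refine tendsto_integral_zero_of_le_mul hq
      (.of_forall fun n => (hθ n).continuous.aestronglyMeasurable.sub hw.1) hθw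
      (M := D.toNNReal) (.of_forall fun n => .of_forall fun x => ?_)
    rw [enorm_mul, mul_comm]
    refine mul_le_mul' ?_ ?_
    · rw [← ofReal_norm]; exact ENNReal.ofReal_le_ofReal (hD x)
    · rw [← ofReal_norm, ← ofReal_norm]
      exact ENNReal.ofReal_le_ofReal (hblip _ _)
  have t2 : Tendsto (fun n => ∫ x in Ω, η x * deriv b (θ n x) *
      inner ℝ (gradient (θ n) x - G x) d) atTop (𝓝 0) := by
    refine tendsto_integral_zero_of_le_mul hq
      (.of_forall fun n => (hgr n).aestronglyMeasurable.sub hG.1) hθG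
      (M := (M * ‖d‖).toNNReal) (.of_forall fun n => .of_forall fun x => ?_)
    rw [← ofReal_norm, ← ofReal_norm]
    change _ ≤ ENNReal.ofReal _ * _
    rw [← ENNReal.ofReal_mul (by positivity)]
    refine ENNReal.ofReal_le_ofReal ?_
    rw [norm_mul, norm_mul]
    calc ‖η x‖ * ‖deriv b (θ n x)‖ * ‖(inner ℝ (gradient (θ n) x - G x) d : ℝ)‖
        ≤ M * 1 * (‖gradient (θ n) x - G x‖ * ‖d‖) := by
          gcongr
          · exact hM x
          · exact hb' _
          · exact norm_inner_le_norm _ _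
      _ = _ := by simp only [Pi.sub_apply]; ring
  have t3 : Tendsto (fun n => ∫ x in Ω, η x * deriv b (θ (ns n) x) * inner ℝ (G x) d) atTop
      (𝓝 (∫ x in Ω, η x * deriv b (w x) * inner ℝ (G x) d)) := by
    have hGi : Integrable (fun x => M * ‖(inner ℝ (G x) d : ℝ)‖) (volume.restrict Ω) :=
      ((hG.integrable hq).inner_const d).norm.const_mul M
    refine tendsto_integral_of_dominated_convergence _ (fun n => ?_) hGi (fun n => ?_) ?_
    · exact ((hη.continuous.mul (hbdc.comp (hθ _).continuous)).aestronglyMeasurable).mul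
        ((hG.integrable hq).inner_const d).1
    · refine .of_forall fun x => ?_
      rw [norm_mul, norm_mul]
      calc ‖η x‖ * ‖deriv b (θ (ns n) x)‖ * ‖(inner ℝ (G x) d : ℝ)‖
          ≤ M * 1 * ‖(inner ℝ (G x) d : ℝ)‖ := by
            gcongr
            · exact hM x
            · exact hb' _
        _ = _ := by ring
    · filter_upwards [hae] with x hx
      exact ((hbdc.tendsto _).comp hx).const_mul (η x) |>.mul_const _
  -- the product rule, with `θ n` compared to its limit
  have hsplit : ∀ n, ∫ x in Ω, fderiv ℝ (fun x => b (θ n x) * η x) x d =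
      (∫ x in Ω, b (w x) * fderiv ℝ η x d) +
      (∫ x in Ω, (b (θ n x) - b (w x)) * fderiv ℝ η x d) +
      (∫ x in Ω, η x * deriv b (θ n x) * inner ℝ (gradient (θ n) x - G x) d) +
      ∫ x in Ω, η x * deriv b (θ n x) * inner ℝ (G x) d := fun n => by
    have j1 : Integrable (fun x => b (θ n x) * fderiv ℝ η x d) (volume.restrict Ω) :=
      ((((hb.continuous.comp (hθ n).continuous).mul hdc).integrable_of_hasCompactSupport
        (hηc.fderiv_apply (𝕜 := ℝ) d).mul_left)).restrict
    have j2 : Integrable (fun x => (b (θ n x) - b (w x)) * fderiv ℝ η x d)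
        (volume.restrict Ω) := by
      simp only [sub_mul]; exact j1.sub (i1 hη hηc d)
    have hbdd : ∀ᵐ x ∂(volume.restrict Ω), ‖η x * deriv b (θ n x)‖ ≤ M := .of_forall fun x => by
      rw [norm_mul]
      calc ‖η x‖ * ‖deriv b (θ n x)‖ ≤ M * 1 := by
            gcongr
            · exact hM x
            · exact hb' _
        _ = M := mul_one M
    have hηb : Continuous fun x => η x * deriv b (θ n x) :=
      hη.continuous.mul (hbdc.comp (hθ n).continuous)
    have j4 : Integrable (fun x => η x * deriv b (θ n x) * inner ℝ (G x) d)
        (volume.restrict Ω) :=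
      ((hG.integrable hq).inner_const d).bdd_mul hηb.aestronglyMeasurable hbdd
    have j5 : Integrable (fun x => η x * deriv b (θ n x) * inner ℝ (gradient (θ n) x) d)
        (volume.restrict Ω) := by
      refine (Continuous.integrable_of_hasCompactSupport ?_ ?_).restrict
      · exact hηb.mul ((hgr n).inner continuous_const)
      · exact (hηc.mul_right).mul_right
    have j3 : Integrable (fun x => η x * deriv b (θ n x) * inner ℝ (gradient (θ n) x - G x) d)
        (volume.restrict Ω) := by
      simp only [inner_sub_left, mul_sub]; exact j5.sub j4
    refine Eq.trans ?_ ((integral_add (((i1 hη hηc d).add j2).add j3) j4).trans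
      (congrArg (· + _) ((integral_add ((i1 hη hηc d).add j2) j3).trans
        (congrArg (· + _) (integral_add (i1 hη hηc d) j2)))))
    congr 1; ext x
    rw [hfd]; simp only [Pi.add_apply]; ring
  have hlim := ((tendsto_const_nhds (x := ∫ x in Ω, b (w x) * fderiv ℝ η x d)).add
    (t1.comp hns.tendsto_atTop)).add (t2.comp hns.tendsto_atTop) |>.add t3
  have hlim0 := t0.comp hns.tendsto_atTop
  have := tendsto_nhds_unique (hlim0.congr fun n => hsplit (ns n)) hlim
  have e5 : ∫ x in Ω, inner ℝ (deriv b (w x) • G x) d * η x =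
      ∫ x in Ω, η x * deriv b (w x) * inner ℝ (G x) d := by
    congr 1; ext x; rw [real_inner_smul_left]; ring
  rw [e5]
  linarith

/-- If the trace of `u` is at most that of `v`, then the truncations of `u - v` have weakly
differentiable extensions by zero. -/
lemma hasZeroExtensionGradient_of_trace_le (hN : 1 ≤ N) {Ω : Set (RN N)}
    (hΩ : IsBoundedLipschitzDomain Ω) {p : ℝ} (hp : 1 ≤ p) {b : ℝ → ℝ} (hb : ContDiff ℝ 1 b)
    (hb' : ∀ s, |deriv b s| ≤ 1) (hb0 : ∀ s, |b s| ≤ max s 0) {u v : RN N → ℝ}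
    {G H : RN N → RN N} (hu : MemLp u (ENNReal.ofReal p) (volume.restrict Ω))
    (hv : MemLp v (ENNReal.ofReal p) (volume.restrict Ω))
    (hG : MemLp G (ENNReal.ofReal p) (volume.restrict Ω))
    (hH : MemLp H (ENNReal.ofReal p) (volume.restrict Ω)) {k l : RN N → ℝ}
    (hk : AEStronglyMeasurable k (surfaceMeasure Ω))
    (hl : AEStronglyMeasurable l (surfaceMeasure Ω))
    (hku : HasTrace Ω p u G k) (hlv : HasTrace Ω p v H l)
    (hkl : ∀ᵐ x ∂(surfaceMeasure Ω), k x ≤ l x) :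
    HasZeroExtensionGradient Ω (fun x => b (u x - v x))
      (fun x => deriv b (u x - v x) • (G x - H x)) := by
  have hq : 1 ≤ ENNReal.ofReal p := by simpa using hp
  obtain ⟨η, hη, hηu, hηG, hηk⟩ := hku
  obtain ⟨ζ, hζ, hζv, hζH, hζl⟩ := hlv
  have hgr : ∀ {f : RN N → ℝ}, ContDiff ℝ ∞ f → Continuous (gradient f) := fun hf =>
    (LinearIsometryEquiv.continuous _).comp (hf.continuous_fderiv (by simp))
  refine hasZeroExtensionGradient_truncation hN hΩ hp hb hb' hb0 (hu.sub hv) (hG.sub hH)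
    (θ := fun n x => η n x - ζ n x) (fun n => (hη n).sub (hζ n)) ?_ ?_ ?_
  · refine tendsto_of_tendsto_of_tendsto_of_le_of_le tendsto_const_nhds
      (by simpa using hηu.add hζv) (fun _ => zero_le) fun n => ?_
    refine le_trans (le_of_eq ?_) (eLpNorm_sub_le ((hη n).continuous.aestronglyMeasurable.sub hu.1)
      ((hζ n).continuous.aestronglyMeasurable.sub hv.1) hq)
    congr 1; ext x; simp; ring
  · refine tendsto_of_tendsto_of_tendsto_of_le_of_le tendsto_const_nhds
      (by simpa using hηG.add hζH) (fun _ => zero_le) fun n => ?_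
    refine le_trans (le_of_eq ?_) (eLpNorm_sub_le
      ((hgr (hη n)).aestronglyMeasurable.sub hG.1)
      ((hgr (hζ n)).aestronglyMeasurable.sub hH.1) hq)
    congr 1; ext1 x
    have : gradient (fun x => η n x - ζ n x) x = gradient (η n) x - gradient (ζ n) x := by
      simp only [gradient]
      rw [fderiv_fun_sub ((hη n).differentiable (by simp) x) ((hζ n).differentiable (by simp) x),
        map_sub]
    simp only [this, Pi.sub_apply]; abel
  · refine tendsto_of_tendsto_of_tendsto_of_le_of_le tendsto_const_nhds
      (by simpa using hηk.add hζl) (fun _ => zero_le) fun n => ?_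
    refine le_trans (eLpNorm_mono_ae ?_) (eLpNorm_sub_le
      ((hη n).continuous.aestronglyMeasurable.sub hk)
      ((hζ n).continuous.aestronglyMeasurable.sub hl) hq)
    filter_upwards [hkl] with x hx
    rw [Real.norm_of_nonneg (le_max_right _ _), Pi.sub_apply, Real.norm_eq_abs]
    refine max_le (le_trans ?_ (le_abs_self _)) (abs_nonneg _)
    linarith

/-! ### The truncation and its primitive -/

/-- A bounded nondecreasing `C¹` truncation which vanishes exactly on the nonpositive numbers. -/
noncomputable def trunc (s : ℝ) : ℝ := max s 0 ^ 2 / (1 + max s 0 ^ 2)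

/-- The primitive of `trunc` vanishing on the nonpositive numbers. -/
noncomputable def truncPrim (s : ℝ) : ℝ := max s 0 - Real.arctan (max s 0)

lemma continuous_trunc : Continuous trunc := by
  unfold trunc
  refine Continuous.div (by fun_prop) (by fun_prop) fun s => by positivity

lemma continuous_truncPrim : Continuous truncPrim := by
  unfold truncPrim
  exact (by fun_prop : Continuous fun s : ℝ => max s 0).sub
    (Real.continuous_arctan.comp (by fun_prop))

lemma trunc_nonneg (s : ℝ) : 0 ≤ trunc s := by unfold trunc; positivity

lemma trunc_le_one (s : ℝ) : trunc s ≤ 1 := by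
  unfold trunc; rw [div_le_one (by positivity)]; linarith

lemma trunc_of_nonpos {s : ℝ} (hs : s ≤ 0) : trunc s = 0 := by simp [trunc, max_eq_right hs]

lemma truncPrim_of_nonpos {s : ℝ} (hs : s ≤ 0) : truncPrim s = 0 := by
  simp [truncPrim, max_eq_right hs]

lemma trunc_le (s : ℝ) : trunc s ≤ max s 0 := by
  unfold trunc
  have : 0 ≤ max s 0 := le_max_right _ _
  rw [div_le_iff₀ (by positivity)]
  nlinarith [mul_nonneg this (sq_nonneg (max s 0 - 1)), mul_nonneg this (sq_nonneg (max s 0))]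

/-- A function with the given derivative on both sides of `0` which is continuous at `0`. -/
lemma hasDerivAt_of_pos_of_neg {f f' : ℝ → ℝ} (hf : Continuous f) (hf' : Continuous f')
    (hpos : ∀ s, 0 < s → HasDerivAt f (f' s) s) (hneg : ∀ s < 0, HasDerivAt f (f' s) s) (s : ℝ) :
    HasDerivAt f (f' s) s := by
  have hne : ∀ s ≠ 0, HasDerivAt f (f' s) s := fun s hs =>
    (lt_or_gt_of_ne hs).elim (hneg s) (hpos s)
  rcases eq_or_ne s 0 with rfl | hs
  · exact hasDerivAt_of_hasDerivAt_of_ne hne hf.continuousAt hf'.continuousAt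
  · exact hne s hs

lemma hasDerivAt_trunc (s : ℝ) :
    HasDerivAt trunc (2 * max s 0 / (1 + max s 0 ^ 2) ^ 2) s := by
  refine hasDerivAt_of_pos_of_neg (f' := fun s => 2 * max s 0 / (1 + max s 0 ^ 2) ^ 2)
    continuous_trunc (Continuous.div (by fun_prop) (by fun_prop) fun s => by positivity)
    (fun s hs => ?_) (fun s hs => ?_) s
  · have h1 : HasDerivAt (fun s : ℝ => s ^ 2 / (1 + s ^ 2)) (2 * s / (1 + s ^ 2) ^ 2) s := by
      have h2 : HasDerivAt (fun s : ℝ => s ^ 2) (2 * s) s := by simpa using hasDerivAt_pow 2 s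
      convert! h2.div (h2.const_add 1) (by positivity) using 1
      congr 1; ring
    rw [max_eq_left hs.le]
    refine h1.congr_of_eventuallyEq ?_
    filter_upwards [lt_mem_nhds hs] with t ht
    rw [trunc, max_eq_left ht.le]
  · rw [max_eq_right hs.le, mul_zero, zero_div]
    refine (hasDerivAt_const s (0 : ℝ)).congr_of_eventuallyEq ?_
    filter_upwards [gt_mem_nhds hs] with t ht
    exact trunc_of_nonpos ht.le

lemma contDiff_trunc : ContDiff ℝ 1 trunc := by
  rw [contDiff_one_iff_deriv]
  refine ⟨fun s => (hasDerivAt_trunc s).differentiableAt, ?_⟩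
  rw [funext fun s => (hasDerivAt_trunc s).deriv]
  exact Continuous.div (by fun_prop) (by fun_prop) fun s => by positivity

lemma deriv_trunc_nonneg (s : ℝ) : 0 ≤ deriv trunc s := by
  rw [(hasDerivAt_trunc s).deriv]
  have : 0 ≤ max s 0 := le_max_right _ _
  positivity

lemma deriv_trunc_le_one (s : ℝ) : deriv trunc s ≤ 1 := by
  rw [(hasDerivAt_trunc s).deriv, div_le_one (by positivity)]
  nlinarith [sq_nonneg (max s 0 - 1), sq_nonneg (max s 0 ^ 2)]

lemma monotone_trunc : Monotone trunc :=
  monotone_of_deriv_nonneg (fun s => (hasDerivAt_trunc s).differentiableAt) deriv_trunc_nonneg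

lemma hasDerivAt_truncPrim (s : ℝ) : HasDerivAt truncPrim (trunc s) s := by
  refine hasDerivAt_of_pos_of_neg continuous_truncPrim continuous_trunc
    (fun s hs => ?_) (fun s hs => ?_) s
  · have h1 : HasDerivAt (fun s : ℝ => s - Real.arctan s) (trunc s) s := by
      convert! (hasDerivAt_id s).sub (Real.hasDerivAt_arctan s) using 1
      rw [trunc, max_eq_left hs.le]; field_simp; ring
    refine h1.congr_of_eventuallyEq ?_
    filter_upwards [lt_mem_nhds hs] with t ht
    rw [truncPrim, max_eq_left ht.le]
  · rw [trunc_of_nonpos hs.le]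
    refine (hasDerivAt_const s (0 : ℝ)).congr_of_eventuallyEq ?_
    filter_upwards [gt_mem_nhds hs] with t ht
    exact truncPrim_of_nonpos ht.le

lemma abs_truncPrim_sub_le (s t : ℝ) : |truncPrim s - truncPrim t| ≤ |s - t| := by
  have := lipschitzWith_of_nnnorm_deriv_le (f := truncPrim)
    (fun s => (hasDerivAt_truncPrim s).differentiableAt) (C := 1) (fun s => by
    rw [(hasDerivAt_truncPrim s).deriv, ← NNReal.coe_le_coe]
    simpa [abs_of_nonneg (trunc_nonneg s)] using trunc_le_one s)
  simpa [Real.dist_eq] using this.dist_le_mul s t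

lemma truncPrim_nonneg (s : ℝ) : 0 ≤ truncPrim s := by
  have h := monotone_of_deriv_nonneg (fun s => (hasDerivAt_truncPrim s).differentiableAt)
    (fun s => by rw [(hasDerivAt_truncPrim s).deriv]; exact trunc_nonneg s)
  rcases le_total s 0 with hs | hs
  · rw [truncPrim_of_nonpos hs]
  · exact (truncPrim_of_nonpos le_rfl).symm.le.trans (h hs)

lemma truncPrim_le_abs (s : ℝ) : truncPrim s ≤ |s| := by
  have := abs_truncPrim_sub_le s 0
  rw [truncPrim_of_nonpos le_rfl, sub_zero, sub_zero] at this
  exact (le_abs_self _).trans this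

/-- The tangent line inequality for the convex function `truncPrim`. -/
lemma trunc_mul_sub_le (r s : ℝ) : trunc s * (r - s) ≤ truncPrim r - truncPrim s := by
  have hd : ∀ s, HasDerivAt truncPrim (trunc s) s := hasDerivAt_truncPrim
  rcases lt_trichotomy s r with h | h | h
  · obtain ⟨c, hc, he⟩ := exists_hasDerivAt_eq_slope truncPrim trunc h
      continuous_truncPrim.continuousOn fun x _ => hd x
    rw [eq_div_iff (by linarith)] at he
    rw [← he]
    exact mul_le_mul_of_nonneg_right (monotone_trunc hc.1.le) (by linarith)
  · simp [h]
  · obtain ⟨c, hc, he⟩ := exists_hasDerivAt_eq_slope truncPrim trunc h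
      continuous_truncPrim.continuousOn fun x _ => hd x
    rw [eq_div_iff (by linarith)] at he
    have := mul_le_mul_of_nonneg_right (monotone_trunc hc.2.le) (by linarith : 0 ≤ s - r)
    linarith

/-- Up to a constant, the integrand `s * trunc s` of the reaction term is controlled by the energy
density. With `s³ / (1 + s²)` on the left, the difference of the two sides is nondecreasing on
`[0, ∞)`. -/
lemma mul_trunc_le (s : ℝ) : s * trunc s ≤ 3 * truncPrim s := by
  rcases le_or_gt s 0 with hs | hs
  · rw [trunc_of_nonpos hs, truncPrim_of_nonpos hs]; simp
  have hd : ∀ t : ℝ, HasDerivAt (fun t => 3 * (t - Real.arctan t) - t ^ 3 / (1 + t ^ 2))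
      (3 * (1 - 1 / (1 + t ^ 2)) - (3 * t ^ 2 * (1 + t ^ 2) - t ^ 3 * (2 * t)) / (1 + t ^ 2) ^ 2)
      t := fun t => by
    have h2 : HasDerivAt (fun t : ℝ => 1 + t ^ 2) (2 * t) t := by
      simpa using (hasDerivAt_pow 2 t).const_add 1
    have h3 : HasDerivAt (fun t : ℝ => t ^ 3) (3 * t ^ 2) t := by simpa using hasDerivAt_pow 3 t
    exact (((hasDerivAt_id t).sub (Real.hasDerivAt_arctan t)).const_mul 3).sub
      (h3.div h2 (by positivity))
  have hmono : Monotone fun t : ℝ => 3 * (t - Real.arctan t) - t ^ 3 / (1 + t ^ 2) := by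
    refine monotone_of_deriv_nonneg (fun t => (hd t).differentiableAt) fun t => ?_
    rw [(hd t).deriv]
    have : 3 * (1 - 1 / (1 + t ^ 2)) - (3 * t ^ 2 * (1 + t ^ 2) - t ^ 3 * (2 * t)) / (1 + t ^ 2) ^ 2
        = 2 * t ^ 4 / (1 + t ^ 2) ^ 2 := by
      field_simp; ring
    rw [this]; positivity
  have h0 := hmono hs.le
  simp only [Real.arctan_zero] at h0
  rw [trunc, truncPrim, max_eq_left hs.le]
  have : s * (s ^ 2 / (1 + s ^ 2)) = s ^ 3 / (1 + s ^ 2) := by ring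
  rw [this]
  norm_num at h0
  linarith

lemma nonpos_of_truncPrim_eq_zero {s : ℝ} (h : truncPrim s = 0) : s ≤ 0 := by
  by_contra! hs
  have h1 := mul_trunc_le s
  rw [h, mul_zero] at h1
  have h2 : 0 < trunc s := by
    rw [trunc, max_eq_left hs.le]; positivity
  nlinarith [mul_pos hs h2]

/-! ### The nonlinearity `a ↦ |a|^{p-2} a` -/

lemma norm_rpow_sub_two_mul_norm {F : Type*} [NormedAddCommGroup F] {p : ℝ} (hp : 1 < p) (a : F) :
    ‖a‖ ^ (p - 2) * ‖a‖ = ‖a‖ ^ (p - 1) := by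
  rcases eq_or_ne a 0 with rfl | ha
  · rw [norm_zero, mul_zero, Real.zero_rpow (by linarith)]
  · rw [← Real.rpow_add_one (by simpa using ha)]; congr 1; ring

/-- Monotonicity of the `p`-Laplacian. -/
lemma inner_norm_rpow_smul_sub_nonneg {F : Type*} [NormedAddCommGroup F] [InnerProductSpace ℝ F]
    {p : ℝ} (hp : 1 < p) (a c : F) :
    0 ≤ (inner ℝ (‖a‖ ^ (p - 2) • a - ‖c‖ ^ (p - 2) • c) (a - c) : ℝ) := by
  have h1 : (inner ℝ (‖a‖ ^ (p - 2) • a - ‖c‖ ^ (p - 2) • c) (a - c) : ℝ) =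
      ‖a‖ ^ (p - 1) * ‖a‖ + ‖c‖ ^ (p - 1) * ‖c‖ -
        (‖a‖ ^ (p - 2) + ‖c‖ ^ (p - 2)) * inner ℝ a c := by
    rw [← norm_rpow_sub_two_mul_norm hp a, ← norm_rpow_sub_two_mul_norm hp c]
    simp only [inner_sub_left, inner_sub_right, real_inner_smul_left,
      real_inner_self_eq_norm_mul_norm,
      real_inner_comm c a]
    ring
  have h2 : (‖a‖ ^ (p - 2) + ‖c‖ ^ (p - 2)) * (inner ℝ a c : ℝ) ≤
      (‖a‖ ^ (p - 2) + ‖c‖ ^ (p - 2)) * (‖a‖ * ‖c‖) := by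
    gcongr
    exact real_inner_le_norm a c
  have h3 : (‖a‖ ^ (p - 2) + ‖c‖ ^ (p - 2)) * (‖a‖ * ‖c‖) =
      ‖a‖ ^ (p - 1) * ‖c‖ + ‖c‖ ^ (p - 1) * ‖a‖ := by
    rw [← norm_rpow_sub_two_mul_norm hp a, ← norm_rpow_sub_two_mul_norm hp c]; ring
  have h4 : 0 ≤ (‖a‖ ^ (p - 1) - ‖c‖ ^ (p - 1)) * (‖a‖ - ‖c‖) := by
    rcases le_total ‖a‖ ‖c‖ with h | h
    · exact mul_nonneg_of_nonpos_of_nonpos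
        (sub_nonpos.2 (Real.rpow_le_rpow (norm_nonneg _) h (by linarith))) (sub_nonpos.2 h)
    · exact mul_nonneg
        (sub_nonneg.2 (Real.rpow_le_rpow (norm_nonneg _) h (by linarith))) (sub_nonneg.2 h)
  rw [h1]; nlinarith

lemma abs_rpow_mul_mono {p : ℝ} (hp : 1 < p) {r s : ℝ} (h : r ≤ s) :
    |r| ^ (p - 2) * r ≤ |s| ^ (p - 2) * s := by
  rcases h.eq_or_lt with rfl | h
  · rfl
  have := inner_norm_rpow_smul_sub_nonneg hp s r
  simp only [smul_eq_mul, Real.norm_eq_abs, RCLike.inner_apply, conj_trivial] at this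
  have h1 := nonneg_of_mul_nonneg_right this (sub_pos.2 h)
  linarith

/-- For `p > 2` the nonlinearity is Lipschitz on bounded sets. -/
lemma abs_rpow_mul_sub_le {p : ℝ} (hp : 2 < p) {M r s : ℝ} (hr : |r| ≤ M) (hs : |s| ≤ M)
    (h : r ≤ s) :
    |s| ^ (p - 2) * s - |r| ^ (p - 2) * r ≤ (p - 1) * M ^ (p - 2) * (s - r) := by
  have hc : Continuous fun s : ℝ => |s| ^ (p - 2) :=
    continuous_abs.rpow_const fun s => .inr (by linarith)
  have hd : ∀ s : ℝ, HasDerivAt (fun s : ℝ => |s| ^ (p - 2) * s) ((p - 1) * |s| ^ (p - 2)) s := by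
    refine hasDerivAt_of_pos_of_neg (hc.mul continuous_id) (hc.const_mul _)
      (fun s hs => ?_) (fun s hs => ?_)
    · have h1 : HasDerivAt (fun s : ℝ => s ^ (p - 1)) ((p - 1) * s ^ (p - 1 - 1)) s :=
        Real.hasDerivAt_rpow_const (.inl hs.ne')
      rw [abs_of_pos hs]
      have e : p - 1 - 1 = p - 2 := by ring
      rw [e] at h1
      refine h1.congr_of_eventuallyEq ?_
      filter_upwards [lt_mem_nhds hs] with t ht
      rw [abs_of_pos ht, ← Real.rpow_add_one ht.ne']; congr 1; ring
    · have h1 : HasDerivAt (fun s : ℝ => -(-s) ^ (p - 1)) ((p - 1) * (-s) ^ (p - 2)) s := by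
        have h2 : HasDerivAt (fun s : ℝ => (-s) ^ (p - 1)) _ s :=
          (hasDerivAt_neg s).rpow_const (.inl (by linarith : (-s) ≠ 0))
        convert! h2.neg using 1
        have e : p - 1 - 1 = p - 2 := by ring
        rw [e]; ring
      rw [abs_of_neg hs]
      refine h1.congr_of_eventuallyEq ?_
      filter_upwards [gt_mem_nhds hs] with t ht
      have ht' : 0 < -t := by linarith
      have : (-t) ^ (p - 1) = (-t) ^ (p - 2) * (-t) := by
        rw [← Real.rpow_add_one ht'.ne']; congr 1; ring
      rw [abs_of_neg ht, this]; ring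
  refine (convex_Icc (-M) M).image_sub_le_mul_sub_of_deriv_le (hc.mul continuous_id).continuousOn
    (fun s _ => (hd s).differentiableAt.differentiableWithinAt) (fun s hs => ?_) r (abs_le.1 hr) s
    (abs_le.1 hs) h
  refine le_trans (le_of_eq (hd s).deriv) ?_
  have : |s| ≤ M := abs_le.2 (interior_subset (s := Icc (-M) M) hs)
  gcongr
  all_goals linarith

/-! ### Averages in time -/

/-- The uniform probability measure on the time interval `(0, h]`. -/
noncomputable def timeMeasure (h : ℝ) : Measure ℝ :=
  ENNReal.ofReal h⁻¹ • volume.restrict (Ioc 0 h)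

lemma isProbabilityMeasure_timeMeasure {h : ℝ} (hh : 0 < h) :
    IsProbabilityMeasure (timeMeasure h) := by
  constructor
  rw [timeMeasure, Measure.smul_apply, Measure.restrict_apply_univ, Real.volume_Ioc, sub_zero,
    smul_eq_mul, ← ENNReal.ofReal_mul (by positivity), inv_mul_cancel₀ hh.ne', ENNReal.ofReal_one]

instance (h : ℝ) : IsFiniteMeasure (timeMeasure h) := by
  constructor
  rw [timeMeasure, Measure.smul_apply, Measure.restrict_apply_univ, Real.volume_Ioc, smul_eq_mul]
  exact ENNReal.mul_lt_top (by simp) (by simp)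

lemma timeMeasure_absolutelyContinuous (h : ℝ) : timeMeasure h ≪ volume :=
  (Measure.smul_absolutelyContinuous).trans Measure.absolutelyContinuous_restrict

lemma integral_timeMeasure {F : Type*} [NormedAddCommGroup F] [NormedSpace ℝ F] {h : ℝ}
    (hh : 0 < h) (f : ℝ → F) : ∫ s, f s ∂(timeMeasure h) = h⁻¹ • ∫ s in Ioc 0 h, f s := by
  rw [timeMeasure, integral_smul_measure, ENNReal.toReal_ofReal (by positivity)]

/-- The average of `W(x, ·)` over the time interval `(t, t + h]`. -/
noncomputable def timeAverage {F : Type*} [NormedAddCommGroup F] [NormedSpace ℝ F] (h : ℝ)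
    (W : RN N × ℝ → F) (z : RN N × ℝ) : F :=
  ∫ s, W (z.1, z.2 + s) ∂(timeMeasure h)

section TimeAverage

variable {F : Type*} [NormedAddCommGroup F] [NormedSpace ℝ F] {h : ℝ} {W : RN N × ℝ → F}

lemma stronglyMeasurable_timeAverage (hW : StronglyMeasurable W) :
    StronglyMeasurable (timeAverage h W) :=
  StronglyMeasurable.integral_prod_right (f := fun (z : RN N × ℝ) s => W (z.1, z.2 + s))
    (hW.comp_measurable (by fun_prop))

/-- The time average is an average over translates in space-time. -/
lemma timeAverage_eq_integral_map (hW : StronglyMeasurable W) (z : RN N × ℝ) :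
    timeAverage h W z = ∫ y, W (z + y) ∂((timeMeasure h).map fun s => ((0 : RN N), s)) := by
  rw [integral_map (f := fun y => W (z + y)) (by fun_prop)
    (hW.comp_measurable (measurable_const_add z)).aestronglyMeasurable]
  simp [timeAverage, Prod.add_def]

lemma eLpNorm_timeAverage_le (hh : 0 < h) (hW : StronglyMeasurable W) {q : ℝ≥0∞} (hq : 1 ≤ q)
    (hq' : q ≠ ⊤) : eLpNorm (timeAverage h W) q volume ≤ eLpNorm W q volume := by
  have := isProbabilityMeasure_timeMeasure hh
  have : IsProbabilityMeasure ((timeMeasure h).map fun s => ((0 : RN N), s)) :=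
    Measure.isProbabilityMeasure_map (by fun_prop)
  rw [funext (timeAverage_eq_integral_map hW)]
  have hvol : (volume : Measure (RN N × ℝ)).IsAddHaarMeasure :=
    Measure.prod.instIsAddHaarMeasure _ _
  exact eLpNorm_translate_average_le hq hq' hW _

lemma tendsto_eLpNorm_timeAverage_sub [CompleteSpace F] (hW : StronglyMeasurable W)
    (hWi : Integrable W) {q : ℝ≥0∞} (hq : 1 ≤ q) (hq' : q ≠ ⊤) (hWq : MemLp W q volume)
    {τ : ℕ → ℝ} (hτ : ∀ n, 0 < τ n) (hτ0 : Tendsto τ atTop (𝓝 0)) :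
    Tendsto (fun n => eLpNorm (fun z => timeAverage (τ n) W z - W z) q volume) atTop (𝓝 0) := by
  have := fun n => isProbabilityMeasure_timeMeasure (hτ n)
  have : ∀ n, IsProbabilityMeasure ((timeMeasure (τ n)).map fun s => ((0 : RN N), s)) :=
    fun n => Measure.isProbabilityMeasure_map (by fun_prop)
  have hvol : (volume : Measure (RN N × ℝ)).IsAddHaarMeasure :=
    Measure.prod.instIsAddHaarMeasure _ _
  simp only [timeAverage_eq_integral_map hW]
  refine tendsto_eLpNorm_translate_average_sub hq hq' hW hWq _ (fun U hU => ?_) fun n => ?_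
  · obtain ⟨V, hVU, hV, h0V⟩ := mem_nhds_iff.1 hU
    have hV' : (fun s : ℝ => ((0 : RN N), s)) ⁻¹' V ∈ 𝓝 (0 : ℝ) :=
      (by fun_prop : Continuous fun s : ℝ => ((0 : RN N), s)).continuousAt.preimage_mem_nhds
        (hV.mem_nhds h0V)
    obtain ⟨ε, hε, hεV⟩ := Metric.mem_nhds_iff.1 hV'
    filter_upwards [hτ0.eventually_lt_const hε] with n hn
    have h1 : ∀ᵐ y ∂((timeMeasure (τ n)).map fun s => ((0 : RN N), s)), y ∈ V := by
      rw [ae_map_iff (p := fun y => y ∈ V) (by fun_prop) hV.measurableSet]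
      refine (Measure.smul_absolutelyContinuous (c := ENNReal.ofReal (τ n)⁻¹)).ae_le ?_
      filter_upwards [ae_restrict_mem measurableSet_Ioc] with s hs
      refine hεV (mem_ball_zero_iff.2 ?_)
      rw [Real.norm_of_nonneg hs.1.le]
      exact hs.2.trans_lt hn
    exact h1.mono fun y hy => hVU hy
  · have h1 : ∀ᵐ x : RN N, Integrable fun t => W (x, t) := by
      rw [Measure.volume_eq_prod] at hWi
      exact hWi.prod_right_ae
    have h2 : ∀ᵐ z : RN N × ℝ, Integrable fun t => W (z.1, t) := by
      rw [Measure.volume_eq_prod]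
      exact Measure.quasiMeasurePreserving_fst.ae h1
    filter_upwards [h2] with z hz
    rw [integrable_map_measure (g := fun y => W (z + y))
      (hW.comp_measurable (measurable_const_add z)).aestronglyMeasurable
      (by fun_prop)]
    have h3 : Integrable (fun s => W (z.1, z.2 + s)) := hz.comp_add_left z.2
    refine ((h3.restrict (s := Ioc 0 (τ n))).smul_measure (c := ENNReal.ofReal (τ n)⁻¹)
      (by simp)).congr (.of_forall fun s => ?_)
    simp [Prod.add_def]

end TimeAverage

/-- Almost all time slices of an `L^q` function of space-time are in `L^q`. -/
lemma ae_memLp_slice {F : Type*} [NormedAddCommGroup F] {W : RN N × ℝ → F}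
    (hW : StronglyMeasurable W) {q : ℝ≥0∞} (hq : 1 ≤ q) (hq' : q ≠ ⊤)
    (hWq : MemLp W q volume) : ∀ᵐ t : ℝ, MemLp (fun x => W (x, t)) q volume := by
  have hq0 : q ≠ 0 := (zero_lt_one.trans_le hq).ne'
  have h1 := (integrable_norm_rpow_iff hW.aestronglyMeasurable hq0 hq').2 hWq
  rw [Measure.volume_eq_prod] at h1
  filter_upwards [h1.prod_left_ae] with t ht
  exact (integrable_norm_rpow_iff
    (hW.comp_measurable measurable_prodMk_right).aestronglyMeasurable hq0 hq').1 ht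

/-- A space-time integrable function, translated in time, is integrable against the product with
the averaging measure. -/
lemma integrable_prod_timeMeasure {F : Type*} [NormedAddCommGroup F] {W : RN N × ℝ → F}
    (hW : Integrable W) (Ω : Set (RN N)) (h t : ℝ) :
    Integrable (fun z : RN N × ℝ => W (z.1, t + z.2))
      ((volume.restrict Ω).prod (timeMeasure h)) := by
  have hvol : (volume : Measure (RN N × ℝ)).IsAddHaarMeasure :=
    Measure.prod.instIsAddHaarMeasure _ _
  have h1 : Integrable (fun z : RN N × ℝ => W (z.1, t + z.2)) := by
    have := hW.comp_add_left ((0 : RN N), t)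
    refine this.congr (.of_forall fun z => ?_)
    simp [Prod.add_def]
  rw [timeMeasure, Measure.prod_smul_right, Measure.prod_restrict, ← Measure.volume_eq_prod]
  exact (h1.restrict).smul_measure (by simp)

/-- The time average inherits a weakly differentiable extension by zero from the time slices. -/
lemma hasZeroExtensionGradient_timeAverage {Ω : Set (RN N)} {W : RN N × ℝ → ℝ}
    {H : RN N × ℝ → RN N} (hW : Integrable W) (hH : Integrable H)
    (hz : ∀ᵐ t : ℝ, HasZeroExtensionGradient Ω (fun x => W (x, t)) (fun x => H (x, t)))
    (h t : ℝ) : HasZeroExtensionGradient Ω (fun x => timeAverage h W (x, t))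
      (fun x => timeAverage h H (x, t)) := by
  intro η hη hηc d
  have hz' : ∀ᵐ s ∂(timeMeasure h),
      HasZeroExtensionGradient Ω (fun x => W (x, t + s)) (fun x => H (x, t + s)) :=
    (timeMeasure_absolutelyContinuous h).ae_le
      ((measurePreserving_add_left volume t).quasiMeasurePreserving.ae hz)
  have hdc : Continuous fun x => fderiv ℝ η x d :=
    (hη.continuous_fderiv (by simp)).clm_apply continuous_const
  obtain ⟨D, hD⟩ := hdc.bounded_above_of_compact_support (hηc.fderiv_apply (𝕜 := ℝ) d)
  obtain ⟨M, hM⟩ := hη.continuous.bounded_above_of_compact_support hηc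
  have i1 : Integrable (fun z : RN N × ℝ => W (z.1, t + z.2) * fderiv ℝ η z.1 d)
      ((volume.restrict Ω).prod (timeMeasure h)) :=
    (integrable_prod_timeMeasure hW Ω h t).mul_bdd (c := D)
      (hdc.comp continuous_fst).aestronglyMeasurable (.of_forall fun z => hD _)
  have i2 : Integrable (fun z : RN N × ℝ => inner ℝ (H (z.1, t + z.2)) d * η z.1)
      ((volume.restrict Ω).prod (timeMeasure h)) :=
    ((integrable_prod_timeMeasure hH Ω h t).inner_const d).mul_bdd (c := M)
      (hη.continuous.comp continuous_fst).aestronglyMeasurable (.of_forall fun z => hM _)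
  calc ∫ x in Ω, timeAverage h W (x, t) * fderiv ℝ η x d
      = ∫ x in Ω, ∫ s, W (x, t + s) * fderiv ℝ η x d ∂(timeMeasure h) := by
        congr 1; ext x; rw [integral_mul_const]; rfl
    _ = ∫ s, (∫ x in Ω, W (x, t + s) * fderiv ℝ η x d) ∂(timeMeasure h) :=
        integral_integral_swap i1
    _ = ∫ s, (- ∫ x in Ω, inner ℝ (H (x, t + s)) d * η x) ∂(timeMeasure h) :=
        integral_congr_ae (hz'.mono fun s hs => hs η hη hηc d)
    _ = - ∫ s, (∫ x in Ω, inner ℝ (H (x, t + s)) d * η x) ∂(timeMeasure h) := integral_neg _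
    _ = - ∫ x in Ω, ∫ s, inner ℝ (H (x, t + s)) d * η x ∂(timeMeasure h) := by
        rw [← integral_integral_swap i2]
    _ = - ∫ x in Ω, inner ℝ (timeAverage h H (x, t)) d * η x := by
        congr 1
        refine integral_congr_ae ?_
        filter_upwards [(integrable_prod_timeMeasure hH Ω h t).prod_right_ae] with x hx
        rw [integral_mul_const, timeAverage, real_inner_comm d, ← integral_inner hx]
        simp only [real_inner_comm]

/-- Integration by parts in time for the average of a bounded function. -/
lemma integral_average_mul_deriv {h : ℝ} {f : ℝ → ℝ} (hf : Measurable f) (hf1 : ∀ t, |f t| ≤ 1)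
    (hh : 0 < h)
    {η : ℝ → ℝ} (hη : ContDiff ℝ ∞ η) (hηc : HasCompactSupport η) :
    ∫ t, (∫ s, f (t + s) ∂(timeMeasure h)) * deriv η t =
      - ∫ t, h⁻¹ * (f (t + h) - f t) * η t := by
  have hdc : Continuous (deriv η) := hη.continuous_deriv (by simp)
  have hηi : Integrable η := hη.continuous.integrable_of_hasCompactSupport hηc
  have hdi : Integrable (deriv η) := hdc.integrable_of_hasCompactSupport hηc.deriv
  have i1 : Integrable (fun z : ℝ × ℝ => f (z.1 + z.2) * deriv η z.1)
      (volume.prod (timeMeasure h)) := by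
    have h1 : Integrable (fun z : ℝ × ℝ => deriv η z.1) (volume.prod (timeMeasure h)) :=
      hdi.comp_fst _
    exact h1.bdd_mul (c := 1) (hf.comp (by fun_prop)).aestronglyMeasurable
      (.of_forall fun z => hf1 _)
  have i2 : Integrable (fun z : ℝ × ℝ => f z.1 * deriv η (z.1 - z.2))
      (volume.prod (timeMeasure h)) := by
    have h1 : Integrable (fun z : ℝ × ℝ => deriv η z.1) (volume.prod (timeMeasure h)) :=
      hdi.comp_fst _
    have h2 : Integrable (fun z : ℝ × ℝ => deriv η (z.1 - z.2)) (volume.prod (timeMeasure h)) :=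
      (measurePreserving_sub_prod volume (timeMeasure h)).integrable_comp_of_integrable h1
    exact h2.bdd_mul (c := 1) (hf.comp (by fun_prop)).aestronglyMeasurable
      (.of_forall fun z => hf1 _)
  have hfη : Integrable (fun t => f t * η t) :=
    hηi.bdd_mul (c := 1) hf.aestronglyMeasurable (.of_forall hf1)
  have hfη' : Integrable (fun t => f (t + h) * η t) :=
    hηi.bdd_mul (c := 1) (hf.comp (by fun_prop)).aestronglyMeasurable (.of_forall fun _ => hf1 _)
  have hfη'' : Integrable (fun t => f t * η (t - h)) :=
    (hηi.comp_sub_right h).bdd_mul (c := 1) hf.aestronglyMeasurable (.of_forall hf1)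
  calc ∫ t, (∫ s, f (t + s) ∂(timeMeasure h)) * deriv η t
      = ∫ t, ∫ s, f (t + s) * deriv η t ∂(timeMeasure h) := by
        congr 1; ext t; rw [integral_mul_const]
    _ = ∫ s, (∫ t, f (t + s) * deriv η t) ∂(timeMeasure h) := integral_integral_swap i1
    _ = ∫ s, (∫ t, f t * deriv η (t - s)) ∂(timeMeasure h) := by
        congr 1; ext s
        rw [← integral_add_right_eq_self (fun t => f t * deriv η (t - s)) s]
        simp
    _ = ∫ t, ∫ s, f t * deriv η (t - s) ∂(timeMeasure h) := (integral_integral_swap i2).symm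
    _ = ∫ t, h⁻¹ * (f t * η t - f t * η (t - h)) := by
        congr 1; ext t
        rw [integral_const_mul, integral_timeMeasure hh, ← intervalIntegral.integral_of_le hh.le,
          intervalIntegral.integral_comp_sub_left (fun s => deriv η s) t,
          intervalIntegral.integral_deriv_eq_sub' η rfl
            (fun x _ => hη.differentiable (by simp) x) hdc.continuousOn]
        simp only [sub_zero, smul_eq_mul]; ring
    _ = h⁻¹ * ((∫ t, f t * η t) - ∫ t, f t * η (t - h)) := by
        rw [integral_const_mul, integral_sub hfη hfη'']
    _ = h⁻¹ * ((∫ t, f t * η t) - ∫ t, f (t + h) * η t) := by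
        rw [← integral_add_right_eq_self (fun t => f t * η (t - h)) h]
        simp
    _ = - ∫ t, h⁻¹ * (f (t + h) - f t) * η t := by
        simp only [mul_assoc, sub_mul]
        rw [integral_const_mul, integral_sub hfη' hfη]; ring

/-- The average of a bounded function is Lipschitz continuous. -/
lemma abs_average_sub_le {h : ℝ} {f : ℝ → ℝ} (hf : Measurable f) (hf1 : ∀ t, |f t| ≤ 1)
    (hh : 0 < h)
    (t s : ℝ) : |(∫ r, f (t + r) ∂(timeMeasure h)) - ∫ r, f (s + r) ∂(timeMeasure h)| ≤
      h⁻¹ * (2 * |t - s|) := by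
  have hi : ∀ a b, IntervalIntegrable f volume a b := fun a b =>
    (intervalIntegrable_const (c := (1 : ℝ))).mono_fun hf.aestronglyMeasurable
      (.of_forall fun x => by simpa using hf1 x)
  have e : ∀ t, ∫ r, f (t + r) ∂(timeMeasure h) = h⁻¹ * ∫ r in t..(t + h), f r := fun t => by
    rw [integral_timeMeasure hh, ← intervalIntegral.integral_of_le hh.le,
      intervalIntegral.integral_comp_add_left f t]
    simp
  rw [e, e, ← mul_sub, abs_mul, abs_of_pos (inv_pos.2 hh)]
  gcongr
  rw [intervalIntegral.integral_interval_sub_interval_comm (hi _ _) (hi _ _) (hi _ _)]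
  have h1 : ∀ a b : ℝ, |∫ r in a..b, f r| ≤ 1 * |b - a| := fun a b =>
    (Real.norm_eq_abs _).symm.le.trans
      (intervalIntegral.norm_integral_le_of_norm_le_const fun x _ => hf1 x)
  have h2 := h1 t s
  have h3 := h1 (t + h) (s + h)
  have h4 := abs_sub (∫ r in t..s, f r) (∫ r in (t + h)..(s + h), f r)
  rw [add_sub_add_right_eq_sub] at h3
  rw [abs_sub_comm t s]
  linarith

/-- The time averages of a bounded function with weakly differentiable extension by zero in space
are admissible test functions. -/
lemma isTestFunction_timeAverage {Ω : Set (RN N)} (hΩ : IsBoundedLipschitzDomain Ω) {τ p h : ℝ}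
    (hp : 1 ≤ p) (hh : 0 < h) {W : RN N × ℝ → ℝ} {H : RN N × ℝ → RN N}
    (hW : StronglyMeasurable W) (hW1 : ∀ z, |W z| ≤ 1) (hWi : Integrable W)
    (hH : StronglyMeasurable H) (hHi : Integrable H)
    (hHp : MemLp H (ENNReal.ofReal p) volume)
    (hz : ∀ᵐ t : ℝ, HasZeroExtensionGradient Ω (fun x => W (x, t)) (fun x => H (x, t))) :
    IsTestFunction Ω τ p (timeAverage h W) (fun z => h⁻¹ * (W (z.1, z.2 + h) - W z))
      (timeAverage h H) := by
  have hq : 1 ≤ ENNReal.ofReal p := by simpa using hp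
  have hq' : ENNReal.ofReal p ≠ ⊤ := ENNReal.ofReal_ne_top
  have hfin : IsFiniteMeasure (volume.restrict Ω) := ⟨by
    simpa using hΩ.isBounded.measure_lt_top⟩
  have hcyl : IsFiniteMeasure (volume.restrict (cyl Ω τ)) := ⟨by
    rw [Measure.restrict_apply_univ, cyl, Measure.volume_eq_prod, Measure.prod_prod]
    exact ENNReal.mul_lt_top hΩ.isBounded.measure_lt_top (by simp)⟩
  have := isProbabilityMeasure_timeMeasure hh
  have hφm : StronglyMeasurable (timeAverage h W) := stronglyMeasurable_timeAverage hW
  have hΦm : StronglyMeasurable (timeAverage h H) := stronglyMeasurable_timeAverage hH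
  have hφ1 : ∀ z, ‖timeAverage h W z‖ ≤ 1 := fun z => by
    have := norm_integral_le_of_norm_le_const (μ := timeMeasure h) (C := 1)
      (f := fun s => W (z.1, z.2 + s)) (.of_forall fun s => hW1 _)
    simpa [timeAverage] using this
  have hφx : ∀ t, StronglyMeasurable fun x => timeAverage h W (x, t) := fun t =>
    hφm.comp_measurable measurable_prodMk_right
  have hΦx : ∀ t, StronglyMeasurable fun x => timeAverage h H (x, t) := fun t =>
    hΦm.comp_measurable measurable_prodMk_right
  have hΦp : MemLp (timeAverage h H) (ENNReal.ofReal p) volume :=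
    ⟨hΦm.aestronglyMeasurable, (eLpNorm_timeAverage_le hh hH hq hq').trans_lt hHp.2⟩
  have hφp : ∀ t q, MemLp (fun x => timeAverage h W (x, t)) q (volume.restrict Ω) := fun t q =>
    MemLp.of_bound (hφx t).aestronglyMeasurable 1 (.of_forall fun x => hφ1 _)
  have hslice : ∀ᵐ t : ℝ, MemW1p₀ Ω p (fun x => timeAverage h W (x, t))
      (fun x => timeAverage h H (x, t)) := by
    filter_upwards [ae_memLp_slice hΦm hq hq' hΦp] with t ht
    exact (hasZeroExtensionGradient_timeAverage hWi hHi hz h t).memW1p₀ hΩ hp (hφx t) (hΦx t)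
      (hφp t _) (ht.restrict Ω)
  refine ⟨⟨?_, ?_, ⟨fun t _ => hφp t 2, fun s _ => ?_⟩, fun η hη hηc hηs => ?_⟩,
    ⟨?_, hΦp.restrict _, ?_⟩, ae_restrict_of_ae hslice⟩
  · exact MemLp.of_bound hφm.aestronglyMeasurable 1 (.of_forall hφ1)
  · refine MemLp.of_bound (C := h⁻¹ * 2) ?_ (.of_forall fun z => ?_)
    · exact (((hW.comp_measurable (by fun_prop)).sub hW).const_mul _).aestronglyMeasurable
    · rw [norm_mul, norm_inv, Real.norm_of_nonneg hh.le]
      gcongr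
      refine (norm_sub_le _ _).trans ?_
      have h1 := hW1 (z.1, z.2 + h)
      have h2 := hW1 z
      rw [Real.norm_eq_abs, Real.norm_eq_abs]; linarith
  · have hlim : Tendsto (fun t => volume.restrict Ω univ ^ (2 : ℝ≥0∞).toReal⁻¹ *
        ENNReal.ofReal (h⁻¹ * (2 * |t - s|))) (𝓝 s) (𝓝 0) := by
      have h1 : Continuous fun t : ℝ => ENNReal.ofReal (h⁻¹ * (2 * |t - s|)) :=
        ENNReal.continuous_ofReal.comp (by fun_prop)
      have h2 := ENNReal.Tendsto.const_mul (h1.tendsto s)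
        (a := volume.restrict Ω univ ^ (2 : ℝ≥0∞).toReal⁻¹)
        (.inr (ENNReal.rpow_ne_top_of_nonneg (by positivity) (measure_ne_top _ _)))
      simpa using h2
    refine tendsto_of_tendsto_of_tendsto_of_le_of_le tendsto_const_nhds
      (hlim.mono_left nhdsWithin_le_nhds) (fun _ => zero_le) fun t => ?_
    exact eLpNorm_le_of_ae_bound (.of_forall fun x => abs_average_sub_le
      (f := fun r => W (x, r)) (hW.comp_measurable measurable_prodMk_left).measurable
      (fun _ => hW1 _) hh t s)
  · refine .of_forall fun x => ?_
    have hin : ∀ g : ℝ → ℝ, (∀ t ∉ Ioo 0 τ, g t = 0) → ∫ t in Ioo 0 τ, g t = ∫ t, g t :=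
      fun g hg => setIntegral_eq_integral_of_forall_compl_eq_zero hg
    rw [hin, hin]
    · exact integral_average_mul_deriv (f := fun r => W (x, r))
        (hW.comp_measurable measurable_prodMk_left).measurable (fun _ => hW1 _) hh hη hηc
    · intro t ht
      rw [image_eq_zero_of_notMem_tsupport fun hmem => ht (hηs hmem), mul_zero]
    · intro t ht
      have : deriv η t = 0 := by
        by_contra hne
        exact ht (hηs (support_deriv_subset hne))
      rw [this, mul_zero]
  · exact MemLp.of_bound hφm.aestronglyMeasurable 1 (.of_forall hφ1)
  · exact ae_restrict_of_ae (hslice.mono fun t ht => ht.toMemW1p)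

/-! ### Duality between `L^p` and its conjugate space -/

lemma holderConjugate_ofReal {p : ℝ} (hp : 1 < p) :
    ENNReal.HolderConjugate (ENNReal.ofReal (p / (p - 1))) (ENNReal.ofReal p) := by
  have h := Real.HolderConjugate.conjExponent hp
  exact h.symm.ennrealOfReal

/-- The nonlinearity maps `L^p` to its conjugate space. -/
lemma memLp_norm_rpow_smul {α F : Type*} [MeasurableSpace α] {μ : Measure α}
    [NormedAddCommGroup F] [NormedSpace ℝ F] {p : ℝ} (hp : 1 < p) {G : α → F}
    (hG : MemLp G (ENNReal.ofReal p) μ) :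
    MemLp (fun z => ‖G z‖ ^ (p - 2) • G z) (ENNReal.ofReal (p / (p - 1))) μ := by
  have h1 := hG.norm_rpow_div (ENNReal.ofReal (p - 1))
  rw [ENNReal.toReal_ofReal (by linarith), ← ENNReal.ofReal_div_of_pos (by linarith)] at h1
  refine h1.mono ((hG.1.norm.aemeasurable.pow_const _).aestronglyMeasurable.smul hG.1)
    (.of_forall fun z => ?_)
  rw [norm_smul, Real.norm_of_nonneg (by positivity), norm_rpow_sub_two_mul_norm hp,
    Real.norm_of_nonneg (by positivity)]

lemma integrable_inner_of_conjugate {α F : Type*} [MeasurableSpace α] {μ : Measure α}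
    [NormedAddCommGroup F] [InnerProductSpace ℝ F] {p : ℝ} (hp : 1 < p) {A Φ : α → F}
    (hA : MemLp A (ENNReal.ofReal (p / (p - 1))) μ) (hΦ : MemLp Φ (ENNReal.ofReal p) μ) :
    Integrable (fun z => (inner ℝ (A z) (Φ z) : ℝ)) μ := by
  have := holderConjugate_ofReal hp
  refine memLp_one_iff_integrable.1
    (MemLp.of_bilin (r := 1) (fun a b : F => (inner ℝ a b : ℝ)) 1 hA hΦ (hA.1.inner hΦ.1)
      (.of_forall fun z => ?_))
  simpa using nnnorm_inner_le_nnnorm (𝕜 := ℝ) (A z) (Φ z)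

lemma tendsto_integral_inner {α F : Type*} [MeasurableSpace α] {μ : Measure α}
    [NormedAddCommGroup F] [InnerProductSpace ℝ F] {p : ℝ} (hp : 1 < p) {A Φ : α → F}
    (hA : MemLp A (ENNReal.ofReal (p / (p - 1))) μ) (hΦ : MemLp Φ (ENNReal.ofReal p) μ)
    {Ψ : ℕ → α → F} (hΨ : ∀ n, MemLp (Ψ n) (ENNReal.ofReal p) μ)
    (hlim : Tendsto (fun n => eLpNorm (fun z => Ψ n z - Φ z) (ENNReal.ofReal p) μ) atTop (𝓝 0)) :
    Tendsto (fun n => ∫ z, (inner ℝ (A z) (Ψ n z) : ℝ) ∂μ) atTop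
      (𝓝 (∫ z, (inner ℝ (A z) (Φ z) : ℝ) ∂μ)) := by
  have := holderConjugate_ofReal hp
  refine tendsto_integral_of_L1' _ (integrable_inner_of_conjugate hp hA hΦ).1
    (.of_forall fun n => integrable_inner_of_conjugate hp hA (hΨ n)) ?_
  have h1 : Tendsto (fun n => (1 : ℝ≥0) * eLpNorm A (ENNReal.ofReal (p / (p - 1))) μ *
      eLpNorm (fun z => Ψ n z - Φ z) (ENNReal.ofReal p) μ) atTop (𝓝 0) := by
    have := ENNReal.Tendsto.const_mul hlim
      (a := (1 : ℝ≥0) * eLpNorm A (ENNReal.ofReal (p / (p - 1))) μ)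
      (.inr (ENNReal.mul_ne_top (by simp) hA.2.ne))
    simpa using this
  refine tendsto_of_tendsto_of_tendsto_of_le_of_le tendsto_const_nhds h1
    (fun _ => zero_le) fun n => ?_
  refine le_trans (le_of_eq ?_) (eLpNorm_le_eLpNorm_mul_eLpNorm_of_nnnorm (r := 1) hA.1
    ((hΨ n).sub hΦ).1 (fun a b : F => (inner ℝ a b : ℝ)) 1 (.of_forall fun z => ?_))
  · congr 1; ext z; simp [inner_sub_right]
  · simpa using nnnorm_inner_le_nnnorm (𝕜 := ℝ) (A z) (Ψ n z - Φ z)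

/-! ### The energy inequality -/

lemma HasZeroExtensionGradient.congr_ae {Ω : Set (RN N)} {w w' : RN N → ℝ} {G G' : RN N → RN N}
    (h : HasZeroExtensionGradient Ω w G) (hw : w =ᵐ[volume.restrict Ω] w')
    (hG : G =ᵐ[volume.restrict Ω] G') : HasZeroExtensionGradient Ω w' G' := by
  intro η hη hηc e
  have e1 : ∫ x in Ω, w' x * fderiv ℝ η x e = ∫ x in Ω, w x * fderiv ℝ η x e :=
    integral_congr_ae (hw.mono fun x hx => by simp only [hx])
  have e2 : ∫ x in Ω, inner ℝ (G' x) e * η x = ∫ x in Ω, inner ℝ (G x) e * η x :=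
    integral_congr_ae (hG.mono fun x hx => by simp only [hx])
  rw [e1, e2]
  exact h η hη hηc e

lemma volume_restrict_cyl (Ω : Set (RN N)) (τ : ℝ) : volume.restrict (cyl Ω τ) =
    (volume.restrict Ω).prod (volume.restrict (Ioo 0 τ)) := by
  rw [cyl, Measure.volume_eq_prod, Measure.prod_restrict]

lemma ae_slice_of_ae_cyl {Ω : Set (RN N)} {τ : ℝ} {P : RN N × ℝ → Prop}
    (h : ∀ᵐ z ∂(volume.restrict (cyl Ω τ)), P z) :
    ∀ᵐ t ∂(volume.restrict (Ioo 0 τ)), ∀ᵐ x ∂(volume.restrict Ω), P (x, t) := by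
  rw [volume_restrict_cyl] at h
  have h1 := (Measure.measurePreserving_swap (μ := volume.restrict (Ioo (0 : ℝ) τ))
    (ν := volume.restrict Ω)).quasiMeasurePreserving.ae h
  exact Measure.ae_ae_of_ae_prod h1

lemma ContinuousL2.integrable_sub {Ω : Set (RN N)} (hΩ : IsBoundedLipschitzDomain Ω) {T : ℝ}
    {u v : RN N × ℝ → ℝ} (hu : ContinuousL2 Ω T u) (hv : ContinuousL2 Ω T v) {t : ℝ}
    (ht : t ∈ Icc 0 T) : Integrable (fun x => u (x, t) - v (x, t)) (volume.restrict Ω) := by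
  have hfin : IsFiniteMeasure (volume.restrict Ω) := ⟨by
    simpa using hΩ.isBounded.measure_lt_top⟩
  exact ((hu.memLp t ht).sub (hv.memLp t ht)).integrable (by norm_num)

lemma integrable_truncPrim {α : Type*} [MeasurableSpace α] {μ : Measure α} {w : α → ℝ}
    (hw : Integrable w μ) : Integrable (fun x => truncPrim (w x)) μ :=
  hw.mono (continuous_truncPrim.comp_aestronglyMeasurable hw.1) (.of_forall fun x => by
    rw [Real.norm_of_nonneg (truncPrim_nonneg _)]; exact truncPrim_le_abs _)

/-- The truncated energy of `u - v` is a continuous function of time. -/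
lemma continuousOn_energy {Ω : Set (RN N)} (hΩ : IsBoundedLipschitzDomain Ω) {T : ℝ}
    {u v : RN N × ℝ → ℝ} (hu : ContinuousL2 Ω T u) (hv : ContinuousL2 Ω T v) :
    ContinuousOn (fun t => ∫ x in Ω, truncPrim (u (x, t) - v (x, t))) (Icc 0 T) := by
  have hfin : IsFiniteMeasure (volume.restrict Ω) := ⟨by
    simpa using hΩ.isBounded.measure_lt_top⟩
  intro s hs
  have h0 : Tendsto (fun t => ∫ x in Ω, (truncPrim (u (x, t) - v (x, t)) -
      truncPrim (u (x, s) - v (x, s)))) (𝓝[Icc 0 T] s) (𝓝 0) := by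
    refine tendsto_integral_zero_of_le_mul (q := 2) (by norm_num)
      (f := fun t x => (u (x, t) - u (x, s)) - (v (x, t) - v (x, s))) ?_ ?_ (M := 1) ?_
    · filter_upwards [self_mem_nhdsWithin] with t ht
      exact (((hu.memLp t ht).sub (hu.memLp s hs)).sub ((hv.memLp t ht).sub (hv.memLp s hs))).1
    · refine tendsto_of_tendsto_of_tendsto_of_le_of_le' tendsto_const_nhds
        (by simpa using (hu.tendsto s hs).add (hv.tendsto s hs)) (.of_forall fun _ => zero_le) ?_
      filter_upwards [self_mem_nhdsWithin] with t ht
      exact eLpNorm_sub_le ((hu.memLp t ht).sub (hu.memLp s hs)).1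
        ((hv.memLp t ht).sub (hv.memLp s hs)).1 (by norm_num)
    · refine .of_forall fun t => .of_forall fun x => ?_
      rw [ENNReal.coe_one, one_mul, ← ofReal_norm, ← ofReal_norm]
      refine ENNReal.ofReal_le_ofReal ((abs_truncPrim_sub_le _ _).trans (le_of_eq ?_))
      rw [Real.norm_eq_abs]; congr 1; ring
  have h1 := h0.add_const (∫ x in Ω, truncPrim (u (x, s) - v (x, s)))
  rw [zero_add] at h1
  refine h1.congr' ?_
  filter_upwards [self_mem_nhdsWithin] with t ht
  rw [integral_sub (integrable_truncPrim (hu.integrable_sub hΩ hv ht))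
    (integrable_truncPrim (hu.integrable_sub hΩ hv hs))]
  ring

/-- The time derivative tested with the forward time average of `trunc w`, extended by zero after
the final time `τ`, controls the energy just before `τ`. This is the tangent line inequality for
the convex function `truncPrim`, summed over time steps of length `h`. -/
lemma energy_le_integral_mul_difference {Ω : Set (RN N)} (hΩ : IsBoundedLipschitzDomain Ω) {τ h : ℝ}
    (hh : 0 < h) {w : RN N × ℝ → ℝ} (hw : StronglyMeasurable w)
    (hwi : Integrable w (volume.restrict (cyl Ω τ))) {W : RN N × ℝ → ℝ}
    (hW : W = (cyl Ω τ).indicator fun z => trunc (w z)) :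
    ∫ z in cyl Ω τ, (Ici (τ - h)).indicator (fun _ => truncPrim (w z)) z.2 ≤
      ∫ z in cyl Ω τ, w z * (W z - W (z.1, z.2 + h)) := by
  have hQ : MeasurableSet (cyl Ω τ) := hΩ.isOpen.measurableSet.prod measurableSet_Ioo
  -- `P` is the convex conjugate of `truncPrim` at `trunc (w z)`; the difference of `P` and its
  -- shift in time has nonnegative integral, because `P ≥ 0` vanishes outside the cylinder
  set P : RN N × ℝ → ℝ := (cyl Ω τ).indicator fun z => w z * trunc (w z) - truncPrim (w z) with hP
  have hWm : StronglyMeasurable W := by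
    rw [hW]; exact (continuous_trunc.comp_stronglyMeasurable hw).indicator hQ
  have hW1 : ∀ z, |W z| ≤ 1 := fun z => by
    rw [hW]
    by_cases hz : z ∈ cyl Ω τ
    · rw [indicator_of_mem hz, abs_of_nonneg (trunc_nonneg _)]; exact trunc_le_one _
    · rw [indicator_of_notMem hz]; simp
  have hBi : Integrable (fun z => truncPrim (w z)) (volume.restrict (cyl Ω τ)) :=
    integrable_truncPrim hwi
  have hPi : Integrable P := by
    rw [hP, integrable_indicator_iff hQ]
    refine Integrable.sub ?_ hBi
    exact hwi.mul_bdd (c := 1) (continuous_trunc.comp_stronglyMeasurable hw).aestronglyMeasurable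
      (.of_forall fun z => by
        rw [Real.norm_of_nonneg (trunc_nonneg _)]; exact trunc_le_one _)
  have hP0 : ∀ z, 0 ≤ P z := fun z => by
    refine indicator_nonneg (fun z _ => ?_) z
    have := trunc_mul_sub_le 0 (w z)
    rw [truncPrim_of_nonpos le_rfl] at this
    linarith
  have hvol : (volume : Measure (RN N × ℝ)).IsAddHaarMeasure :=
    Measure.prod.instIsAddHaarMeasure _ _
  have hshift : ∀ z : RN N × ℝ, (z.1, z.2 + h) = z + ((0 : RN N), h) := fun z => by
    simp [Prod.add_def]
  have hPh : Integrable fun z : RN N × ℝ => P (z.1, z.2 + h) := by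
    simp only [hshift]; exact hPi.comp_add_right _
  have hPint : ∫ z in cyl Ω τ, P (z.1, z.2 + h) ≤ ∫ z in cyl Ω τ, P z := by
    calc ∫ z in cyl Ω τ, P (z.1, z.2 + h) ≤ ∫ z : RN N × ℝ, P (z.1, z.2 + h) :=
          setIntegral_le_integral hPh (.of_forall fun z => hP0 _)
      _ = ∫ z, P z := by
          simp only [hshift]; exact integral_add_right_eq_self P _
      _ = ∫ z in cyl Ω τ, P z := by
          rw [setIntegral_eq_integral_of_forall_compl_eq_zero]
          intro z hz; exact indicator_of_notMem hz _
  have hindi : Integrable (fun z : RN N × ℝ =>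
      (Ici (τ - h)).indicator (fun _ => truncPrim (w z)) z.2) (volume.restrict (cyl Ω τ)) := by
    have : (fun z : RN N × ℝ => (Ici (τ - h)).indicator (fun _ => truncPrim (w z)) z.2) =
        (Prod.snd ⁻¹' Ici (τ - h)).indicator fun z => truncPrim (w z) := by
      ext z; by_cases hz : τ - h ≤ z.2 <;> simp [indicator, hz]
    rw [this]
    exact hBi.indicator (measurable_snd measurableSet_Ici)
  have hright : Integrable (fun z => w z * (W z - W (z.1, z.2 + h)))
      (volume.restrict (cyl Ω τ)) := by
    refine hwi.mul_bdd (c := 2) ?_ (.of_forall fun z => ?_)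
    · exact (hWm.sub (hWm.comp_measurable (by fun_prop))).aestronglyMeasurable
    · refine (norm_sub_le _ _).trans ?_
      have h1 := hW1 z
      have h2 := hW1 (z.1, z.2 + h)
      rw [Real.norm_eq_abs, Real.norm_eq_abs]; linarith
  have key : ∫ z in cyl Ω τ, ((P z - P (z.1, z.2 + h)) +
      (Ici (τ - h)).indicator (fun _ => truncPrim (w z)) z.2) ≤
      ∫ z in cyl Ω τ, w z * (W z - W (z.1, z.2 + h)) := by
    refine setIntegral_mono_on (((hPi.restrict).sub (hPh.restrict)).add hindi) hright hQ
      fun z hz => ?_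
    have hWz : W z = trunc (w z) := by rw [hW, indicator_of_mem hz]
    have hPz : P z = w z * trunc (w z) - truncPrim (w z) := by rw [hP, indicator_of_mem hz]
    rw [hWz, hPz]
    -- before `τ - h` this is the tangent line inequality, afterwards the shifted terms vanish
    by_cases ht : z.2 + h < τ
    · have hz' : (z.1, z.2 + h) ∈ cyl Ω τ := ⟨hz.1, by
        have := hz.2.1
        exact ⟨by simp only; linarith, ht⟩⟩
      have e1 : W (z.1, z.2 + h) = trunc (w (z.1, z.2 + h)) := by rw [hW, indicator_of_mem hz']
      have e2 : P (z.1, z.2 + h) = w (z.1, z.2 + h) * trunc (w (z.1, z.2 + h)) -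
        truncPrim (w (z.1, z.2 + h)) := by rw [hP, indicator_of_mem hz']
      have e3 : z.2 ∉ Ici (τ - h) := by simp only [mem_Ici, not_le]; linarith
      rw [e1, e2, indicator_of_notMem e3]
      have := trunc_mul_sub_le (w z) (w (z.1, z.2 + h))
      linarith
    · have hz' : (z.1, z.2 + h) ∉ cyl Ω τ := fun hmem => ht hmem.2.2
      have e1 : W (z.1, z.2 + h) = 0 := by rw [hW, indicator_of_notMem hz']
      have e2 : P (z.1, z.2 + h) = 0 := by rw [hP, indicator_of_notMem hz']
      have e3 : z.2 ∈ Ici (τ - h) := by simp only [mem_Ici]; linarith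
      rw [e1, e2, indicator_of_mem e3]
      linarith
  have hsum : ∫ z in cyl Ω τ, ((P z - P (z.1, z.2 + h)) +
      (Ici (τ - h)).indicator (fun _ => truncPrim (w z)) z.2) =
      ((∫ z in cyl Ω τ, P z) - ∫ z in cyl Ω τ, P (z.1, z.2 + h)) +
        ∫ z in cyl Ω τ, (Ici (τ - h)).indicator (fun _ => truncPrim (w z)) z.2 := by
    rw [← integral_sub (hPi.restrict) (hPh.restrict)]
    exact integral_add ((hPi.restrict).sub (hPh.restrict)) hindi
  linarith

/-- The difference of the weak formulations for `u` and `v`, tested with a bounded function which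
is nonnegative at the initial time and vanishes at the final time `τ`. -/
lemma weak_formulation_sub_le {Ω : Set (RN N)} (hΩ : IsBoundedLipschitzDomain Ω) {τ p lam : ℝ}
    (hp : 1 < p) (hτ : 0 < τ) {u v f g : RN N × ℝ → ℝ} {G H : RN N × ℝ → RN N}
    (hu : ContinuousL2 Ω τ u) (hv : ContinuousL2 Ω τ v)
    (hup : MemLp u (ENNReal.ofReal p) (volume.restrict (cyl Ω τ)))
    (hvp : MemLp v (ENNReal.ofReal p) (volume.restrict (cyl Ω τ)))
    (hG : MemLp G (ENNReal.ofReal p) (volume.restrict (cyl Ω τ)))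
    (hH : MemLp H (ENNReal.ofReal p) (volume.restrict (cyl Ω τ)))
    (hf : MemLp f ⊤ (volume.restrict (cyl Ω τ))) (hg : MemLp g ⊤ (volume.restrict (cyl Ω τ)))
    (h0 : ∀ᵐ x ∂(volume.restrict Ω), u (x, 0) ≤ v (x, 0))
    {φ ψ : RN N × ℝ → ℝ} {Φ : RN N × ℝ → RN N} (hφ : IsTestFunction Ω τ p φ ψ Φ)
    (hwu : ((∫ x in Ω, u (x, τ) * φ (x, τ)) - ∫ x in Ω, u (x, 0) * φ (x, 0)) +
        ∫ z in cyl Ω τ, (-(u z * ψ z) + ‖G z‖ ^ (p - 2) * inner ℝ (G z) (Φ z)) =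
      lam * (∫ z in cyl Ω τ, |u z| ^ (p - 2) * u z * φ z) + ∫ z in cyl Ω τ, f z * φ z)
    (hwv : ((∫ x in Ω, v (x, τ) * φ (x, τ)) - ∫ x in Ω, v (x, 0) * φ (x, 0)) +
        ∫ z in cyl Ω τ, (-(v z * ψ z) + ‖H z‖ ^ (p - 2) * inner ℝ (H z) (Φ z)) =
      lam * (∫ z in cyl Ω τ, |v z| ^ (p - 2) * v z * φ z) + ∫ z in cyl Ω τ, g z * φ z)
    (hψm : AEStronglyMeasurable ψ (volume.restrict (cyl Ω τ))) {D : ℝ} (hψ : ∀ z, |ψ z| ≤ D)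
    (hφ0 : ∀ x, 0 ≤ φ (x, 0)) (hφτ : ∀ x, φ (x, τ) = 0) :
    (∫ z in cyl Ω τ, -((u z - v z) * ψ z)) +
      ∫ z in cyl Ω τ, (inner ℝ (‖G z‖ ^ (p - 2) • G z - ‖H z‖ ^ (p - 2) • H z) (Φ z) : ℝ) ≤
      ∫ z in cyl Ω τ, (inner ℝ (lam * (|u z| ^ (p - 2) * u z - |v z| ^ (p - 2) * v z) +
        (f z - g z)) (φ z) : ℝ) := by
  have hq : 1 ≤ ENNReal.ofReal p := by simpa using hp.le
  have hfinΩ : IsFiniteMeasure (volume.restrict Ω) := ⟨by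
    simpa using hΩ.isBounded.measure_lt_top⟩
  have hfin : IsFiniteMeasure (volume.restrict (cyl Ω τ)) := by
    rw [volume_restrict_cyl]; infer_instance
  set μ := volume.restrict (cyl Ω τ) with hμ
  have hφp : MemLp φ (ENNReal.ofReal p) μ := hφ.space.memLp
  have hΦp : MemLp Φ (ENNReal.ofReal p) μ := hφ.space.memLp_grad
  have hφτ0 : ∀ w : RN N × ℝ → ℝ, ∫ x in Ω, w (x, τ) * φ (x, τ) = 0 := fun w => by simp [hφτ]
  have hinit : ∫ x in Ω, u (x, 0) * φ (x, 0) ≤ ∫ x in Ω, v (x, 0) * φ (x, 0) := by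
    have h0m : (0 : ℝ) ∈ Icc 0 τ := ⟨le_rfl, hτ.le⟩
    refine integral_mono_ae ?_ ?_ ?_
    · exact (hu.memLp 0 h0m).integrable_mul (hφ.time.continuousL2.memLp 0 h0m)
    · exact (hv.memLp 0 h0m).integrable_mul (hφ.time.continuousL2.memLp 0 h0m)
    · filter_upwards [h0] with x hx
      exact mul_le_mul_of_nonneg_right hx (hφ0 x)
  -- integrability of every term
  have iψ : ∀ {w : RN N × ℝ → ℝ}, MemLp w (ENNReal.ofReal p) μ →
      Integrable (fun z => w z * ψ z) μ := fun hw =>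
    (hw.integrable hq).mul_bdd (c := D) hψm (.of_forall hψ)
  have iA : ∀ {G : RN N × ℝ → RN N}, MemLp G (ENNReal.ofReal p) μ →
      Integrable (fun z => ‖G z‖ ^ (p - 2) * inner ℝ (G z) (Φ z)) μ := fun hG =>
    (integrable_inner_of_conjugate hp (memLp_norm_rpow_smul hp hG) hΦp).congr
      (.of_forall fun z => real_inner_smul_left _ _ _)
  have iB : ∀ {w : RN N × ℝ → ℝ}, MemLp w (ENNReal.ofReal p) μ →
      Integrable (fun z => |w z| ^ (p - 2) * w z * φ z) μ := fun hw =>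
    (integrable_inner_of_conjugate hp (memLp_norm_rpow_smul hp hw) hφp).congr
      (.of_forall fun z => by simp [mul_comm])
  have iF : ∀ {f : RN N × ℝ → ℝ}, MemLp f ⊤ μ → Integrable (fun z => f z * φ z) μ := fun hf =>
    (integrable_inner_of_conjugate hp (hf.mono_exponent le_top) hφp).congr
      (.of_forall fun z => by simp [mul_comm])
  rw [hφτ0] at hwu hwv
  have e1 : ∫ z, (-(u z * ψ z) + ‖G z‖ ^ (p - 2) * inner ℝ (G z) (Φ z)) ∂μ =
      - (∫ z, u z * ψ z ∂μ) + ∫ z, ‖G z‖ ^ (p - 2) * inner ℝ (G z) (Φ z) ∂μ := by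
    rw [← integral_neg]; exact integral_add (iψ hup).neg (iA hG)
  have e2 : ∫ z, (-(v z * ψ z) + ‖H z‖ ^ (p - 2) * inner ℝ (H z) (Φ z)) ∂μ =
      - (∫ z, v z * ψ z ∂μ) + ∫ z, ‖H z‖ ^ (p - 2) * inner ℝ (H z) (Φ z) ∂μ := by
    rw [← integral_neg]; exact integral_add (iψ hvp).neg (iA hH)
  have e3 : ∫ z, -((u z - v z) * ψ z) ∂μ = - (∫ z, u z * ψ z ∂μ) + ∫ z, v z * ψ z ∂μ := by
    rw [integral_neg]
    have : ∫ z, (u z - v z) * ψ z ∂μ = (∫ z, u z * ψ z ∂μ) - ∫ z, v z * ψ z ∂μ := by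
      simp only [sub_mul]; exact integral_sub (iψ hup) (iψ hvp)
    rw [this]; ring
  have e4 : ∫ z, (inner ℝ (‖G z‖ ^ (p - 2) • G z - ‖H z‖ ^ (p - 2) • H z) (Φ z) : ℝ) ∂μ =
      (∫ z, ‖G z‖ ^ (p - 2) * inner ℝ (G z) (Φ z) ∂μ) -
        ∫ z, ‖H z‖ ^ (p - 2) * inner ℝ (H z) (Φ z) ∂μ := by
    simp only [inner_sub_left, real_inner_smul_left]; exact integral_sub (iA hG) (iA hH)
  have e5 : ∫ z, (inner ℝ (lam * (|u z| ^ (p - 2) * u z - |v z| ^ (p - 2) * v z) +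
        (f z - g z)) (φ z) : ℝ) ∂μ =
      (lam * (∫ z, |u z| ^ (p - 2) * u z * φ z ∂μ) + ∫ z, f z * φ z ∂μ) -
      (lam * (∫ z, |v z| ^ (p - 2) * v z * φ z ∂μ) + ∫ z, g z * φ z ∂μ) := by
    rw [← integral_const_mul, ← integral_const_mul]
    refine Eq.trans ?_ ((integral_sub (((iB hup).const_mul lam).add (iF hf))
      (((iB hvp).const_mul lam).add (iF hg))).trans
      (congrArg₂ (· - ·) (integral_add ((iB hup).const_mul lam) (iF hf))
        (integral_add ((iB hvp).const_mul lam) (iF hg))))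
    congr 1; ext z
    simp only [RCLike.inner_apply, conj_trivial, Pi.add_apply]; ring
  rw [e1] at hwu
  rw [e2] at hwv
  rw [e3, e4, e5]
  linarith

/-- The energy inequality for the difference of two solutions, obtained from the test function
`trunc (u - v)`. -/
lemma energy_inequality {Ω : Set (RN N)} (hΩ : IsBoundedLipschitzDomain Ω) {τ p lam : ℝ}
    (hp : 1 < p) (hτ : 0 < τ) {u v f g : RN N × ℝ → ℝ} {G H : RN N × ℝ → RN N}
    (hu : ContinuousL2 Ω τ u) (hv : ContinuousL2 Ω τ v)
    (hup : MemLp u (ENNReal.ofReal p) (volume.restrict (cyl Ω τ)))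
    (hvp : MemLp v (ENNReal.ofReal p) (volume.restrict (cyl Ω τ)))
    (hG : MemLp G (ENNReal.ofReal p) (volume.restrict (cyl Ω τ)))
    (hH : MemLp H (ENNReal.ofReal p) (volume.restrict (cyl Ω τ)))
    (hf : MemLp f ⊤ (volume.restrict (cyl Ω τ))) (hg : MemLp g ⊤ (volume.restrict (cyl Ω τ)))
    (h0 : ∀ᵐ x ∂(volume.restrict Ω), u (x, 0) ≤ v (x, 0))
    (hz : ∀ᵐ t ∂(volume.restrict (Ioo 0 τ)),
      HasZeroExtensionGradient Ω (fun x => trunc (u (x, t) - v (x, t)))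
        (fun x => deriv trunc (u (x, t) - v (x, t)) • (G (x, t) - H (x, t))))
    (hwu : ∀ (φ ψ : RN N × ℝ → ℝ) (Φ : RN N × ℝ → RN N), IsTestFunction Ω τ p φ ψ Φ →
      ((∫ x in Ω, u (x, τ) * φ (x, τ)) - ∫ x in Ω, u (x, 0) * φ (x, 0)) +
        ∫ z in cyl Ω τ, (-(u z * ψ z) + ‖G z‖ ^ (p - 2) * inner ℝ (G z) (Φ z)) =
      lam * (∫ z in cyl Ω τ, |u z| ^ (p - 2) * u z * φ z) + ∫ z in cyl Ω τ, f z * φ z)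
    (hwv : ∀ (φ ψ : RN N × ℝ → ℝ) (Φ : RN N × ℝ → RN N), IsTestFunction Ω τ p φ ψ Φ →
      ((∫ x in Ω, v (x, τ) * φ (x, τ)) - ∫ x in Ω, v (x, 0) * φ (x, 0)) +
        ∫ z in cyl Ω τ, (-(v z * ψ z) + ‖H z‖ ^ (p - 2) * inner ℝ (H z) (Φ z)) =
      lam * (∫ z in cyl Ω τ, |v z| ^ (p - 2) * v z * φ z) + ∫ z in cyl Ω τ, g z * φ z) :
    (∫ x in Ω, truncPrim (u (x, τ) - v (x, τ))) +
      (∫ z in cyl Ω τ, (inner ℝ (‖G z‖ ^ (p - 2) • G z - ‖H z‖ ^ (p - 2) • H z)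
        (deriv trunc (u z - v z) • (G z - H z)) : ℝ)) ≤
      ∫ z in cyl Ω τ, (inner ℝ (lam * (|u z| ^ (p - 2) * u z - |v z| ^ (p - 2) * v z) +
        (f z - g z)) (trunc (u z - v z)) : ℝ) := by
  have hq : 1 ≤ ENNReal.ofReal p := by simpa using hp.le
  have hq' : ENNReal.ofReal p ≠ ⊤ := ENNReal.ofReal_ne_top
  have hfinΩ : IsFiniteMeasure (volume.restrict Ω) := ⟨by
    simpa using hΩ.isBounded.measure_lt_top⟩
  have hfin : IsFiniteMeasure (volume.restrict (cyl Ω τ)) := by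
    rw [volume_restrict_cyl]; infer_instance
  have hQ : MeasurableSet (cyl Ω τ) := hΩ.isOpen.measurableSet.prod measurableSet_Ioo
  -- measurable representatives of `u - v` and its gradient
  obtain ⟨w, hwm, hwae⟩ : ∃ w, StronglyMeasurable w ∧
      (fun z => u z - v z) =ᵐ[volume.restrict (cyl Ω τ)] w :=
    ⟨_, (hup.sub hvp).1.stronglyMeasurable_mk, (hup.sub hvp).1.ae_eq_mk⟩
  obtain ⟨K, hKm, hKae⟩ : ∃ K, StronglyMeasurable K ∧
      (fun z => G z - H z) =ᵐ[volume.restrict (cyl Ω τ)] K :=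
    ⟨_, (hG.sub hH).1.stronglyMeasurable_mk, (hG.sub hH).1.ae_eq_mk⟩
  have hKp : MemLp K (ENNReal.ofReal p) (volume.restrict (cyl Ω τ)) :=
    (hG.sub hH).ae_eq hKae
  have hwi : Integrable w (volume.restrict (cyl Ω τ)) :=
    ((hup.sub hvp).integrable hq).congr hwae
  set W : RN N × ℝ → ℝ := (cyl Ω τ).indicator fun z => trunc (w z) with hW
  set L : RN N × ℝ → RN N := (cyl Ω τ).indicator fun z => deriv trunc (w z) • K z with hL
  have hdc : Continuous (deriv trunc) := contDiff_trunc.continuous_deriv le_rfl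
  have hWm : StronglyMeasurable W := (continuous_trunc.comp_stronglyMeasurable hwm).indicator hQ
  have hLm : StronglyMeasurable L := ((hdc.comp_stronglyMeasurable hwm).smul hKm).indicator hQ
  have hW0 : ∀ z, 0 ≤ W z := fun z => indicator_nonneg (fun z _ => trunc_nonneg _) z
  have hW1 : ∀ z, |W z| ≤ 1 := fun z => by
    rw [abs_of_nonneg (hW0 z)]
    exact indicator_le' (fun z _ => trunc_le_one _) (fun _ _ => zero_le_one) z
  have hWp : MemLp W (ENNReal.ofReal p) volume := by
    rw [hW, memLp_indicator_iff_restrict hQ]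
    refine MemLp.of_bound (continuous_trunc.comp_stronglyMeasurable hwm).aestronglyMeasurable 1
      (.of_forall fun z => ?_)
    rw [Real.norm_of_nonneg (trunc_nonneg _)]; exact trunc_le_one _
  have hWi : Integrable W := by
    rw [hW, integrable_indicator_iff hQ]
    refine memLp_one_iff_integrable.1 (MemLp.of_bound
      (continuous_trunc.comp_stronglyMeasurable hwm).aestronglyMeasurable 1
      (.of_forall fun z => ?_))
    rw [Real.norm_of_nonneg (trunc_nonneg _)]; exact trunc_le_one _
  have hLp' : MemLp (fun z => deriv trunc (w z) • K z) (ENNReal.ofReal p)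
      (volume.restrict (cyl Ω τ)) := by
    refine hKp.mono ((hdc.comp_stronglyMeasurable hwm).smul hKm).aestronglyMeasurable
      (.of_forall fun z => ?_)
    rw [norm_smul, Real.norm_of_nonneg (deriv_trunc_nonneg _)]
    exact mul_le_of_le_one_left (norm_nonneg _) (deriv_trunc_le_one _)
  have hLp : MemLp L (ENNReal.ofReal p) volume := (memLp_indicator_iff_restrict hQ).2 hLp'
  have hLi : Integrable L := (integrable_indicator_iff hQ).2 (hLp'.integrable hq)
  have hslice : ∀ᵐ t : ℝ, HasZeroExtensionGradient Ω (fun x => W (x, t)) (fun x => L (x, t)) := by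
    have h1 := ae_slice_of_ae_cyl hwae
    have h2 := ae_slice_of_ae_cyl hKae
    rw [ae_restrict_iff' measurableSet_Ioo] at h1 h2 hz
    filter_upwards [h1, h2, hz] with t h1 h2 h3
    by_cases ht : t ∈ Ioo 0 τ
    · refine (h3 ht).congr_ae ?_ ?_
      · filter_upwards [h1 ht, ae_restrict_mem hΩ.isOpen.measurableSet] with x hx hxΩ
        have hmem : (x, t) ∈ cyl Ω τ := ⟨hxΩ, ht⟩
        rw [hW, indicator_of_mem hmem, hx]
      · filter_upwards [h1 ht, h2 ht, ae_restrict_mem hΩ.isOpen.measurableSet] with x hx hx2 hxΩ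
        have hmem : (x, t) ∈ cyl Ω τ := ⟨hxΩ, ht⟩
        rw [hL, indicator_of_mem hmem, hx, hx2]
    · have hn : ∀ x, (x, t) ∉ cyl Ω τ := fun x hx => ht hx.2
      intro η _ _ e
      simp [hW, hL, hn]
  -- test functions for the time steps `h n`
  obtain ⟨h, hpos, hlt, hlim⟩ : ∃ h : ℕ → ℝ, (∀ n, 0 < h n) ∧ (∀ n, h n < τ) ∧
      Tendsto h atTop (𝓝 0) := by
    refine ⟨fun n => τ / (n + 2), fun n => by positivity, fun n => ?_,
      Tendsto.div_atTop tendsto_const_nhds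
        (tendsto_atTop_add_const_right _ _ tendsto_natCast_atTop_atTop)⟩
    rw [div_lt_iff₀ (by positivity)]
    have : (0 : ℝ) ≤ n := n.cast_nonneg
    nlinarith
  have htest := fun n => isTestFunction_timeAverage (τ := τ) hΩ hp.le (hpos n) hWm hW1 hWi hLm hLi
    hLp hslice
  set Y : ℝ → ℝ := fun t => ∫ x in Ω, truncPrim (u (x, t) - v (x, t)) with hY
  have hYc : ContinuousOn Y (Icc 0 τ) := continuousOn_energy hΩ hu hv
  have hstep : ∀ n, (h n)⁻¹ * (∫ t in Ioo (τ - h n) τ, Y t) +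
      ∫ z in cyl Ω τ, (inner ℝ (‖G z‖ ^ (p - 2) • G z - ‖H z‖ ^ (p - 2) • H z)
        (timeAverage (h n) L z) : ℝ) ≤
      ∫ z in cyl Ω τ, (inner ℝ (lam * (|u z| ^ (p - 2) * u z - |v z| ^ (p - 2) * v z) +
        (f z - g z)) (timeAverage (h n) W z) : ℝ) := fun n => by
    have hψm : StronglyMeasurable fun z : RN N × ℝ => (h n)⁻¹ * (W (z.1, z.2 + h n) - W z) :=
      (((hWm.comp_measurable (by fun_prop)).sub hWm).const_mul _)
    -- the average vanishes at the time `τ`, since `W` does so after `τ`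
    have h1 := weak_formulation_sub_le hΩ hp hτ hu hv hup hvp hG hH hf hg h0 (htest n)
      (hwu _ _ _ (htest n)) (hwv _ _ _ (htest n)) hψm.aestronglyMeasurable (D := (h n)⁻¹ * 2)
      (fun z => ?_) (fun x => integral_nonneg fun s => hW0 _) (fun x => ?_)
    · refine le_trans (add_le_add ?_ le_rfl) h1
      have h2 := energy_le_integral_mul_difference hΩ (hpos n) hwm hwi hW
      have e1 : ∫ z in cyl Ω τ, -((u z - v z) * ((h n)⁻¹ * (W (z.1, z.2 + h n) - W z))) =
          (h n)⁻¹ * ∫ z in cyl Ω τ, w z * (W z - W (z.1, z.2 + h n)) := by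
        rw [← integral_const_mul]
        refine integral_congr_ae (hwae.mono fun z hz => ?_)
        simp only at hz ⊢
        rw [← hz]; ring
      have e2 : ∫ z in cyl Ω τ, (Ici (τ - h n)).indicator (fun _ => truncPrim (w z)) z.2 =
          ∫ t in Ioo (τ - h n) τ, Y t := by
        have hi : Integrable (fun z : RN N × ℝ =>
            (Ici (τ - h n)).indicator (fun _ => truncPrim (w z)) z.2)
            (volume.restrict (cyl Ω τ)) := by
          have : (fun z : RN N × ℝ => (Ici (τ - h n)).indicator (fun _ => truncPrim (w z)) z.2) =
              (Prod.snd ⁻¹' Ici (τ - h n)).indicator fun z => truncPrim (w z) := by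
            ext z; by_cases hz : τ - h n ≤ z.2 <;> simp [indicator, hz]
          rw [this]
          exact (integrable_truncPrim hwi).indicator (measurable_snd measurableSet_Ici)
        rw [volume_restrict_cyl] at hi ⊢
        rw [integral_prod_symm _ hi]
        have h3 := ae_slice_of_ae_cyl hwae
        have e3 : ∀ᵐ t ∂(volume.restrict (Ioo 0 τ)),
            ∫ x in Ω, (Ici (τ - h n)).indicator (fun _ => truncPrim (w (x, t))) t =
              (Ici (τ - h n)).indicator Y t := by
          filter_upwards [h3] with t ht
          by_cases htm : t ∈ Ici (τ - h n)
          · simp only [indicator_of_mem htm]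
            exact integral_congr_ae (ht.mono fun x hx => congrArg truncPrim hx.symm)
          · simp [indicator_of_notMem htm]
        rw [integral_congr_ae e3, setIntegral_indicator measurableSet_Ici,
          ← integral_Ico_eq_integral_Ioo]
        congr 2
        ext t
        have h5 := hlt n
        simp only [mem_inter_iff, mem_Ioo, mem_Ici, mem_Ico]
        constructor
        · rintro ⟨⟨h1, h2⟩, h3⟩; exact ⟨h3, h2⟩
        · rintro ⟨h1, h2⟩; exact ⟨⟨by linarith, h2⟩, h1⟩
      rw [e1, ← e2]
      have := inv_pos.2 (hpos n)
      exact mul_le_mul_of_nonneg_left h2 this.le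
    · rw [abs_mul, abs_of_pos (inv_pos.2 (hpos n))]
      have := inv_pos.2 (hpos n)
      refine mul_le_mul_of_nonneg_left ((abs_sub _ _).trans ?_) this.le
      linarith [hW1 z, hW1 (z.1, z.2 + h n)]
    · rw [timeAverage, integral_timeMeasure (hpos n)]
      rw [setIntegral_eq_zero_of_forall_eq_zero, smul_zero]
      intro s hs
      have : (x, τ + s) ∉ cyl Ω τ := fun hmem => by
        have h1 := hmem.2.2
        have h2 := hs.1
        simp only at h1
        linarith
      simp [hW, this]
  -- passage to the limit
  have hA : MemLp (fun z => ‖G z‖ ^ (p - 2) • G z - ‖H z‖ ^ (p - 2) • H z)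
      (ENNReal.ofReal (p / (p - 1))) (volume.restrict (cyl Ω τ)) :=
    (memLp_norm_rpow_smul hp hG).sub (memLp_norm_rpow_smul hp hH)
  have hR : MemLp (fun z => lam * (|u z| ^ (p - 2) * u z - |v z| ^ (p - 2) * v z) + (f z - g z))
      (ENNReal.ofReal (p / (p - 1))) (volume.restrict (cyl Ω τ)) := by
    have h1 : MemLp (fun z => |u z| ^ (p - 2) * u z) (ENNReal.ofReal (p / (p - 1)))
      (volume.restrict (cyl Ω τ)) := memLp_norm_rpow_smul hp hup
    have h2 : MemLp (fun z => |v z| ^ (p - 2) * v z) (ENNReal.ofReal (p / (p - 1)))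
      (volume.restrict (cyl Ω τ)) := memLp_norm_rpow_smul hp hvp
    exact ((h1.sub h2).const_mul lam).add
      ((hf.mono_exponent le_top).sub (hg.mono_exponent le_top))
  have t1 := tendsto_integral_inner hp hA (hLp.restrict _) (fun n => (htest n).space.memLp_grad)
    (tendsto_of_tendsto_of_tendsto_of_le_of_le tendsto_const_nhds
      (tendsto_eLpNorm_timeAverage_sub hLm hLi hq hq' hLp hpos hlim) (fun _ => zero_le)
      (fun n => eLpNorm_restrict_le _ _ _ _))
  have t2 := tendsto_integral_inner hp hR (hWp.restrict _) (fun n => (htest n).space.memLp)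
    (tendsto_of_tendsto_of_tendsto_of_le_of_le tendsto_const_nhds
      (tendsto_eLpNorm_timeAverage_sub hWm hWi hq hq' hWp hpos hlim) (fun _ => zero_le)
      (fun n => eLpNorm_restrict_le _ _ _ _))
  have e1 : ∫ z in cyl Ω τ, (inner ℝ (‖G z‖ ^ (p - 2) • G z - ‖H z‖ ^ (p - 2) • H z)
        (deriv trunc (u z - v z) • (G z - H z)) : ℝ) =
      ∫ z in cyl Ω τ, (inner ℝ (‖G z‖ ^ (p - 2) • G z - ‖H z‖ ^ (p - 2) • H z) (L z) : ℝ) := by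
    refine integral_congr_ae ?_
    filter_upwards [hwae, hKae, ae_restrict_mem hQ] with z h1 h2 h3
    rw [hL, indicator_of_mem h3, ← h1, ← h2]
  have e2 : ∫ z in cyl Ω τ, (inner ℝ (lam * (|u z| ^ (p - 2) * u z - |v z| ^ (p - 2) * v z) +
        (f z - g z)) (trunc (u z - v z)) : ℝ) =
      ∫ z in cyl Ω τ, (inner ℝ (lam * (|u z| ^ (p - 2) * u z - |v z| ^ (p - 2) * v z) +
        (f z - g z)) (W z) : ℝ) := by
    refine integral_congr_ae ?_
    filter_upwards [hwae, ae_restrict_mem hQ] with z h1 h3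
    rw [hW, indicator_of_mem h3, ← h1]
  rw [e1, e2]
  -- the averages of `Y` over `(τ - h n, τ)` are eventually at least `Y τ - ε`
  refine le_of_forall_pos_le_add fun ε hε => ?_
  have hτm : τ ∈ Icc 0 τ := ⟨hτ.le, le_rfl⟩
  obtain ⟨δ, hδ, hYδ⟩ := Metric.continuousOn_iff.1 hYc τ hτm ε hε
  have hev : ∀ᶠ n in atTop, Y τ - ε + ∫ z in cyl Ω τ,
      (inner ℝ (‖G z‖ ^ (p - 2) • G z - ‖H z‖ ^ (p - 2) • H z) (timeAverage (h n) L z) : ℝ) ≤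
      ∫ z in cyl Ω τ, (inner ℝ (lam * (|u z| ^ (p - 2) * u z - |v z| ^ (p - 2) * v z) +
        (f z - g z)) (timeAverage (h n) W z) : ℝ) := by
    filter_upwards [hlim.eventually_lt_const hδ] with n hn
    refine le_trans (add_le_add ?_ le_rfl) (hstep n)
    have hsub : Ioo (τ - h n) τ ⊆ Icc 0 τ := fun t ht => by
      have := hlt n
      exact ⟨by linarith [ht.1], ht.2.le⟩
    have hYi : IntegrableOn Y (Ioo (τ - h n) τ) :=
      (hYc.integrableOn_compact isCompact_Icc).mono_set hsub
    have h1 : ∫ t in Ioo (τ - h n) τ, (Y τ - ε) ≤ ∫ t in Ioo (τ - h n) τ, Y t := by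
      refine setIntegral_mono_on (integrableOn_const (by simp)) hYi measurableSet_Ioo
        fun t ht => ?_
      have h2 := hYδ t (hsub ht) (by
        rw [Real.dist_eq, abs_sub_comm, abs_of_pos (by linarith [ht.2])]; linarith [ht.1])
      rw [Real.dist_eq] at h2
      linarith [(abs_lt.1 h2).1]
    rw [setIntegral_const, Real.volume_real_Ioo_of_le (by linarith [hpos n]), smul_eq_mul] at h1
    have h3 := mul_le_mul_of_nonneg_left h1 (inv_pos.2 (hpos n)).le
    have h4 : (h n)⁻¹ * ((τ - (τ - h n)) * (Y τ - ε)) = Y τ - ε := by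
      have := (hpos n).ne'
      field_simp; ring
    linarith
  have := le_of_tendsto_of_tendsto (t1.const_add (Y τ - ε)) t2 hev
  linarith

/-! ### Grönwall's inequality and the comparison of solutions -/

/-- Grönwall's inequality in integral form, with vanishing initial value. -/
lemma eq_zero_of_le_mul_integral {Y : ℝ → ℝ} {C T : ℝ} (hT : 0 ≤ T)
    (hY : ContinuousOn Y (Icc 0 T)) (hY0 : ∀ t ∈ Icc 0 T, 0 ≤ Y t)
    (h : ∀ t ∈ Icc 0 T, Y t ≤ C * ∫ s in 0..t, Y s) : ∀ t ∈ Icc 0 T, Y t = 0 := by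
  set X : ℝ → ℝ := fun t => IccExtend hT (domRestrict (Icc 0 T) Y) t with hX
  have hXc : Continuous X := (continuousOn_iff_continuous_domRestrict.1 hY).Icc_extend'
  have hXY : ∀ t ∈ Icc 0 T, X t = Y t := fun t ht => IccExtend_of_mem hT _ ht
  have hint : ∀ t ∈ Icc 0 T, ∫ s in 0..t, Y s = ∫ s in 0..t, X s := fun t ht => by
    refine intervalIntegral.integral_congr fun s hs => ?_
    rw [uIcc_of_le ht.1] at hs
    exact (hXY s ⟨hs.1, hs.2.trans ht.2⟩).symm
  have hX0 : ∀ t, 0 ≤ X t := fun t => hY0 _ (projIcc 0 T hT t).2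
  have hd : ∀ t, HasDerivAt (fun t => ∫ s in 0..t, X s) (X t) t := fun t =>
    (hXc.integral_hasStrictDerivAt 0 t).hasDerivAt
  have hZ := eq_zero_of_abs_deriv_le_mul_abs_self_of_eq_zero_right (a := 0) (b := T) (K := C)
    (fun t _ => (hd t).continuousAt.continuousWithinAt)
    (fun t _ => (hd t).hasDerivWithinAt) (by simp) (fun t ht => by
      have ht' := Ico_subset_Icc_self ht
      rw [Real.norm_of_nonneg (hX0 t), Real.norm_of_nonneg
        (intervalIntegral.integral_nonneg ht.1 fun s _ => hX0 s), hXY t ht', ← hint t ht']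
      exact h t ht')
  intro t ht
  refine le_antisymm ?_ (hY0 t ht)
  have := h t ht
  rwa [hint t ht, hZ t ht, mul_zero] at this

lemma exists_ae_norm_le {α F : Type*} [MeasurableSpace α] [NormedAddCommGroup F] {μ : Measure α}
    {f : α → F} (hf : MemLp f ⊤ μ) : ∃ M : ℝ, ∀ᵐ x ∂μ, ‖f x‖ ≤ M := by
  refine ⟨(eLpNormEssSup f μ).toReal, ?_⟩
  have hlt : eLpNormEssSup f μ < ⊤ := by simpa using hf.2
  filter_upwards [ae_le_eLpNormEssSup (f := f) (μ := μ)] with x hx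
  simpa using ENNReal.toReal_mono hlt.ne hx

lemma ContinuousL2.mono {Ω : Set (RN N)} {τ T : ℝ} {w : RN N × ℝ → ℝ} (hw : ContinuousL2 Ω T w)
    (h : τ ≤ T) : ContinuousL2 Ω τ w where
  memLp t ht := hw.memLp t ⟨ht.1, ht.2.trans h⟩
  tendsto s hs := (hw.tendsto s ⟨hs.1, hs.2.trans h⟩).mono_left
    (nhdsWithin_mono s (Icc_subset_Icc_right h))

/-- Boundary data continuous on the parabolic boundary are measurable for the surface measure. -/
lemma aestronglyMeasurable_surfaceMeasure {Ω : Set (RN N)} {T : ℝ} {h : RN N × ℝ → ℝ}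
    (hh : ContinuousOn h (parabolicBoundary Ω T)) {t : ℝ} (ht : t ∈ Icc 0 T) :
    AEStronglyMeasurable (fun x => h (x, t)) (surfaceMeasure Ω) := by
  refine ContinuousOn.aestronglyMeasurable ?_ isClosed_frontier.measurableSet
  exact hh.comp (by fun_prop) fun x hx => Or.inr ⟨hx, ht⟩

/-- The reaction terms and the sources are controlled by the truncated energy density wherever the
hypotheses on the data hold, with a constant that does not depend on the point. -/
lemma exists_reaction_mul_trunc_le {p lam : ℝ} {f g u v : RN N × ℝ → ℝ} {E : Set (RN N × ℝ)}
    (hfg : ∀ᵐ z ∂(volume.restrict E), f z ≤ g z)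
    (hcase : (1 < p ∧ lam ≤ 0) ∨
      (2 < p ∧ 0 < lam ∧ MemLp u ⊤ (volume.restrict E) ∧ MemLp v ⊤ (volume.restrict E))) :
    ∃ C : ℝ, 0 ≤ C ∧ ∀ᵐ z ∂(volume.restrict E),
      (lam * (|u z| ^ (p - 2) * u z - |v z| ^ (p - 2) * v z) + (f z - g z)) *
        trunc (u z - v z) ≤ C * truncPrim (u z - v z) := by
  rcases hcase with ⟨hp, hlam⟩ | ⟨hp, hlam, hu, hv⟩
  · refine ⟨0, le_rfl, ?_⟩
    filter_upwards [hfg] with z hz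
    rcases le_total (u z) (v z) with h | h
    · rw [trunc_of_nonpos (by linarith)]; simp
    · have h1 := abs_rpow_mul_mono hp h
      have h2 : lam * (|u z| ^ (p - 2) * u z - |v z| ^ (p - 2) * v z) ≤ 0 :=
        mul_nonpos_of_nonpos_of_nonneg hlam (by linarith)
      rw [zero_mul]
      exact mul_nonpos_of_nonpos_of_nonneg (by linarith) (trunc_nonneg _)
  · obtain ⟨M₁, hM₁⟩ := exists_ae_norm_le hu
    obtain ⟨M₂, hM₂⟩ := exists_ae_norm_le hv
    set M := max (max M₁ M₂) 0
    have hM : 0 ≤ (p - 1) * M ^ (p - 2) :=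
      mul_nonneg (by linarith) (Real.rpow_nonneg (le_max_right _ _) _)
    refine ⟨lam * ((p - 1) * M ^ (p - 2)) * 3, by positivity, ?_⟩
    filter_upwards [hfg, hM₁, hM₂] with z hz h₁ h₂
    rcases le_total (u z) (v z) with h | h
    · rw [trunc_of_nonpos (by linarith), truncPrim_of_nonpos (by linarith)]; simp
    · have h1 := abs_rpow_mul_sub_le (M := M) hp
        (h₂.trans ((le_max_right M₁ M₂).trans (le_max_left _ _)))
        (h₁.trans ((le_max_left M₁ M₂).trans (le_max_left _ _))) h
      have h2 := mul_le_mul_of_nonneg_left h1 hlam.le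
      calc _ ≤ (lam * ((p - 1) * M ^ (p - 2) * (u z - v z))) * trunc (u z - v z) :=
            mul_le_mul_of_nonneg_right (by linarith) (trunc_nonneg _)
        _ = lam * ((p - 1) * M ^ (p - 2)) * ((u z - v z) * trunc (u z - v z)) := by ring
        _ ≤ lam * ((p - 1) * M ^ (p - 2)) * (3 * truncPrim (u z - v z)) :=
            mul_le_mul_of_nonneg_left (mul_trunc_le _) (by positivity)
        _ = _ := by ring

/-- The truncated energy of `u - v` at time `τ` is at most a multiple of its integral over the
times before `τ`. -/
lemma energy_le_mul_integral (hN : 1 ≤ N) {Ω : Set (RN N)} (hΩ : IsBoundedLipschitzDomain Ω)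
    {T p lam : ℝ} (hp : 1 < p) {f g : RN N × ℝ → ℝ}
    (hf : MemLp f ⊤ (volume.restrict (cyl Ω T))) (hg : MemLp g ⊤ (volume.restrict (cyl Ω T)))
    {u₀ v₀ : RN N → ℝ} {h₁ h₂ : RN N × ℝ → ℝ} (hh₁ : ContinuousOn h₁ (parabolicBoundary Ω T))
    (hh₂ : ContinuousOn h₂ (parabolicBoundary Ω T)) {u v : RN N × ℝ → ℝ}
    (hu : IsWeakSolution Ω T p lam f u₀ h₁ u) (hv : IsWeakSolution Ω T p lam g v₀ h₂ v)
    (h0 : ∀ᵐ x ∂(volume.restrict Ω), u (x, 0) ≤ v (x, 0))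
    (hlat : ∀ᵐ t ∂(volume.restrict (Ioo 0 T)), ∀ᵐ x ∂(surfaceMeasure Ω), h₁ (x, t) ≤ h₂ (x, t))
    {C : ℝ} (hC : 0 ≤ C)
    (hR : ∀ᵐ z ∂(volume.restrict (cyl Ω T)),
      (lam * (|u z| ^ (p - 2) * u z - |v z| ^ (p - 2) * v z) + (f z - g z)) *
        trunc (u z - v z) ≤ C * truncPrim (u z - v z))
    {τ : ℝ} (hτ : τ ∈ Ioc 0 T) :
    ∫ x in Ω, truncPrim (u (x, τ) - v (x, τ)) ≤
      C * ∫ s in 0..τ, ∫ x in Ω, truncPrim (u (x, s) - v (x, s)) := by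
  obtain ⟨huc, -, G, hG, htu, hwu⟩ := hu
  obtain ⟨hvc, -, H, hH, htv, hwv⟩ := hv
  have hfinΩ : IsFiniteMeasure (volume.restrict Ω) := ⟨by
    simpa using hΩ.isBounded.measure_lt_top⟩
  have hfin : IsFiniteMeasure (volume.restrict (cyl Ω τ)) := by
    rw [volume_restrict_cyl]; infer_instance
  have hq : 1 ≤ ENNReal.ofReal p := by simpa using hp.le
  have hI : Ioo 0 τ ⊆ Ioo 0 T := Ioo_subset_Ioo_right hτ.2
  have hle : volume.restrict (cyl Ω τ) ≤ volume.restrict (cyl Ω T) :=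
    Measure.restrict_mono (prod_mono le_rfl hI) le_rfl
  have hz : ∀ᵐ t ∂(volume.restrict (Ioo 0 T)),
      HasZeroExtensionGradient Ω (fun x => trunc (u (x, t) - v (x, t)))
        (fun x => deriv trunc (u (x, t) - v (x, t)) • (G (x, t) - H (x, t))) := by
    filter_upwards [hG.slice, hH.slice, htu, htv, hlat, ae_restrict_mem measurableSet_Ioo]
      with t hGt hHt h1 h2 h3 ht
    refine hasZeroExtensionGradient_of_trace_le hN hΩ hp.le contDiff_trunc (fun s => ?_)
      (fun s => ?_) hGt.memLp hHt.memLp hGt.memLp_grad hHt.memLp_grad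
      (aestronglyMeasurable_surfaceMeasure hh₁ (Ioo_subset_Icc_self ht))
      (aestronglyMeasurable_surfaceMeasure hh₂ (Ioo_subset_Icc_self ht)) h1 h2 h3
    · rw [abs_of_nonneg (deriv_trunc_nonneg s)]; exact deriv_trunc_le_one s
    · rw [abs_of_nonneg (trunc_nonneg s)]; exact trunc_le s
  have hE := energy_inequality hΩ hp hτ.1 (huc.mono hτ.2) (hvc.mono hτ.2)
    (hG.memLp.mono_measure hle) (hH.memLp.mono_measure hle) (hG.memLp_grad.mono_measure hle)
    (hH.memLp_grad.mono_measure hle) (hf.mono_measure hle) (hg.mono_measure hle) h0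
    (ae_restrict_of_ae_restrict_of_subset hI hz) (hwu τ hτ) (hwv τ hτ)
  -- monotonicity of the `p`-Laplacian
  have hgrad : 0 ≤ ∫ z in cyl Ω τ, (inner ℝ (‖G z‖ ^ (p - 2) • G z - ‖H z‖ ^ (p - 2) • H z)
      (deriv trunc (u z - v z) • (G z - H z)) : ℝ) := by
    refine integral_nonneg fun z => ?_
    rw [Pi.zero_apply, inner_smul_right]
    exact mul_nonneg (deriv_trunc_nonneg _) (inner_norm_rpow_smul_sub_nonneg hp _ _)
  have hBi : Integrable (fun z => truncPrim (u z - v z)) (volume.restrict (cyl Ω τ)) :=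
    integrable_truncPrim
      (((hG.memLp.mono_measure hle).sub (hH.memLp.mono_measure hle)).integrable hq)
  have hreact : ∫ z in cyl Ω τ, (inner ℝ (lam * (|u z| ^ (p - 2) * u z - |v z| ^ (p - 2) * v z) +
        (f z - g z)) (trunc (u z - v z)) : ℝ) ≤
      C * ∫ z in cyl Ω τ, truncPrim (u z - v z) := by
    rw [← integral_const_mul]
    by_cases hi : Integrable (fun z => (inner ℝ (lam * (|u z| ^ (p - 2) * u z -
        |v z| ^ (p - 2) * v z) + (f z - g z)) (trunc (u z - v z)) : ℝ)) (volume.restrict (cyl Ω τ))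
    · refine integral_mono_ae hi (hBi.const_mul C) ?_
      filter_upwards [ae_mono hle hR] with z hz
      simpa [mul_comm] using hz
    -- otherwise the integral on the left is zero by convention
    · rw [integral_undef hi]
      exact integral_nonneg fun z => mul_nonneg hC (truncPrim_nonneg _)
  have hFub : ∫ z in cyl Ω τ, truncPrim (u z - v z) =
      ∫ s in 0..τ, ∫ x in Ω, truncPrim (u (x, s) - v (x, s)) := by
    rw [intervalIntegral.integral_of_le hτ.1.le, integral_Ioc_eq_integral_Ioo]
    rw [volume_restrict_cyl] at hBi ⊢
    exact integral_prod_symm _ hBi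
  rw [← hFub]
  linarith

end PLaplace

theorem theorem2p1 {N : ℕ} (hN : 1 ≤ N) (Ω : Set (PLaplace.RN N))
    (hΩ : PLaplace.IsBoundedLipschitzDomain Ω) (T : ℝ) (hT : 0 < T) (p lam : ℝ)
    (f g : PLaplace.RN N × ℝ → ℝ)
    (hf : MemLp f ⊤ (volume.restrict (PLaplace.cyl Ω T)))
    (hg : MemLp g ⊤ (volume.restrict (PLaplace.cyl Ω T)))
    (u₀ v₀ : PLaplace.RN N → ℝ)
    (hu₀ : MemLp u₀ 2 (volume.restrict Ω) ∧ ∃ G₀, PLaplace.MemW1p Ω p u₀ G₀)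
    (hv₀ : MemLp v₀ 2 (volume.restrict Ω) ∧ ∃ G₀, PLaplace.MemW1p Ω p v₀ G₀)
    (h₁ h₂ : PLaplace.RN N × ℝ → ℝ)
    (hh₁ : ContinuousOn h₁ (PLaplace.parabolicBoundary Ω T))
    (hh₂ : ContinuousOn h₂ (PLaplace.parabolicBoundary Ω T))
    (u v : PLaplace.RN N × ℝ → ℝ)
    (hu : PLaplace.IsWeakSolution Ω T p lam f u₀ h₁ u)
    (hv : PLaplace.IsWeakSolution Ω T p lam g v₀ h₂ v)
    (E : Set (PLaplace.RN N × ℝ)) (hE : E ⊆ PLaplace.cyl Ω T)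
    (hEo : IsOpen E) (hEc : IsConnected E)
    (hfg : ∀ᵐ z ∂(volume.restrict E), f z ≤ g z)
    (hcase : (1 < p ∧ lam ≤ 0) ∨
      (2 < p ∧ 0 < lam ∧ MemLp u ⊤ (volume.restrict E) ∧ MemLp v ⊤ (volume.restrict E)))
    -- `u ≤ v` a.e. in `(closure Ω × [0, T)) \ E`: inside the cylinder, at the initial time,
    -- and on the lateral surface, each with respect to its own measure
    (hint : ∀ᵐ z ∂(volume.restrict (PLaplace.cyl Ω T \ E)), u z ≤ v z)
    (hinit : ∀ᵐ x ∂(volume.restrict Ω), u₀ x ≤ v₀ x)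
    (hlat : ∀ᵐ t ∂(volume.restrict (Ioo 0 T)), ∀ᵐ x ∂(PLaplace.surfaceMeasure Ω),
      h₁ (x, t) ≤ h₂ (x, t)) :
    (∀ᵐ z ∂(volume.restrict E), u z ≤ v z) ∧
      ∀ t ∈ Ioo 0 T, ∀ᵐ x ∂(volume : Measure (PLaplace.RN N)),
        (x, t) ∈ E → u (x, t) ≤ v (x, t) := by
  have hp : 1 < p := by
    rcases hcase with h | h
    · exact h.1
    · linarith [h.1]
  obtain ⟨C, hC, hCE⟩ := PLaplace.exists_reaction_mul_trunc_le (u := u) (v := v) hfg hcase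
  have hCcyl : ∀ᵐ z ∂(volume.restrict (PLaplace.cyl Ω T)),
      (lam * (|u z| ^ (p - 2) * u z - |v z| ^ (p - 2) * v z) + (f z - g z)) *
        PLaplace.trunc (u z - v z) ≤ C * PLaplace.truncPrim (u z - v z) := by
    rw [← union_sdiff_cancel hE]
    refine ae_restrict_union_iff _ _ _ |>.2 ⟨hCE, hint.mono fun z hz => ?_⟩
    -- outside `E` the truncations vanish
    rw [PLaplace.trunc_of_nonpos (by linarith), PLaplace.truncPrim_of_nonpos (by linarith)]
    simp
  have h0 : ∀ᵐ x ∂(volume.restrict Ω), u (x, 0) ≤ v (x, 0) := by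
    filter_upwards [hu.2.1, hv.2.1, hinit] with x h1 h2 h3
    rwa [h1, h2]
  have hzero := PLaplace.eq_zero_of_le_mul_integral (C := C) hT.le
    (PLaplace.continuousOn_energy hΩ hu.1 hv.1)
    (fun t _ => integral_nonneg fun x => PLaplace.truncPrim_nonneg _) (fun t ht => by
      rcases ht.1.eq_or_lt with rfl | h
      · rw [intervalIntegral.integral_same, mul_zero]
        refine (integral_eq_zero_of_ae (h0.mono fun x hx => ?_)).le
        exact PLaplace.truncPrim_of_nonpos (by linarith)
      · exact PLaplace.energy_le_mul_integral hN hΩ hp hf hg hh₁ hh₂ hu hv h0 hlat hC hCcyl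
          ⟨h, ht.2⟩)
  have hslice : ∀ t ∈ Ioo 0 T, ∀ᵐ x ∂(volume.restrict Ω), u (x, t) ≤ v (x, t) := by
    intro t ht
    have ht' := Ioo_subset_Icc_self ht
    have h1 := (integral_eq_zero_iff_of_nonneg (fun x => PLaplace.truncPrim_nonneg _)
      (PLaplace.integrable_truncPrim (hu.1.integrable_sub hΩ hv.1 ht'))).1 (hzero t ht')
    filter_upwards [h1] with x hx
    have := PLaplace.nonpos_of_truncPrim_eq_zero hx
    linarith
  constructor
  · obtain ⟨-, -, G, hG, -, -⟩ := hu
    obtain ⟨-, -, H, hH, -, -⟩ := hv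
    refine ae_restrict_of_ae_restrict_of_subset hE ?_
    have hfin : IsFiniteMeasure (volume.restrict Ω) := ⟨by
      simpa using hΩ.isBounded.measure_lt_top⟩
    have hfin' : IsFiniteMeasure (volume.restrict (PLaplace.cyl Ω T)) := by
      rw [PLaplace.volume_restrict_cyl]; infer_instance
    have hi := PLaplace.integrable_truncPrim
      ((hG.memLp.sub hH.memLp).integrable (by simpa using hp.le))
    have h1 : ∫ z in PLaplace.cyl Ω T, PLaplace.truncPrim (u z - v z) = 0 := by
      rw [PLaplace.volume_restrict_cyl] at hi ⊢
      refine (integral_prod_symm _ hi).trans ?_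
      exact setIntegral_eq_zero_of_forall_eq_zero fun t ht => hzero t (Ioo_subset_Icc_self ht)
    filter_upwards [(integral_eq_zero_iff_of_nonneg
      (fun z => PLaplace.truncPrim_nonneg _) hi).1 h1] with z hz
    have := PLaplace.nonpos_of_truncPrim_eq_zero hz
    simp only [Pi.sub_apply] at this
    linarith
  · intro t ht
    have := hslice t ht
    rw [ae_restrict_iff' hΩ.isOpen.measurableSet] at this
    exact this.mono fun x hx hxE => hx (hE hxE).1
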